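/- Let $k$ be an algebraically closed field. For a $k$-scheme $X$ of finite type let $\mathcal{L}X$ be its arc space, the $k$-scheme with $\mathcal{L}X(R)=X(R[[t]])$ for every $k$-algebra $R$. For a closed subscheme $Z\subseteq X$ with ideal sheaf $I_Z$ and $d\in\mathbb{N}$, let $\mathcal{L}X^{\le d}_Z\subseteq\mathcal{L}X$ be the open subscheme whose points are the arcs $\gamma$ whose truncation modulo $t^{d+1}$ is not contained in $Z$ (equivalently, $\gamma^{-1}I_Z\not\subseteq (t^{d+1})$), and let $\mathcal{L}X^{=d}_Z$ be the closed subscheme of $\mathcal{L}X^{\le d}_Z$ representing the arcs with $\gamma^{-1}I_Z\subseteq (t^{d})$. Write $\mathbb{A}^{\mathbb{N}}=\operatorname{Spec} k[x_1,x_2,\dots]$. (a) Let $X$ be a reduced $k$-scheme of finite type, pure of dimension $n\ge 1$ (every irreducible component of $X$ has dimension $n$), and let $\mathcal{L}X^{\le d}=\mathcal{L}X^{\le d}_Z$, where $Z$ is the Jacobian subscheme of $X$, defined by the Fitting ideal $\operatorname{Fitt}_n(\Omega_{X/k})$. Then for every $d\in\mathbb{N}$ the scheme $\mathcal{L}X^{\le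 d}$ admits a finite constructible stratification whose strata are isomorphic over $k$ to schemes of the form $H\times\mathbb{A}^{\mathbb{N}}$ with $H$ a $k$-scheme of finite type. That is, there are finitely many immersions of finite presentation $S_1,\dots,S_r\to\mathcal{L}X^{\le d}$ whose (constructible, locally closed) images form a partition of $\mathcal{L}X^{\le d}$, with $\overline{S_i}\subseteq\bigcup_{j\le i}S_j$ for all $i$, and for every $i$ there is a $k$-scheme $H_i$ of finite type with $S_i\simeq H_i\times\mathbb{A}^{\mathbb{N}}$ over $k$. (b) Let $m,l\ge 0$, let $p_1,\dots,p_l\in k[x_1,\dots,x_m,y_1,\dots,y_l]$, let $X=\operatorname{Spec} k[x_1,\dots,x_m,y_1,\dots,y_l]/(p_1,\dots,p_l)$ (a special complete intersection), and let $\mathcal{L}X^{=d}=\mathcal{L}X^{=d}_Z$, where $Z$ is the closed subscheme of $X$ defined by $\det(\partial p_i/\partial y_j)$. Then for every $d\in\mathbb{N}$ there is a $k$-scheme $D_d$ of finite type such that $\mathcal{L}X^{=d}\simeq D_d\times_k\mathcal{L}\mathbb{A}^m$ over $k$. -/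

import Mathlib

universe u

open CategoryTheory CategoryTheory.Limits AlgebraicGeometry

noncomputable section

namespace ArcSpaces

/-! ### The algebra of arcs of an affine scheme -/

section ArcAlgebra

variable {k : Type u} [CommRing k] {A B : Type u} [CommRing A] [CommRing B]

/-- The relations between the variables `a⁽ⁱ⁾ = X (a, i)`, for `a : A` and `i : ℕ`, which say that
`a ↦ ∑ a⁽ⁱ⁾ tⁱ` is a homomorphism of `k`-algebras lifting `a ↦ a⁽⁰⁾ = a`, and that it maps the
elements of the ideal `I` to series divisible by `t ^ e`. -/
inductive ArcRel (φ : k →+* A) (I : Ideal A) (e : ℕ) : MvPolynomial (A × ℕ) A → Prop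
  | zero (a : A) : ArcRel φ I e (.X (a, 0) - .C a)
  | const (c : k) (i : ℕ) : ArcRel φ I e (.X (φ c, i + 1))
  | add (a b : A) (i : ℕ) : ArcRel φ I e (.X (a + b, i) - (.X (a, i) + .X (b, i)))
  | mul (a b : A) (i : ℕ) : ArcRel φ I e
      (.X (a * b, i) - ∑ p ∈ Finset.HasAntidiagonal.antidiagonal i, .X (a, p.1) * .X (b, p.2))
  | contact (g : A) (hg : g ∈ I) (i : ℕ) (hi : i < e) : ArcRel φ I e (.X (g, i))

/-- For a `k`-algebra `φ : k → A` and an ideal `I` of `A`, the algebra whose homomorphisms of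
`k`-algebras to `R` are the homomorphisms of `k`-algebras `γ : A → R[[t]]` with `γ(I) ⊆ (t ^ e)`.
For `e = 0` (or `I = ⊥`) there is no condition on `γ`, and this is the algebra of all arcs. -/
def ArcAlgebra (φ : k →+* A) (I : Ideal A) (e : ℕ) : Type u :=
  MvPolynomial (A × ℕ) A ⧸ Ideal.span {p | ArcRel φ I e p}

instance (φ : k →+* A) (I : Ideal A) (e : ℕ) : CommRing (ArcAlgebra φ I e) :=
  inferInstanceAs (CommRing (MvPolynomial (A × ℕ) A ⧸ _))

namespace ArcAlgebra

variable (φ : k →+* A) (I : Ideal A) (e : ℕ)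

/-- The `i`-th coefficient `a⁽ⁱ⁾` of the universal arc, evaluated at the function `a`. -/
def coeff (a : A) (i : ℕ) : ArcAlgebra φ I e :=
  Ideal.Quotient.mk _ (.X (a, i))

/-- The map `A → ArcAlgebra φ I e` given by the origin of arcs. -/
def of : A →+* ArcAlgebra φ I e :=
  (Ideal.Quotient.mk _).comp MvPolynomial.C

lemma mk_eq_zero_of_rel {p : MvPolynomial (A × ℕ) A} (hp : ArcRel φ I e p) :
    (Ideal.Quotient.mk (Ideal.span {p | ArcRel φ I e p}) p) = 0 :=
  Ideal.Quotient.eq_zero_iff_mem.mpr (Ideal.subset_span hp)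

lemma coeff_zero_right (a : A) : coeff φ I e a 0 = of φ I e a := by
  have := mk_eq_zero_of_rel φ I e (.zero a)
  rwa [map_sub, sub_eq_zero] at this

lemma coeff_const (c : k) (i : ℕ) : coeff φ I e (φ c) (i + 1) = 0 :=
  mk_eq_zero_of_rel φ I e (.const c i)

lemma coeff_add (a b : A) (i : ℕ) :
    coeff φ I e (a + b) i = coeff φ I e a i + coeff φ I e b i := by
  have := mk_eq_zero_of_rel φ I e (.add a b i)
  rwa [map_sub, sub_eq_zero, map_add] at this

lemma coeff_mul (a b : A) (i : ℕ) : coeff φ I e (a * b) i =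
    ∑ p ∈ Finset.HasAntidiagonal.antidiagonal i, coeff φ I e a p.1 * coeff φ I e b p.2 := by
  have := mk_eq_zero_of_rel φ I e (.mul a b i)
  simp only [map_sub, sub_eq_zero, map_sum, map_mul] at this
  exact this

lemma coeff_contact {g : A} (hg : g ∈ I) {i : ℕ} (hi : i < e) : coeff φ I e g i = 0 :=
  mk_eq_zero_of_rel φ I e (.contact g hg i hi)

/-- The universal arc `a ↦ ∑ a⁽ⁱ⁾ tⁱ`. -/
def univ : A →+* PowerSeries (ArcAlgebra φ I e) where
  toFun a := PowerSeries.mk (coeff φ I e a)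
  map_one' := by
    ext i
    have h : (1 : A) = φ 1 := by simp
    rcases i with _ | i
    · simp [coeff_zero_right]
    · rw [PowerSeries.coeff_mk, h, coeff_const]
      simp [PowerSeries.coeff_one]
  map_zero' := by
    ext i
    have := coeff_add φ I e 0 0 i
    simpa using this
  map_add' a b := by ext i; simp [coeff_add]
  map_mul' a b := by ext i; simp [coeff_mul, PowerSeries.coeff_mul]

variable {R : Type u} [CommRing R]

/-- The homomorphism from the algebra of arcs to `R` defined by an arc `γ : A → R[[t]]`. -/
def lift (γ : A →+* PowerSeries R)
    (hk : ∀ c i, PowerSeries.coeff (i + 1) (γ (φ c)) = 0)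
    (hI : ∀ g ∈ I, PowerSeries.X ^ e ∣ γ g) : ArcAlgebra φ I e →+* R :=
  Ideal.Quotient.lift _
    (MvPolynomial.eval₂Hom (PowerSeries.constantCoeff.comp γ)
      fun p ↦ PowerSeries.coeff p.2 (γ p.1)) <| by
    change ∀ a ∈ Ideal.span _, a ∈ RingHom.ker _
    rw [← SetLike.le_def, Ideal.span_le]
    rintro p (a | ⟨c, i⟩ | ⟨a, b, i⟩ | ⟨a, b, i⟩ | ⟨g, hg, i, hi⟩)
    · simp [RingHom.mem_ker]
    · simp [RingHom.mem_ker, hk]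
    · simp [RingHom.mem_ker]
    · simp [RingHom.mem_ker, PowerSeries.coeff_mul]
    · simpa [RingHom.mem_ker] using PowerSeries.X_pow_dvd_iff.mp (hI g hg) i hi

section lift

variable (γ : A →+* PowerSeries R) (hk : ∀ c i, PowerSeries.coeff (i + 1) (γ (φ c)) = 0)
  (hI : ∀ g ∈ I, PowerSeries.X ^ e ∣ γ g)

@[simp]
lemma lift_coeff (a : A) (i : ℕ) :
    lift φ I e γ hk hI (coeff φ I e a i) = PowerSeries.coeff i (γ a) := by
  refine (Ideal.Quotient.lift_mk _ _ _).trans ?_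
  simp

@[simp]
lemma lift_of (a : A) :
    lift φ I e γ hk hI (of φ I e a) = PowerSeries.constantCoeff (γ a) := by
  rw [← coeff_zero_right, lift_coeff, PowerSeries.coeff_zero_eq_constantCoeff_apply]

end lift

variable {φ I e} in
lemma hom_ext {f g : ArcAlgebra φ I e →+* R}
    (h : ∀ a i, f (coeff φ I e a i) = g (coeff φ I e a i)) : f = g := by
  refine Ideal.Quotient.ringHom_ext (MvPolynomial.ringHom_ext (fun a ↦ ?_) fun p ↦ h p.1 p.2)
  have := h a 0
  rwa [coeff_zero_right] at this

lemma X_pow_dvd_univ {g : A} (hg : g ∈ I) : PowerSeries.X ^ e ∣ univ φ I e g :=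
  PowerSeries.X_pow_dvd_iff.mpr fun i hi ↦ by
    simpa [univ] using coeff_contact φ I e hg hi

/-- Functoriality of the algebra of arcs: `a⁽ⁱ⁾ ↦ (ρ a)⁽ⁱ⁾`. -/
def map {φ : k →+* A} {I : Ideal A} {e : ℕ} {ψ : k →+* B} {J : Ideal B} {e' : ℕ}
    (ρ : A →+* B) (hρ : ρ.comp φ = ψ) (hI : I ≤ J.comap ρ) (he : e ≤ e') :
    ArcAlgebra φ I e →+* ArcAlgebra ψ J e' :=
  lift φ I e ((univ ψ J e').comp ρ)
    (fun c i ↦ by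
      have : ρ (φ c) = ψ c := congr($hρ c)
      simp [univ, this, coeff_const])
    (fun g hg ↦ (pow_dvd_pow _ he).trans (X_pow_dvd_univ ψ J e' (hI hg)))

section map

variable {φ I e} {ψ : k →+* B} {J : Ideal B} {e' : ℕ}
    (ρ : A →+* B) (hρ : ρ.comp φ = ψ) (hI : I ≤ J.comap ρ) (he : e ≤ e')

@[simp]
lemma map_coeff (a : A) (i : ℕ) :
    map ρ hρ hI he (coeff φ I e a i) = coeff ψ J e' (ρ a) i := by
  simp [map, univ]

@[simp]
lemma map_of (a : A) : map ρ hρ hI he (of φ I e a) = of ψ J e' (ρ a) := by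
  rw [← coeff_zero_right, map_coeff, coeff_zero_right]

end map

/-- The arc of `B` induced by an arc of `A` whose origin factors through the localization `B`. -/
lemma exists_arc_of_isLocalization (ρ : A →+* B) (f : A)
    (hloc : letI := ρ.toAlgebra; IsLocalization.Away f B)
    (γ : A →+* PowerSeries R) (b : B →+* R)
    (hb : ∀ a, b (ρ a) = PowerSeries.constantCoeff (γ a)) :
    ∃ δ : B →+* PowerSeries R, (∀ a, δ (ρ a) = γ a) ∧
      ∀ x, PowerSeries.constantCoeff (δ x) = b x := by
  let := ρ.toAlgebra
  have hloc : IsLocalization.Away f B := hloc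
  have hf : IsUnit (γ f) := by
    rw [PowerSeries.isUnit_iff_constantCoeff, ← hb]
    exact (IsLocalization.Away.algebraMap_isUnit (S := B) f).map b
  refine ⟨IsLocalization.Away.lift f hf, fun a ↦ IsLocalization.Away.lift_eq f hf a, fun x ↦ ?_⟩
  have : PowerSeries.constantCoeff.comp (IsLocalization.Away.lift (S := B) f hf) = b := by
    refine IsLocalization.ringHom_ext (Submonoid.powers f) ?_
    ext a
    simpa using! (hb a).symm
  exact congr($this x)

/-- The formation of the algebra of arcs commutes with localization. -/
lemma isPushout_map {ψ : k →+* B} {J : Ideal B}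
    (ρ : A →+* B) (hρ : ρ.comp φ = ψ) (hIJ : I.map ρ = J) (f : A)
    (hloc : letI := ρ.toAlgebra; IsLocalization.Away f B) :
    IsPushout (CommRingCat.ofHom ρ) (CommRingCat.ofHom (of φ I e))
      (CommRingCat.ofHom (of ψ J e))
      (CommRingCat.ofHom (map (e' := e) ρ hρ (Ideal.map_le_iff_le_comap.mp hIJ.le) le_rfl)) := by
  let := ρ.toAlgebra
  have hloc : IsLocalization.Away f B := hloc
  have key (s : PushoutCocone (CommRingCat.ofHom ρ) (CommRingCat.ofHom (of φ I e))) :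
      ∃ δ : ArcAlgebra ψ J e →+* s.pt, (∀ x, δ (of ψ J e x) = s.inl.hom x) ∧
        ∀ a i, δ (coeff ψ J e (ρ a) i) = s.inr.hom (coeff φ I e a i) := by
    obtain ⟨δ, h₁, h₂⟩ := exists_arc_of_isLocalization ρ f hloc
      ((PowerSeries.map s.inr.hom).comp (univ φ I e)) s.inl.hom fun a ↦ by
        refine congr($(s.condition) a).trans ?_
        simp [univ, ← PowerSeries.coeff_zero_eq_constantCoeff_apply, coeff_zero_right]
    refine ⟨lift ψ J e δ (fun c i ↦ ?_) (fun g hg ↦ ?_), fun x ↦ ?_, fun a i ↦ ?_⟩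
    · have : ψ c = ρ (φ c) := congr($hρ c).symm
      rw [this, h₁]
      simp [univ, coeff_const]
    · subst hIJ
      obtain ⟨⟨a, s⟩, h⟩ := (IsLocalization.mem_map_algebraMap_iff (Submonoid.powers f) B).mp hg
      have h' : g * ρ s = ρ a := h
      have hs : IsUnit (δ (ρ s)) :=
        (IsLocalization.map_units B s : IsUnit (algebraMap A B s)).map δ
      rw [← hs.dvd_mul_right, ← map_mul, h', h₁]
      obtain ⟨q, hq⟩ := X_pow_dvd_univ φ I e a.2
      simp [hq]
    · simp [h₂]
    · simp [h₁, univ]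
  choose δ hδ₁ hδ₂ using key
  refine ⟨⟨?_⟩, ⟨PushoutCocone.IsColimit.mk _ (fun s ↦ CommRingCat.ofHom (δ s))
    (fun s ↦ ?_) (fun s ↦ ?_) (fun s m h₁ h₂ ↦ ?_)⟩⟩
  · ext a
    simp
  · ext x
    exact hδ₁ s x
  · ext : 1
    refine hom_ext fun a i ↦ ?_
    simp [hδ₂]
  · have : (PowerSeries.map m.hom).comp (univ ψ J e) = (PowerSeries.map (δ s)).comp (univ ψ J e) := by
      refine IsLocalization.ringHom_ext (R := A) (Submonoid.powers f) ?_
      ext a i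
      have := congr($h₂ (coeff φ I e a i))
      simp only [CommRingCat.hom_comp, CommRingCat.hom_ofHom, RingHom.comp_apply, map_coeff] at this
      have h : m.hom (coeff ψ J e (ρ a) i) = δ s (coeff ψ J e (ρ a) i) := this.trans (hδ₂ s a i).symm
      simpa [univ] using! h
    ext : 1
    refine hom_ext fun x i ↦ ?_
    simpa [univ] using congr(PowerSeries.coeff i ($this x))

end ArcAlgebra

end ArcAlgebra

/-! ### Fitting ideals -/

section Fitting

variable {A : Type*} [CommRing A] {M : Type*} [AddCommGroup M] [Module A M]

/-- The `j`-th Fitting ideal of a finitely generated module `M`: the ideal generated by the minors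
of size `p ≥ r - j` of the matrices of relations between `r` generators of `M`. (The minors of size
`p > r - j` are linear combinations of those of size `r - j`, and one could fix the generators.) -/
def fittingIdeal (A : Type*) [CommRing A] (M : Type*) [AddCommGroup M] [Module A M] (j : ℕ) :
    Ideal A :=
  Ideal.span {x | ∃ (r p : ℕ) (v : Fin r → M) (ρ : Matrix (Fin p) (Fin r) A) (c : Fin p → Fin r),
    r ≤ p + j ∧ Submodule.span A (Set.range v) = ⊤ ∧ (∀ i, ∑ l, ρ i l • v l = 0) ∧
    x = (ρ.submatrix id c).det}

lemma det_mem_fittingIdeal {ι κ : Type*} [Fintype ι] [Fintype κ] [DecidableEq κ] {j : ℕ}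
    (hj : Fintype.card ι ≤ Fintype.card κ + j) (v : ι → M)
    (hv : Submodule.span A (Set.range v) = ⊤) (ρ : Matrix κ ι A)
    (hρ : ∀ i, ∑ l, ρ i l • v l = 0) (c : κ → ι) :
    (ρ.submatrix id c).det ∈ fittingIdeal A M j := by
  let a := Fintype.equivFin ι
  let b := Fintype.equivFin κ
  refine Ideal.subset_span ⟨_, _, v ∘ a.symm, ρ.submatrix b.symm a.symm, a ∘ c ∘ b.symm, hj,
    ?_, fun i ↦ ?_, ?_⟩
  · rwa [EquivLike.range_comp]
  · exact (a.symm.sum_comp fun l ↦ ρ (b.symm i) l • v l).trans (hρ _)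
  · rw [← Matrix.det_submatrix_equiv_self b.symm]
    congr 1
    ext
    simp

lemma det_mem_map_fittingIdeal (S : Submonoid A) (B : Type*) [CommRing B] [Algebra A B]
    [IsLocalization S B] {N : Type*} [AddCommGroup N] [Module A N] [Module B N]
    [IsScalarTower A B N] (g : M →ₗ[A] N) [IsLocalizedModule S g]
    {ι κ : Type*} [Fintype ι] [Fintype κ] [DecidableEq κ] {j : ℕ}
    (hj : Fintype.card ι ≤ Fintype.card κ + j) (v : ι → M)
    (hv : Submodule.span A (Set.range v) = ⊤) (ρ : Matrix κ ι B)
    (hρ : ∀ i, ∑ l, ρ i l • g (v l) = 0) (c : κ → ι) :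
    (ρ.submatrix id c).det ∈ (fittingIdeal A M j).map (algebraMap A B) := by
  have h (i : κ) : ∃ (s : S) (a : ι → A), (∀ l, algebraMap A B (a l) = algebraMap A B s * ρ i l) ∧
      ∑ l, a l • v l = 0 := by
    obtain ⟨s, hs⟩ := IsLocalization.exist_integer_multiples_of_finite S (ρ i)
    choose a ha using hs
    have h0 : g (∑ l, a l • v l) = g 0 := by
      have : ∀ l, g (a l • v l) = s • (ρ i l • g (v l)) := fun l ↦ by
        rw [map_smul, ← algebraMap_smul B (a l), ha, Algebra.smul_def, mul_smul, algebraMap_smul]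
        rfl
      rw [map_sum, Finset.sum_congr rfl fun l _ ↦ this l, ← Finset.smul_sum, hρ, smul_zero,
        map_zero]
    obtain ⟨s', hs'⟩ := IsLocalizedModule.exists_of_eq (S := S) h0
    refine ⟨s' * s, fun l ↦ s' * a l, fun l ↦ ?_, ?_⟩
    · rw [map_mul, ha, Algebra.smul_def, Submonoid.coe_mul, map_mul, mul_assoc]
    · simp only [mul_smul, ← Finset.smul_sum]
      simpa [Submonoid.smul_def] using hs'
  choose s a ha ha' using h
  have h₁ := Ideal.mem_map_of_mem (algebraMap A B)
    (det_mem_fittingIdeal hj v hv (Matrix.of a) ha' c)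
  have h₂ : algebraMap A B ((Matrix.of a).submatrix id c).det =
      (∏ i, algebraMap A B (s i)) * (ρ.submatrix id c).det := by
    rw [RingHom.map_det, ← Matrix.det_mul_column]
    congr 1
    ext i l
    simp [ha]
  rw [h₂] at h₁
  have hu : IsUnit (∏ i, algebraMap A B (s i)) :=
    IsUnit.prod_iff.mpr fun i _ ↦ IsLocalization.map_units B (s i)
  exact (Ideal.unit_mul_mem_iff_mem _ hu).mp h₁

/-- The formation of Fitting ideals commutes with localization. -/
lemma map_fittingIdeal (S : Submonoid A) (B : Type*) [CommRing B] [Algebra A B]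
    [IsLocalization S B] {N : Type*} [AddCommGroup N] [Module A N] [Module B N]
    [IsScalarTower A B N] (g : M →ₗ[A] N) [IsLocalizedModule S g]
    [Module.Finite A M] (j : ℕ) :
    (fittingIdeal A M j).map (algebraMap A B) = fittingIdeal B N j := by
  apply le_antisymm
  · refine Ideal.map_le_iff_le_comap.mpr (Ideal.span_le.mpr ?_)
    rintro _ ⟨r, p, v, ρ, c, hj, hv, hρ, rfl⟩
    refine Ideal.subset_span ⟨r, p, g ∘ v, ρ.map (algebraMap A B), c, hj, ?_, fun i ↦ ?_, ?_⟩
    · have := span_eq_top_of_isLocalizedModule B S g hv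
      rwa [Set.range_comp]
    · simpa using congr(g $(hρ i))
    · rw [RingHom.map_det]
      rfl
  · refine Ideal.span_le.mpr ?_
    rintro _ ⟨r, p, w, ρ, c, hj, hw, hρ, rfl⟩
    obtain ⟨n, u, hu⟩ := Module.Finite.exists_fin (R := A) (M := M)
    choose x hx using fun l ↦ IsLocalizedModule.surj S g (w l)
    have ht (l) : IsUnit (algebraMap A B (x l).2) := IsLocalization.map_units B (x l).2
    choose t ht using ht
    have hwx (l) : w l = (↑(t l)⁻¹ : B) • g (x l).1 := by
      rw [← hx, Submonoid.smul_def, ← algebraMap_smul B (((x l).2 : S) : A) (w l), ← ht, smul_smul, Units.inv_mul, one_smul]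
    have hκ (b) : ∃ κ : Fin r → B, ∑ l, κ l • w l = g (u b) := by
      have : g (u b) ∈ Submodule.span B (Set.range w) := hw ▸ Submodule.mem_top
      exact (Submodule.mem_span_range_iff_exists_fun B).mp this
    choose κ hκ using hκ
    let P : Matrix (Fin p ⊕ Fin n) (Fin r ⊕ Fin n) B :=
      Matrix.fromBlocks (.of fun i l ↦ ρ i l * ↑(t l)⁻¹) 0 (.of fun b l ↦ -(κ b l * ↑(t l)⁻¹)) 1
    have h := det_mem_map_fittingIdeal (j := j) S B g (by simp; omega)
      (Sum.elim (fun l ↦ (x l).1) u)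
      (top_le_iff.mp (hu.ge.trans (Submodule.span_mono (by
        rintro _ ⟨b, rfl⟩; exact ⟨.inr b, rfl⟩)))) P (by
        rintro (i | b)
        · simp [P, mul_smul, ← hwx, hρ]
        · simp [P, mul_smul, ← hwx, hκ, Matrix.one_apply]) (Sum.map c id)
    have hP : (P.submatrix id (Sum.map c id)).det =
        (∏ l, (↑(t (c l))⁻¹ : B)) * (ρ.submatrix id c).det := by
      have : P.submatrix id (Sum.map c id) = Matrix.fromBlocks
          (.of fun i l ↦ ↑(t (c l))⁻¹ * ρ.submatrix id c i l) 0
          (.of fun b l ↦ -(κ b (c l) * ↑(t (c l))⁻¹)) 1 := by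
        ext (i | i) (l | l) <;> simp [P, mul_comm]
      rw [this, Matrix.det_fromBlocks_zero₁₂, Matrix.det_one, mul_one, Matrix.det_mul_row]
    rw [hP] at h
    exact (Ideal.unit_mul_mem_iff_mem _
      (IsUnit.prod_iff.mpr fun l _ ↦ Units.isUnit _)).mp h

end Fitting

/-! ### The arc space of a scheme -/

section ArcSpace

open Scheme Scheme.AffineZariskiSite Opposite

variable {k : Type u} [CommRing k] {X : Scheme.{u}} (f : X ⟶ Spec (.of k))

/-- The `k`-algebra structure on the sections of a `k`-scheme over an open subset. -/
def constants (U : X.Opens) : k →+* Γ(X, U) :=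
  ((Scheme.ΓSpecIso (.of k)).inv ≫ f.appLE ⊤ U (le_top.trans_eq f.preimage_top.symm)).hom

lemma map_constants {U V : X.Opens} (h : V ≤ U) :
    (X.presheaf.map (homOfLE h).op).hom.comp (constants f U) = constants f V := by
  rw [constants, ← CommRingCat.hom_comp, Category.assoc, Scheme.Hom.appLE_map, constants]

variable (Z : X.IdealSheafData) (e : ℕ)

/-- The algebra of the arcs of the affine open subset `U` of `X` which have contact order at least
`e` with the closed subscheme `Z`. -/
abbrev arcAlgebra (U : X.AffineZariskiSite) : Type u :=
  ArcAlgebra (constants f U.1) (Z.ideal U) e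

/-- The restriction maps of the algebras of arcs. -/
def arcRes {U V : X.AffineZariskiSite} (h : V.1 ≤ U.1) :
    arcAlgebra f Z e U →+* arcAlgebra f Z e V :=
  ArcAlgebra.map (X.presheaf.map (homOfLE h).op).hom (map_constants f h)
    (Z.ideal_le_comap_ideal h) le_rfl

lemma arcRes_coeff {U V : X.AffineZariskiSite} (h : V.1 ≤ U.1) (a : Γ(X, U.1)) (i : ℕ) :
    arcRes f Z e h (ArcAlgebra.coeff _ _ e a i) =
      ArcAlgebra.coeff _ _ e ((X.presheaf.map (homOfLE h).op).hom a) i :=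
  ArcAlgebra.map_coeff _ (map_constants f h) (Z.ideal_le_comap_ideal h) le_rfl a i

lemma arcRes_of {U V : X.AffineZariskiSite} (h : V.1 ≤ U.1) (a : Γ(X, U.1)) :
    arcRes f Z e h (ArcAlgebra.of _ _ e a) =
      ArcAlgebra.of _ _ e ((X.presheaf.map (homOfLE h).op).hom a) :=
  ArcAlgebra.map_of _ (map_constants f h) (Z.ideal_le_comap_ideal h) le_rfl a

lemma arcRes_self (U : X.AffineZariskiSite) : arcRes f Z e (le_refl U.1) = RingHom.id _ :=
  ArcAlgebra.hom_ext fun a i ↦ by rw [arcRes_coeff]; simp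

lemma arcRes_comp {U V W : X.AffineZariskiSite} (h : V.1 ≤ U.1) (h' : W.1 ≤ V.1) :
    (arcRes f Z e h').comp (arcRes f Z e h) = arcRes f Z e (h'.trans h) :=
  ArcAlgebra.hom_ext fun a i ↦ by
    have : (X.presheaf.map (homOfLE (h'.trans h)).op).hom a =
        (X.presheaf.map (homOfLE h').op).hom ((X.presheaf.map (homOfLE h).op).hom a) := by
      rw [← CommRingCat.comp_apply, ← Functor.map_comp]
      rfl
    rw [RingHom.comp_apply, arcRes_coeff, arcRes_coeff, arcRes_coeff, this]

/-- The `𝒪_X`-algebra `U ↦ ArcAlgebra (𝒪_X(U)) (I_Z(U)) e` on the affine open subsets of `X`. -/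
def arcPresheaf : X.AffineZariskiSiteᵒᵖ ⥤ CommRingCat.{u} where
  obj U := .of (arcAlgebra f Z e U.unop)
  map i := CommRingCat.ofHom (arcRes f Z e (toOpens_mono i.unop.le))
  map_id U := by rw [arcRes_self]; rfl
  map_comp p q := by rw [← CommRingCat.ofHom_comp, arcRes_comp]

/-- The structure map of the `𝒪_X`-algebra `arcPresheaf f Z e`. -/
def arcPresheafOf : (toOpensFunctor X).op ⋙ X.presheaf ⟶ arcPresheaf f Z e where
  app U := CommRingCat.ofHom (ArcAlgebra.of _ _ e)
  naturality U V i := by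
    ext a
    exact (arcRes_of f Z e (toOpens_mono i.unop.le) a).symm

lemma coequifibered_arcPresheafOf : (arcPresheafOf f Z e).Coequifibered := by
  rintro ⟨V⟩ ⟨U⟩ ⟨g, hg⟩
  obtain rfl : V.basicOpen g = U := Subtype.ext hg
  exact ArcAlgebra.isPushout_map (constants f V.1) (Z.ideal V) e _
    (map_constants f (X.basicOpen_le g)) (Z.map_ideal_basicOpen V g) g
    (V.2.isLocalization_basicOpen g)

/-- The quotient map from the algebra of arcs of `U` to the algebra of arcs of contact order at least
`e` with `Z`. -/
def forgetContact (U : X.AffineZariskiSite) : arcAlgebra f ⊥ 0 U →+* arcAlgebra f Z e U :=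
  ArcAlgebra.map (RingHom.id _) rfl bot_le e.zero_le

lemma forgetContact_coeff (U : X.AffineZariskiSite) (a : Γ(X, U.1)) (i : ℕ) :
    forgetContact f Z e U (ArcAlgebra.coeff _ _ 0 a i) = ArcAlgebra.coeff _ _ e a i :=
  ArcAlgebra.map_coeff _ _ _ _ a i

lemma arcRes_comp_forgetContact {U V : X.AffineZariskiSite} (h : V.1 ≤ U.1) :
    (arcRes f Z e h).comp (forgetContact f Z e U) =
      (forgetContact f Z e V).comp (arcRes f ⊥ 0 h) :=
  ArcAlgebra.hom_ext fun a j ↦ by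
    rw [RingHom.comp_apply, RingHom.comp_apply, forgetContact_coeff, arcRes_coeff, arcRes_coeff,
      forgetContact_coeff]

/-- The gluing datum of the schemes `Spec (ArcAlgebra (𝒪_X(U)) (I_Z(U)) e)` over the affine open
subsets `U` of `X`. -/
def arcGluingData : (directedCover X).RelativeGluingData :=
  relativeGluingData (coequifibered_arcPresheafOf f Z e)

instance : ((arcGluingData f Z e).functor ⋙ Scheme.forget).IsLocallyDirected :=
  Cover.RelativeGluingData.instIsLocallyDirectedI₀CompFunctorForgetOfIsThin ..

instance {U V : X.AffineZariskiSite} (i : U ⟶ V) :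
    IsOpenImmersion ((arcGluingData f Z e).functor.map i) :=
  Cover.RelativeGluingData.instIsOpenImmersionMapI₀Functor ..

/-- The closed subscheme of the arc space of `X` formed by the arcs which have contact order at
least `e` with the closed subscheme `Z` of `X`: for a `k`-algebra `R`, its `R`-points are the
`R`-arcs `γ : Spec R[[t]] → X` such that `γ⁻¹ I_Z ⊆ (t ^ e)`. -/
def contactGE : Scheme.{u} := (arcGluingData f Z e).glued

/-- The origin of arcs. -/
def contactGE.toBase : contactGE f Z e ⟶ X := (arcGluingData f Z e).toBase

/-- The arc space of a `k`-scheme `X`: for a `k`-algebra `R`, its `R`-points are the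
`R`-arcs `Spec R[[t]] → X`. It is glued from the spectra of the algebras of arcs of the affine open
subsets of `X`. -/
def arcSpace : Scheme.{u} := contactGE f ⊥ 0

/-- The structure map of the arc space over `k`. -/
def arcSpace.toSpec : arcSpace f ⟶ Spec (.of k) := contactGE.toBase f ⊥ 0 ≫ f

/-- The open subset of the arc space lying over the affine open subset `U` of `X`, as the spectrum
of the algebra of arcs of `U`. -/
def arcChart (U : X.AffineZariskiSite) : Spec (.of (arcAlgebra f ⊥ 0 U)) ⟶ arcSpace f :=
  (arcGluingData f ⊥ 0).cover.f U

lemma contactGE.ι_naturality {U V : X.AffineZariskiSite} (h : U ≤ V) :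
    Spec.map (CommRingCat.ofHom (arcRes f Z e (toOpens_mono h))) ≫
      Spec.map (CommRingCat.ofHom (forgetContact f Z e V)) ≫ arcChart f V =
    Spec.map (CommRingCat.ofHom (forgetContact f Z e U)) ≫ arcChart f U := by
  have h₂ : Spec.map (CommRingCat.ofHom (arcRes f ⊥ 0 (toOpens_mono h))) ≫ arcChart f V =
      arcChart f U :=
    colimit.w (arcGluingData f ⊥ 0).functor (homOfLE h)
  rw [← h₂, ← Category.assoc, ← Category.assoc, ← Spec.map_comp, ← Spec.map_comp,
    ← CommRingCat.ofHom_comp, ← CommRingCat.ofHom_comp, arcRes_comp_forgetContact]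

/-- The inclusion of the closed subscheme of arcs of contact order at least `e` with `Z`; over an
affine open subset `U` of `X`, it is given by the quotient map between the algebras of arcs. -/
def contactGE.ι : contactGE f Z e ⟶ arcSpace f :=
  colimit.desc (arcGluingData f Z e).functor
    { pt := arcSpace f
      ι.app U := Spec.map (CommRingCat.ofHom (forgetContact f Z e U)) ≫ arcChart f U
      ι.naturality U V i := by
        exact (contactGE.ι_naturality f Z e i.le).trans (Category.comp_id _).symm }

instance (U : X.AffineZariskiSite) : IsOpenImmersion (arcChart f U) :=
  (arcGluingData f ⊥ 0).cover.map_prop U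

/-- The open subset of the arc space formed by the arcs which have contact order at most `d` with
the closed subscheme `Z`: those arcs `γ` for which some function `g` in the ideal of `Z` has a
nonzero coefficient of index `i ≤ d` in `γ⁻¹ g`, that is, those whose truncation modulo `t ^ (d+1)`
is not an arc in `Z`. -/
def contactLE (d : ℕ) : (arcSpace f).Opens :=
  ⨆ (U : X.AffineZariskiSite) (g : Z.ideal U) (i : Fin (d + 1)),
    arcChart f U ''ᵁ PrimeSpectrum.basicOpen (ArcAlgebra.coeff _ _ _ g.1 i)

/-- The locally closed subscheme of the arc space formed by the arcs which have contact order
exactly `d` with `Z`. -/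
def contactEQ (d : ℕ) : Scheme.{u} := (contactGE.ι f Z d ⁻¹ᵁ contactLE f Z d).toScheme

/-- The structure map of `contactEQ f Z d` over `k`. -/
def contactEQ.toSpec (d : ℕ) : contactEQ f Z d ⟶ Spec (.of k) :=
  (contactGE.ι f Z d ⁻¹ᵁ contactLE f Z d).ι ≫ contactGE.ι f Z d ≫ arcSpace.toSpec f

end ArcSpace

/-! ### The Jacobian subscheme -/

section Jacobian

open Scheme

variable {k : Type u} [CommRing k] {X : Scheme.{u}} (f : X ⟶ Spec (.of k))

/-- The `n`-th Fitting ideal of the module of differentials of `𝒪_X(U)` over `k`. -/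
def jacobianIdealObj (n : ℕ) (U : X.Opens) : Ideal Γ(X, U) :=
  letI := (constants f U).toAlgebra
  fittingIdeal Γ(X, U) (Ω[Γ(X, U)⁄k]) n

lemma finiteType_constants [LocallyOfFiniteType f] {U : X.Opens} (hU : IsAffineOpen U) :
    (constants f U).FiniteType := by
  have := f.finiteType_appLE (isAffineOpen_top _) hU (le_top.trans_eq f.preimage_top.symm)
  exact this.comp (.of_surjective _ (Scheme.ΓSpecIso (.of k)).symm.commRingCatIsoToRingEquiv.surjective)

/-- The Jacobian ideal sheaf `Fitt_n(Ω_{X/k})` of a scheme `X` locally of finite type over `k`.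
If `X` has pure dimension `n`, it defines the Jacobian subscheme of `X`. -/
def jacobianIdeal [LocallyOfFiniteType f] (n : ℕ) : X.IdealSheafData where
  ideal U := jacobianIdealObj f n U.1
  map_ideal_basicOpen U g := by
    let := (constants f U.1).toAlgebra
    let := (constants f (X.basicOpen g)).toAlgebra
    let := (X.presheaf.map (homOfLE (X.basicOpen_le g)).op).hom.toAlgebra
    have : IsScalarTower k Γ(X, U.1) Γ(X, X.basicOpen g) :=
      .of_algebraMap_eq' (map_constants f (X.basicOpen_le g)).symm
    have : IsLocalization (Submonoid.powers g) Γ(X, X.basicOpen g) :=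
      U.2.isLocalization_basicOpen g
    have : Algebra.FiniteType k Γ(X, U.1) := finiteType_constants f U.2
    have : Module.Finite Γ(X, U.1) (Ω[Γ(X, U.1)⁄k]) := inferInstance
    exact map_fittingIdeal (Submonoid.powers g) Γ(X, X.basicOpen g)
      (KaehlerDifferential.map k k Γ(X, U.1) Γ(X, X.basicOpen g)) n

end Jacobian

/-- A scheme is pure of dimension `n` if all its irreducible components have dimension `n`. -/
def IsPureOfDim (X : Scheme.{u}) (n : ℕ) : Prop :=
  ∀ C ∈ irreducibleComponents X, topologicalKrullDim C = n

/-! ### Special complete intersections -/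

section SpecialCompleteIntersection

variable {k : Type u} [CommRing k] {m l : ℕ} (p : Fin l → MvPolynomial (Fin m ⊕ Fin l) k)

/-- The coordinate ring `k[x₁, …, xₘ, y₁, …, yₗ] / (p₁, …, pₗ)`. -/
abbrev SpecialCIRing : Type u :=
  MvPolynomial (Fin m ⊕ Fin l) k ⧸ Ideal.span (Set.range p)

/-- The special complete intersection defined by `p₁ = … = pₗ = 0` in the affine space with
coordinates `x₁, …, xₘ, y₁, …, yₗ`. -/
abbrev specialCI : Scheme.{u} := Spec (.of (SpecialCIRing p))

/-- The structure map of a special complete intersection. -/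
def specialCI.toSpec : specialCI p ⟶ Spec (.of k) :=
  Spec.map (CommRingCat.ofHom (algebraMap k (SpecialCIRing p)))

/-- The determinant of the matrix `(∂pᵢ/∂yⱼ)`. -/
def yJacobian : MvPolynomial (Fin m ⊕ Fin l) k :=
  (Matrix.of fun i j ↦ MvPolynomial.pderiv (Sum.inr j) (p i)).det

/-- The ideal sheaf generated by `det (∂pᵢ/∂yⱼ)` on a special complete intersection; it defines
what is called the singular locus of the special complete intersection. -/
def specialCI.singularIdeal : (specialCI p).IdealSheafData :=
  .ofIdealTop (Ideal.span {(Scheme.ΓSpecIso (.of (SpecialCIRing p))).inv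
    (Ideal.Quotient.mk _ (yJacobian p))})

end SpecialCompleteIntersection

/-! ### Stratifications -/

/-- A finite constructible stratification of a scheme `Y`: a finite family of immersions of finite
presentation (so that the strata are locally closed subschemes, with constructible underlying sets)
whose images form a partition of `Y`, ordered in such a way that the closure of each stratum is
contained in the union of this stratum and the preceding ones. -/
structure IsConstructibleStratification {Y : Scheme.{u}} {r : ℕ} {S : Fin r → Scheme.{u}}
    (ι : ∀ i, S i ⟶ Y) : Prop where
  isImmersion : ∀ i, IsImmersion (ι i)
  locallyOfFinitePresentation : ∀ i, LocallyOfFinitePresentation (ι i)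
  quasiCompact : ∀ i, QuasiCompact (ι i)
  isConstructible : ∀ i, Topology.IsConstructible (Set.range (ι i))
  disjoint : ∀ i j, i ≠ j → Disjoint (Set.range (ι i)) (Set.range (ι j))
  cover : ⋃ i, Set.range (ι i) = Set.univ
  closure_subset : ∀ i, closure (Set.range (ι i)) ⊆ ⋃ j ≤ i, Set.range (ι j)

end ArcSpaces

end

noncomputable section

namespace ArcSpaces

/-! ### Newton's lemma for power series -/

section Newton

open PowerSeries

/-! Everything rests on a local model: arcs `v = (x, y)` in a special complete intersection `p = 0`
along which the Jacobian determinant `g = det (∂p/∂y)` has exact order `e`. For `c ≥ e`, multiplying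
the equations by the adjugate of the Jacobian matrix makes the linear part of `p(x, y + t^(c+1) z)`
equal to `t^(e+c+1)` times a unit times `z`. Newton's lemma (`existsUnique_newton`) then says that
`y` modulo `t^(c+1)` extends to a unique solution over a given `x` if and only if a congruence
modulo `t^(e+c+1)` holds. This congruence involves finitely many coefficients, so the coefficients
of `x` of index at least `e+c+1` are free. Hence the ring of such arcs is a polynomial ring over a
finitely generated algebra `B` (`exists_algEquiv_mvPolynomial`), and so is the ring of those arcs
which satisfy further conditions on their truncation modulo `t^(c+1)`.

For (b), the scheme of arcs of contact order `d` is exactly this model with `e = c = d`, and the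
free variables are the coordinates of the arc space of `𝔸^m`.

For (a), the Jacobian ideal of an affine chart is generated by finitely many Jacobian minors. A
nonzero minor is the determinant `g` of a special complete intersection that contains the chart
(`exists_yJacobian_eq_of_mem_jacobianMinors`). Being inside the chart is again a condition on a
truncation, as follows. Where `g` is invertible, `p = 0` is étale over `𝔸^m`. By purity of dimension
`m = n`, and the components of the chart on which `g` is nonzero dominate `𝔸^m`. An ideal with
torsion-free quotient in an étale algebra over a normal domain is generated by an idempotent
(`exists_isIdempotentElem_of_etale`). After clearing denominators, this gives an equation `h` with
`h² = g^s h` modulo `p`, and along an arc with `g` of order `e` such an `h` vanishes as soon as it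
vanishes modulo `t^(es+1)` (`HasIndependentFunctions.exists_forall_eq_zero`).

The strata are the successive differences of the open sets where the coefficient of index `e ≤ d` of
a given minor on a given chart is invertible, in lexicographic order. -/

lemma eq_of_forall_X_pow_dvd_sub {R : Type*} [CommRing R] {a b : R⟦X⟧}
    (h : ∀ n, (X : R⟦X⟧) ^ n ∣ a - b) : a = b := by
  ext n
  have := X_pow_dvd_iff.mp (h (n + 1)) n n.lt_succ_self
  rwa [map_sub, sub_eq_zero] at this

/-- A map which is contracting for the `X`-adic topology has a unique fixed point. -/
lemma existsUnique_fixedPoint {R ι : Type*} [CommRing R] (T : (ι → R⟦X⟧) → ι → R⟦X⟧)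
    (hT : ∀ n z z', (∀ i, (X : R⟦X⟧) ^ n ∣ z i - z' i) →
      ∀ i, (X : R⟦X⟧) ^ (n + 1) ∣ T z i - T z' i) :
    ∃! z, T z = z := by
  have step (n : ℕ) : ∀ i, (X : R⟦X⟧) ^ n ∣ T^[n + 1] 0 i - T^[n] 0 i := by
    induction n with
    | zero => simp
    | succ n ih =>
      rw [Function.iterate_succ_apply' T (n + 1), Function.iterate_succ_apply' T n]
      rw [Function.iterate_succ_apply' T n] at ih
      exact hT n _ _ ih
  have steps (n j : ℕ) : ∀ i, (X : R⟦X⟧) ^ n ∣ T^[n + j] 0 i - T^[n] 0 i := by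
    induction j with
    | zero => simp
    | succ j ih =>
      intro i
      have := dvd_add ((pow_dvd_pow X (n.le_add_right j)).trans (step (n + j) i)) (ih i)
      rwa [sub_add_sub_cancel] at this
  -- The coefficient of index `j` no longer changes from the iterate `j + 1` on, so it is read off
  -- there.
  let z : ι → R⟦X⟧ := fun i ↦ mk fun j ↦ coeff j (T^[j + 1] 0 i)
  have hz (n : ℕ) (i : ι) : (X : R⟦X⟧) ^ n ∣ z i - T^[n] 0 i := by
    rw [X_pow_dvd_iff]
    intro j hj
    obtain ⟨r, rfl⟩ := Nat.exists_eq_add_of_le (Nat.succ_le_of_lt hj)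
    have := X_pow_dvd_iff.mp (steps (j + 1) r i) j j.lt_succ_self
    rw [map_sub, sub_eq_zero] at this ⊢
    simp [z, this]
  refine ⟨z, funext fun i ↦ eq_of_forall_X_pow_dvd_sub fun n ↦ ?_, fun z' hz' ↦ funext fun i ↦
    eq_of_forall_X_pow_dvd_sub fun n ↦ ?_⟩
  · have h₁ := hT n z _ (hz n) i
    rw [← Function.iterate_succ_apply' T n] at h₁
    have := dvd_sub h₁ (hz (n + 1) i)
    rw [sub_sub_sub_cancel_right] at this
    exact (pow_dvd_pow _ n.le_succ).trans this
  · have (n : ℕ) : ∀ i, (X : R⟦X⟧) ^ n ∣ z' i - T^[n] 0 i := by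
      induction n with
      | zero => simp
      | succ n ih =>
        intro i
        have := hT n _ _ ih i
        rwa [hz', ← Function.iterate_succ_apply' T n] at this
    have := dvd_sub (this n i) (hz n i)
    rwa [sub_sub_sub_cancel_right] at this

/-- This is what makes low coefficients of polynomial expressions depend on a truncation of the arc
only. -/
lemma dvd_aeval_sub_aeval {k S σ : Type*} [CommRing k] [CommRing S] [Algebra k S] {d : S}
    {v w : σ → S} (h : ∀ i, d ∣ v i - w i) (p : MvPolynomial σ k) :
    d ∣ MvPolynomial.aeval v p - MvPolynomial.aeval w p := by
  simp only [← Ideal.mem_span_singleton, ← Ideal.Quotient.eq] at h ⊢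
  have key (v : σ → S) : Ideal.Quotient.mk (Ideal.span {d}) (MvPolynomial.aeval v p) =
      MvPolynomial.aeval (fun i ↦ Ideal.Quotient.mk (Ideal.span {d}) (v i)) p := by
    rw [← Ideal.Quotient.mkₐ_eq_mk k, MvPolynomial.aeval_def, MvPolynomial.aeval_def,
      ← AlgHom.coe_toRingHom, MvPolynomial.hom_eval₂, AlgHom.comp_algebraMap]
  rw [key, key]
  simp [h]

/-- The Taylor expansion of a polynomial to the second order. -/
lemma exists_taylor {k S σ : Type*} [CommRing k] [CommRing S] [Algebra k S] [Fintype σ]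
    (v : σ → S) (s : S) (p : MvPolynomial σ k) :
    ∃ Q : MvPolynomial σ S, ∀ h : σ → S,
      MvPolynomial.aeval (fun i ↦ v i + s * h i) p = MvPolynomial.aeval v p +
        s * ∑ i, MvPolynomial.aeval v (MvPolynomial.pderiv i p) * h i +
        s ^ 2 * MvPolynomial.aeval h Q := by
  classical
  induction p using MvPolynomial.induction_on with
  | C a => exact ⟨0, fun h ↦ by simp⟩
  | add p q hp hq =>
    obtain ⟨P, hP⟩ := hp
    obtain ⟨Q, hQ⟩ := hq
    refine ⟨P + Q, fun h ↦ ?_⟩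
    simp only [map_add, hP, hQ, add_mul, Finset.sum_add_distrib]
    ring
  | mul_X p j hp =>
    obtain ⟨P, hP⟩ := hp
    refine ⟨P * .C (v j) + .C s * P * .X j +
      (∑ i, .C (MvPolynomial.aeval v (MvPolynomial.pderiv i p)) * .X i) * .X j, fun h ↦ ?_⟩
    have : ∑ i, MvPolynomial.aeval v (MvPolynomial.pderiv i (p * .X j)) * h i =
        MvPolynomial.aeval v p * h j +
          v j * ∑ i, MvPolynomial.aeval v (MvPolynomial.pderiv i p) * h i := by
      simp only [Derivation.leibniz, MvPolynomial.pderiv_X, smul_eq_mul, map_add, map_mul,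
        MvPolynomial.aeval_X, add_mul, Finset.sum_add_distrib, Finset.mul_sum, mul_assoc]
      congr 1
      simp [Pi.single_apply]
    simp only [this, map_mul, hP, MvPolynomial.aeval_X, map_add, map_sum, MvPolynomial.aeval_C,
      Algebra.algebraMap_self, RingHom.id_apply]
    ring

section Jacobian

variable {k R : Type*} [CommRing k] [CommRing R] [Algebra k R] {m l : ℕ}
  (p : Fin l → MvPolynomial (Fin m ⊕ Fin l) k)

/-- The value at `v` of the matrix of derivatives of `p` with respect to the last variables. -/
def jacobianAt {S : Type*} [CommRing S] [Algebra k S] (v : Fin m ⊕ Fin l → S) :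
    Matrix (Fin l) (Fin l) S :=
  .of fun i j ↦ MvPolynomial.aeval v (MvPolynomial.pderiv (Sum.inr j) (p i))

lemma det_jacobianAt {k : Type u} [CommRing k] {S : Type*} [CommRing S] [Algebra k S]
    (p : Fin l → MvPolynomial (Fin m ⊕ Fin l) k) (v : Fin m ⊕ Fin l → S) :
    (jacobianAt p v).det = MvPolynomial.aeval v (yJacobian p) := by
  rw [yJacobian, AlgHom.map_det]
  rfl

variable {p} {v : Fin m ⊕ Fin l → R⟦X⟧} {e c : ℕ} {w : R⟦X⟧}

/-- Multiplication by `B` turns the adjugate into the scalar `X ^ e * w`, which is a nonzerodivisor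
over any ring `R`. Thus no solutions are added when the equations are multiplied by the adjugate. -/
lemma mulVec_adjugate_injective (hw : IsUnit w) {B : Matrix (Fin l) (Fin l) R⟦X⟧}
    (hB : B.det = X ^ e * w) {a : Fin l → R⟦X⟧} (ha : B.adjugate.mulVec a = 0) : a = 0 := by
  have h : B.mulVec (B.adjugate.mulVec a) = B.det • a := by
    rw [Matrix.mulVec_mulVec, Matrix.mul_adjugate, Matrix.smul_mulVec, Matrix.one_mulVec]
  rw [ha, Matrix.mulVec_zero, hB] at h
  ext1 i
  have h := congr($h i).symm
  simp only [Pi.smul_apply, smul_eq_mul, Pi.zero_apply, mul_assoc] at h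
  obtain ⟨w, rfl⟩ := hw
  refine (w.mul_right_eq_zero).mp ?_
  ext n
  simpa [coeff_X_pow_mul] using congr(coeff (n + e) $h)

/-- In the Taylor expansion, the adjugate turns the linear term into `X ^ (c + 1) * det * z`, of
order `e + c + 1`. The quadratic term carries `X ^ (2c + 2)`, which leaves the factor `X ^ (c + 1 -
e)`, divisible by `X` since `e ≤ c`. -/
lemma exists_expansion (hB : (jacobianAt p v).det = X ^ e * w) (hec : e ≤ c) :
    ∃ Q : Fin l → MvPolynomial (Fin l) R⟦X⟧, ∀ z : Fin l → R⟦X⟧,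
      (jacobianAt p v).adjugate.mulVec
          (fun i ↦ MvPolynomial.aeval (fun j ↦ v j + X ^ (c + 1) * Sum.elim (fun _ ↦ 0) z j) (p i)) =
        (jacobianAt p v).adjugate.mulVec (fun i ↦ MvPolynomial.aeval v (p i)) +
        (X ^ (e + c + 1) : R⟦X⟧) •
          (w • z + (X ^ (c + 1 - e) : R⟦X⟧) • fun i ↦ MvPolynomial.aeval z (Q i)) := by
  choose Q hQ using fun i ↦ exists_taylor v (X ^ (c + 1)) (p i)
  let Q' (i : Fin l) : MvPolynomial (Fin l) R⟦X⟧ :=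
    MvPolynomial.aeval (Sum.elim (fun _ ↦ 0) MvPolynomial.X) (Q i)
  have hQ' (z : Fin l → R⟦X⟧) (i : Fin l) :
      MvPolynomial.aeval z (Q' i) = MvPolynomial.aeval (Sum.elim (fun _ ↦ 0) z) (Q i) := by
    rw [← AlgHom.comp_apply, MvPolynomial.comp_aeval]
    congr 2
    ext1 (j | j) <;> simp
  refine ⟨fun i ↦ ∑ j, .C ((jacobianAt p v).adjugate i j) * Q' j, fun z ↦ ?_⟩
  have key : (fun i ↦ MvPolynomial.aeval (fun j ↦ v j + X ^ (c + 1) * Sum.elim (fun _ ↦ 0) z j) (p i)) =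
      (fun i ↦ MvPolynomial.aeval v (p i)) + (X ^ (c + 1) : R⟦X⟧) • (jacobianAt p v).mulVec z +
      ((X ^ (c + 1)) ^ 2 : R⟦X⟧) • fun i ↦ MvPolynomial.aeval z (Q' i) := by
    ext1 i
    simp [hQ, hQ', Matrix.mulVec, dotProduct, jacobianAt]
  have h₁ : (X ^ (c + 1) : R⟦X⟧) * X ^ e = X ^ (e + c + 1) := by ring
  have h₂ : ((X ^ (c + 1)) ^ 2 : R⟦X⟧) = X ^ (e + c + 1) * X ^ (c + 1 - e) := by
    rw [← pow_mul, ← pow_add]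
    congr 1
    omega
  rw [key, Matrix.mulVec_add, Matrix.mulVec_add, Matrix.mulVec_smul, Matrix.mulVec_smul,
    Matrix.mulVec_mulVec, Matrix.adjugate_mul, hB, Matrix.smul_mulVec, Matrix.one_mulVec,
    add_assoc, h₂, smul_smul, ← mul_assoc, h₁, mul_smul, mul_smul, smul_add]
  congr 3
  ext1 i
  simp [Matrix.mulVec, dotProduct]

/-- The truncation condition of Newton's lemma is necessary. -/
lemma dvd_adjugate_mulVec (hB : (jacobianAt p v).det = X ^ e * w) (hec : e ≤ c)
    {z : Fin l → R⟦X⟧}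
    (hz : ∀ i, MvPolynomial.aeval (fun j ↦ v j + X ^ (c + 1) * Sum.elim (fun _ ↦ 0) z j) (p i) = 0)
    (i : Fin l) : X ^ (e + c + 1) ∣
      (jacobianAt p v).adjugate.mulVec (fun i ↦ MvPolynomial.aeval v (p i)) i := by
  obtain ⟨Q, hQ⟩ := exists_expansion hB hec
  have := hQ z
  simp only [hz] at this
  rw [show (fun _ : Fin l ↦ (0 : R⟦X⟧)) = 0 from rfl, Matrix.mulVec_zero] at this
  rw [eq_neg_of_add_eq_zero_left this.symm]
  exact (Dvd.intro _ rfl : _ ∣ _).neg_right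

/-- **Newton's lemma**: an approximate solution of `p = 0` at which the Jacobian determinant has
order `e` can be corrected, in a unique way, to a solution. -/
theorem existsUnique_newton (hw : IsUnit w) (hB : (jacobianAt p v).det = X ^ e * w) (hec : e ≤ c)
    (h : ∀ i, X ^ (e + c + 1) ∣
      (jacobianAt p v).adjugate.mulVec (fun i ↦ MvPolynomial.aeval v (p i)) i) :
    ∃! z : Fin l → R⟦X⟧,
      ∀ i, MvPolynomial.aeval (fun j ↦ v j + X ^ (c + 1) * Sum.elim (fun _ ↦ 0) z j) (p i) = 0 := by
  obtain ⟨Q, hQ⟩ := exists_expansion hB hec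
  choose a ha using h
  obtain ⟨w', hw'⟩ := hw
  -- Division of the expansion by `X ^ (e + c + 1)` leaves `a + w z + X ^ (c + 1 - e) Q(z) = 0`.
  -- Solved for `z`, it is a fixed-point equation, contracting because `c + 1 - e ≥ 1`.
  let T (z : Fin l → R⟦X⟧) (i : Fin l) : R⟦X⟧ :=
    -((↑(w'⁻¹) : R⟦X⟧) * (a i + X ^ (c + 1 - e) * MvPolynomial.aeval z (Q i)))
  have hT : ∃! z, T z = z := by
    refine existsUnique_fixedPoint T fun n z z' hz i ↦ ?_
    obtain ⟨b, hb⟩ := dvd_aeval_sub_aeval hz (Q i)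
    have : T z i - T z' i = -((↑(w'⁻¹) : R⟦X⟧) * (X ^ (c + 1 - e) *
        (MvPolynomial.aeval z (Q i) - MvPolynomial.aeval z' (Q i)))) := by simp only [T]; ring
    rw [this, hb, ← mul_assoc (X ^ (c + 1 - e)), ← pow_add, dvd_neg]
    exact Dvd.dvd.mul_left (Dvd.dvd.mul_right (pow_dvd_pow _ (by omega)) _) _
  have iff (z : Fin l → R⟦X⟧) : T z = z ↔
      ∀ i, MvPolynomial.aeval (fun j ↦ v j + X ^ (c + 1) * Sum.elim (fun _ ↦ 0) z j) (p i) = 0 := by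
    have h₁ : (∀ i, MvPolynomial.aeval (fun j ↦ v j + X ^ (c + 1) * Sum.elim (fun _ ↦ 0) z j) (p i) = 0) ↔
        (jacobianAt p v).adjugate.mulVec
          (fun i ↦ MvPolynomial.aeval (fun j ↦ v j + X ^ (c + 1) * Sum.elim (fun _ ↦ 0) z j) (p i)) = 0 :=
      ⟨fun h ↦ by simp only [h]; exact Matrix.mulVec_zero _,
        fun h i ↦ congr($(mulVec_adjugate_injective ⟨w', hw'⟩ hB h) i)⟩
    rw [h₁, hQ, funext_iff, funext_iff]
    refine forall_congr' fun i ↦ ?_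
    have h₂ : ((jacobianAt p v).adjugate.mulVec (fun i ↦ MvPolynomial.aeval v (p i)) +
        (X ^ (e + c + 1) : R⟦X⟧) •
          (w • z + (X ^ (c + 1 - e) : R⟦X⟧) • fun i ↦ MvPolynomial.aeval z (Q i))) i =
        X ^ (e + c + 1) * ((w' : R⟦X⟧) * (z i - T z i)) := by
      have : (w' : R⟦X⟧) * T z i = -(a i + X ^ (c + 1 - e) * MvPolynomial.aeval z (Q i)) := by
        rw [mul_neg, Units.mul_inv_cancel_left]
      rw [mul_sub, this]
      simp only [Pi.add_apply, ha, Pi.smul_apply, smul_eq_mul, ← hw']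
      ring
    rw [h₂, Pi.zero_apply]
    constructor
    · intro h
      rw [h, sub_self, mul_zero, mul_zero]
    · intro h
      have h₃ : (w' : R⟦X⟧) * (z i - T z i) = 0 := by
        ext n
        simpa [coeff_X_pow_mul] using congr(coeff (n + (e + c + 1)) $h)
      exact (sub_eq_zero.mp ((Units.mul_right_eq_zero _).mp h₃)).symm
  obtain ⟨z, hz, hz'⟩ := hT
  exact ⟨z, (iff z).mp hz, fun z'' h ↦ hz' z'' ((iff z'').mpr h)⟩

end Jacobian

end Newton

/-! ### Universal arcs with prescribed order of the Jacobian determinant -/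

section Universal

open PowerSeries

/-- A power series is the product of `X ^ e` and a unit. -/
def HasExactOrder {R : Type*} [CommRing R] (e : ℕ) (s : R⟦X⟧) : Prop :=
  (∀ i < e, coeff i s = 0) ∧ IsUnit (coeff e s)

lemma HasExactOrder.exists_eq {R : Type*} [CommRing R] {e : ℕ} {s : R⟦X⟧}
    (h : HasExactOrder e s) : ∃ w, IsUnit w ∧ s = X ^ e * w := by
  obtain ⟨w, rfl⟩ := X_pow_dvd_iff.mpr h.1
  refine ⟨w, ?_, rfl⟩
  have h₁ := h.2
  have h₂ := coeff_X_pow_mul w e 0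
  rw [zero_add] at h₂
  rwa [h₂, coeff_zero_eq_constantCoeff_apply, ← isUnit_iff_constantCoeff] at h₁

lemma coeff_eq_of_dvd_sub {R : Type*} [CommRing R] {n i : ℕ} {s t : R⟦X⟧}
    (h : X ^ n ∣ s - t) (hi : i < n) : coeff i s = coeff i t := by
  have := X_pow_dvd_iff.mp h i hi
  rwa [map_sub, sub_eq_zero] at this

lemma HasExactOrder.of_dvd_sub {R : Type*} [CommRing R] {e n : ℕ} {s t : R⟦X⟧}
    (h : HasExactOrder e s) (hn : e < n) (hst : X ^ n ∣ s - t) : HasExactOrder e t :=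
  ⟨fun i hi ↦ by rw [← coeff_eq_of_dvd_sub hst (hi.trans hn), h.1 i hi],
    by rw [← coeff_eq_of_dvd_sub hst hn]; exact h.2⟩

lemma HasExactOrder.map {R S : Type*} [CommRing R] [CommRing S] {e : ℕ} {s : R⟦X⟧}
    (h : HasExactOrder e s) (f : R →+* S) : HasExactOrder e (PowerSeries.map f s) :=
  ⟨fun i hi ↦ by rw [coeff_map, h.1 i hi, map_zero], by rw [coeff_map]; exact h.2.map f⟩

lemma map_aeval_powerSeries {k R S σ : Type*} [CommRing k] [CommRing R] [CommRing S] [Algebra k R]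
    [Algebra k S] (f : R →ₐ[k] S) (v : σ → R⟦X⟧) (q : MvPolynomial σ k) :
    PowerSeries.map (f : R →+* S) (MvPolynomial.aeval v q) =
      MvPolynomial.aeval (fun i ↦ PowerSeries.map (f : R →+* S) (v i)) q := by
  have h : PowerSeries.map (f : R →+* S) (MvPolynomial.aeval v q) =
    PowerSeries.mapAlgHom f (MvPolynomial.aeval v q) := (PowerSeries.mapAlgHom_apply f _).symm
  rw [h, ← AlgHom.comp_apply, MvPolynomial.comp_aeval]
  rfl

variable {k : Type u} [CommRing k] {m l : ℕ} (p : Fin l → MvPolynomial (Fin m ⊕ Fin l) k)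

/-- The product of the adjugate of the Jacobian matrix and the vector of equations. -/
def newtonPoly (i : Fin l) : MvPolynomial (Fin m ⊕ Fin l) k :=
  (Matrix.of fun i j ↦ MvPolynomial.pderiv (Sum.inr j) (p i) :
    Matrix (Fin l) (Fin l) _).adjugate.mulVec p i

lemma aeval_newtonPoly {S : Type*} [CommRing S] [Algebra k S] (v : Fin m ⊕ Fin l → S) (i : Fin l) :
    MvPolynomial.aeval v (newtonPoly p i) =
      (jacobianAt p v).adjugate.mulVec (fun i ↦ MvPolynomial.aeval v (p i)) i := by
  have h := RingHom.map_mulVec (MvPolynomial.aeval v : _ →ₐ[k] S).toRingHom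
    (Matrix.of fun i j ↦ MvPolynomial.pderiv (Sum.inr j) (p i) :
      Matrix (Fin l) (Fin l) _).adjugate p i
  refine h.trans ?_
  congr 2
  exact (MvPolynomial.aeval v : _ →ₐ[k] S).map_adjugate _

variable {p}

lemma HasExactOrder.det_eq {R : Type*} [CommRing R] [Algebra k R] {v : Fin m ⊕ Fin l → R⟦X⟧} {e : ℕ}
    (h : HasExactOrder e (MvPolynomial.aeval v (yJacobian p))) :
    ∃ w, IsUnit w ∧ (jacobianAt p v).det = X ^ e * w := by
  rw [det_jacobianAt]
  exact h.exists_eq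

variable {R : Type u} [CommRing R] [Algebra k R] {v : Fin m ⊕ Fin l → R⟦X⟧} {e c : ℕ}

/-- If two families of power series are congruent modulo `X ^ (c + 1)`, have the same first
components and the second one is a solution, then they differ by a correction in Newton's lemma. -/
lemma exists_correction {v v' : Fin m ⊕ Fin l → R⟦X⟧} (h₁ : ∀ j, v' (.inl j) = v (.inl j))
    (h₂ : ∀ j, X ^ (c + 1) ∣ v' (.inr j) - v (.inr j)) :
    ∃ z : Fin l → R⟦X⟧, ∀ j, v' j = v j + X ^ (c + 1) * Sum.elim (fun _ ↦ 0) z j := by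
  choose z hz using h₂
  refine ⟨z, ?_⟩
  rintro (j | j)
  · simp [h₁]
  · simp [← hz]

/-- The structure of an algebra which carries a universal arc in a special complete intersection
on which the Jacobian determinant has order `e`, and which satisfies conditions that depend on a
truncation of the arc only. -/
theorem exists_algEquiv_mvPolynomial (hec : e ≤ c)
    (hv : ∀ i, MvPolynomial.aeval v (p i) = 0)
    (hg : HasExactOrder e (MvPolynomial.aeval v (yJacobian p)))
    (hext : ∀ f : R →ₐ[k] R, (∀ j i, f (coeff i (v j)) = coeff i (v j)) → f = AlgHom.id k R)
    (hU : ∀ (T : Type u) [CommRing T] [Algebra k T] (v' : Fin m ⊕ Fin l → T⟦X⟧)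
      (B : Subalgebra k R) (φ : B →ₐ[k] T) (b : Fin m ⊕ Fin l → B⟦X⟧),
      (∀ i, MvPolynomial.aeval v' (p i) = 0) →
      HasExactOrder e (MvPolynomial.aeval b (yJacobian p)) →
      (∀ j, X ^ (c + 1) ∣ PowerSeries.map (B.val : B →+* R) (b j) - v j) →
      (∀ j, X ^ (c + 1) ∣ PowerSeries.map (φ : B →+* T) (b j) - v' j) →
      ∃ ψ : R →ₐ[k] T, ∀ j i, ψ (coeff i (v j)) = coeff i (v' j)) :
    ∃ (B : Type u) (_ : CommRing B) (_ : Algebra k B), Algebra.FiniteType k B ∧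
      Nonempty (R ≃ₐ[k] MvPolynomial (Fin m × ℕ) B) := by
  classical
  set N := e + c + 1 with hN
  obtain ⟨r, hr⟩ := hg.2
  -- The congruence in Newton's lemma is modulo `X ^ N`, so the `x`-coordinates are kept to that
  -- order. For the `y`-coordinates order `c + 1` is enough, because the correction supplies the
  -- rest.
  let ν : Fin m ⊕ Fin l → ℕ := Sum.elim (fun _ ↦ N) fun _ ↦ c + 1
  -- The inverse of the coefficient of index `e` is adjoined so that the determinant has exact order
  -- `e` already over `B`.
  let s : Set R := Set.range (fun x : Σ j, Fin (ν j) ↦ coeff x.2 (v x.1)) ∪ {(↑r⁻¹ : R)}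
  let B : Subalgebra k R := Algebra.adjoin k s
  have hBs (j i) (h : i < ν j) : coeff i (v j) ∈ B :=
    Algebra.subset_adjoin (.inl ⟨⟨j, i, h⟩, rfl⟩)
  have hBr : (↑r⁻¹ : R) ∈ B := Algebra.subset_adjoin (.inr rfl)
  have hBfg : Algebra.FiniteType k B :=
    (Subalgebra.fg_iff_finiteType _).mp (Subalgebra.fg_def.mpr
      ⟨s, (Set.finite_range _).union (Set.finite_singleton _), rfl⟩)
  let b (j : Fin m ⊕ Fin l) : B⟦X⟧ := PowerSeries.mk fun i ↦
    if h : i < ν j then ⟨coeff i (v j), hBs j i h⟩ else 0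
  let vb (j : Fin m ⊕ Fin l) : R⟦X⟧ := PowerSeries.map (B.val : B →+* R) (b j)
  have hvb (j) : X ^ (ν j) ∣ vb j - v j := by
    refine X_pow_dvd_iff.mpr fun i hi ↦ ?_
    simp [vb, b, hi]
  have hν (j) : c + 1 ≤ ν j := by rcases j with j | j <;> simp [ν, hN]
  have hvb' (j) : X ^ (c + 1) ∣ vb j - v j := (pow_dvd_pow _ (hν j)).trans (hvb j)
  have hBinj : Function.Injective (B.val : B →+* R) := Subtype.val_injective
  -- the determinant over `B`
  have hgvb : HasExactOrder e (MvPolynomial.aeval vb (yJacobian p)) :=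
    hg.of_dvd_sub (Nat.lt_succ_of_le hec) (by
      rw [← dvd_neg, neg_sub]; exact dvd_aeval_sub_aeval hvb' _)
  have hmapb (q) : PowerSeries.map (B.val : B →+* R) (MvPolynomial.aeval b q) =
      MvPolynomial.aeval vb q := map_aeval_powerSeries B.val b q
  have hre : (B.val : B →+* R) (coeff e (MvPolynomial.aeval b (yJacobian p))) = r := by
    rw [← coeff_map, hmapb, hr]
    exact coeff_eq_of_dvd_sub (dvd_aeval_sub_aeval hvb' _) (Nat.lt_succ_of_le hec)
  have hgb' : coeff e (MvPolynomial.aeval b (yJacobian p)) * ⟨_, hBr⟩ = 1 := by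
    apply hBinj
    rw [map_mul, hre, map_one]
    exact r.mul_inv
  have hgb : HasExactOrder e (MvPolynomial.aeval b (yJacobian p)) := by
    refine ⟨fun i hi ↦ hBinj ?_, .of_mul_eq_one _ hgb'⟩
    rw [← coeff_map, hmapb, hgvb.1 i hi, map_zero]
  -- the point of `R` to which Newton's lemma is applied
  let vt : Fin m ⊕ Fin l → R⟦X⟧ := Sum.elim (fun j ↦ v (.inl j)) fun j ↦ vb (.inr j)
  have hvt (j) : X ^ N ∣ vb j - vt j := by
    rcases j with j | j
    · exact hvb (.inl j)
    · simp [vt]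
  have hgvt : HasExactOrder e (MvPolynomial.aeval vt (yJacobian p)) :=
    hgvb.of_dvd_sub (by omega) (dvd_aeval_sub_aeval hvt _)
  obtain ⟨w, hw, hwt⟩ := hgvt.det_eq
  obtain ⟨z₀, hz₀⟩ := exists_correction (v := vt) (v' := v) (fun j ↦ rfl) (c := c) (fun j ↦ by
    rw [← dvd_neg, neg_sub]; exact hvb (.inr j))
  have hz₀' : ∀ i, MvPolynomial.aeval
      (fun j ↦ vt j + X ^ (c + 1) * Sum.elim (fun _ ↦ 0) z₀ j) (p i) = 0 := by
    intro i
    simp only [← hz₀]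
    exact hv i
  have hvtN := dvd_adjugate_mulVec hwt hec hz₀'
  -- The congruence holds at `vt` because `v` is a solution, hence at `vb`, and it descends to `B`
  -- because `B → R` is injective.
  have hbN (i) : X ^ N ∣ MvPolynomial.aeval b (newtonPoly p i) := by
    have h₁ : X ^ N ∣ MvPolynomial.aeval vb (newtonPoly p i) := by
      have := dvd_aeval_sub_aeval hvt (newtonPoly p i)
      rwa [aeval_newtonPoly p vt, dvd_sub_left (hvtN i)] at this
    rw [X_pow_dvd_iff] at h₁ ⊢
    intro j hj
    apply hBinj
    rw [← coeff_map, hmapb, h₁ j hj, map_zero]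
  -- the polynomial algebra
  let T := MvPolynomial (Fin m × ℕ) B
  let ι : B →ₐ[k] T := IsScalarTower.toAlgHom k B T
  let y (j : Fin m ⊕ Fin l) : T⟦X⟧ :=
    Sum.elim (fun j ↦ PowerSeries.mk fun i ↦ (MvPolynomial.X (j, i) : T)) (fun _ ↦ 0) j
  -- The coefficients of `x` of index at least `N` become independent variables. This does not
  -- affect the congruence modulo `X ^ N`.
  let v₀ (j : Fin m ⊕ Fin l) : T⟦X⟧ := PowerSeries.map (ι : B →+* T) (b j) + X ^ N * y j
  have hv₀ (j) : X ^ N ∣ PowerSeries.map (ι : B →+* T) (b j) - v₀ j :=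
    ⟨-y j, by simp only [v₀]; ring⟩
  have hgv₀ : HasExactOrder e (MvPolynomial.aeval v₀ (yJacobian p)) := by
    refine (hgb.map (ι : B →+* T)).of_dvd_sub (n := N) (by omega) ?_
    rw [map_aeval_powerSeries]
    exact dvd_aeval_sub_aeval hv₀ _
  obtain ⟨w', hw', hwt'⟩ := hgv₀.det_eq
  obtain ⟨z, hz, -⟩ := existsUnique_newton (c := c) hw' hwt' hec fun i ↦ by
    rw [← aeval_newtonPoly]
    have h₁ := dvd_aeval_sub_aeval hv₀ (newtonPoly p i)
    rw [← map_aeval_powerSeries, dvd_sub_right] at h₁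
    · exact h₁
    · have := map_dvd (PowerSeries.map (ι : B →+* T)) (hbN i)
      rwa [map_pow, map_X] at this
  set v' : Fin m ⊕ Fin l → T⟦X⟧ := fun j ↦ v₀ j + X ^ (c + 1) * Sum.elim (fun _ ↦ 0) z j with hv'
  have hv'₀ (j i) (h : i < ν j) : coeff i (v' j) = coeff i (v₀ j) := by
    refine coeff_eq_of_dvd_sub (n := ν j) ?_ h
    rcases j with j | j <;> simp [hv', ν]
  have hv₀b (j i) (h : i < ν j) : coeff i (v₀ j) = ι ⟨coeff i (v j), hBs j i h⟩ := by
    have : coeff i (PowerSeries.map (ι : B →+* T) (b j)) = ι ⟨coeff i (v j), hBs j i h⟩ := by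
      rw [coeff_map, coeff_mk, dif_pos h]
      rfl
    rw [← this]
    rcases j with j | j
    · exact (coeff_eq_of_dvd_sub (hv₀ (.inl j)) h).symm
    · simp [v₀, y]
  obtain ⟨ψ, hψ⟩ := hU T v' B ι b hz hgb hvb' fun j ↦ by
    have h₁ : X ^ (c + 1) ∣ PowerSeries.map (ι : B →+* T) (b j) - v₀ j :=
      (pow_dvd_pow _ (by omega)).trans (hv₀ j)
    have h₂ : X ^ (c + 1) ∣ v₀ j - v' j :=
      ⟨-Sum.elim (fun _ ↦ 0) z j, by simp only [hv']; ring⟩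
    have := dvd_add h₁ h₂
    rwa [sub_add_sub_cancel] at this
  let θ : T →ₐ[k] R := (MvPolynomial.aeval (R := B) fun x : Fin m × ℕ ↦
    coeff (x.2 + N) (v (.inl x.1))).restrictScalars k
  have hθX (x) : θ (MvPolynomial.X x) = coeff (x.2 + N) (v (.inl x.1)) :=
    MvPolynomial.aeval_X _ _
  have hθι (x : B) : θ (ι x) = x := by
    refine (MvPolynomial.aeval_C _ x).trans rfl
  have hθv₀ (j) : PowerSeries.map (θ : T →+* R) (v₀ j) = vt j := by
    have h₁ : PowerSeries.map (θ : T →+* R) (PowerSeries.map (ι : B →+* T) (b j)) = vb j := by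
      ext i
      simp only [coeff_map, vb]
      exact hθι _
    rw [map_add, h₁, map_mul, map_pow, map_X]
    rcases j with j | j
    · ext i
      rw [map_add, coeff_X_pow_mul']
      simp only [vb, b, coeff_map, coeff_mk, vt, Sum.elim_inl]
      have hν' : ν (.inl j) = N := rfl
      by_cases h₂ : i < ν (.inl j)
      · rw [dif_pos h₂, if_neg (by omega), add_zero]
        rfl
      · rw [dif_neg h₂, if_pos (by omega), map_zero, zero_add]
        simp only [y, Sum.elim_inl, coeff_mk]
        rw [RingHom.coe_coe, hθX]
        rw [Nat.sub_add_cancel (by omega)]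
    · simp [y, vt]
  -- The image of `v'` and `v` itself are both solutions which correct the same point `vt`, so
  -- uniqueness in Newton's lemma identifies them.
  have hθv' (j) : PowerSeries.map (θ : T →+* R) (v' j) = v j := by
    have h₁ (j) : PowerSeries.map (θ : T →+* R) (v' j) = vt j + X ^ (c + 1) *
        Sum.elim (fun _ ↦ 0) (fun j ↦ PowerSeries.map (θ : T →+* R) (z j)) j := by
      rw [hv', map_add, hθv₀, map_mul, map_pow, map_X]
      rcases j with j | j <;> simp
    have h₂ := (existsUnique_newton (c := c) hw hwt hec hvtN).unique hz₀'
      (y₂ := fun j ↦ PowerSeries.map (θ : T →+* R) (z j)) fun i ↦ by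
        simp only [← h₁]
        rw [← map_aeval_powerSeries, hz, map_zero]
    rw [h₁, hz₀, h₂]
  have h₁ : θ.comp ψ = AlgHom.id k R := hext _ fun j i ↦ by
    rw [AlgHom.comp_apply, hψ, ← hθv' j, coeff_map]
    rfl
  -- The two maps agree on the low coefficients, hence on the coefficient of the determinant, hence
  -- on its adjoined inverse.
  have hψι : ψ.comp B.val = ι := by
    have h₁ (j) : PowerSeries.map ((ψ.comp B.val : B →ₐ[k] T) : B →+* T) (b j) =
        PowerSeries.map (ι : B →+* T) (b j) := by
      ext1 i
      simp only [coeff_map, b, coeff_mk]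
      split_ifs with h
      · exact (hψ j i).trans ((hv'₀ j i h).trans (hv₀b j i h))
      · simp
    have h₂ : (ψ.comp B.val) (coeff e (MvPolynomial.aeval b (yJacobian p))) =
        ι (coeff e (MvPolynomial.aeval b (yJacobian p))) := by
      have h₃ := map_aeval_powerSeries (ψ.comp B.val) b (yJacobian p)
      simp only [h₁] at h₃
      rw [← map_aeval_powerSeries] at h₃
      exact congr(coeff e $h₃)
    refine AlgHom.adjoin_ext ?_
    rintro _ (⟨⟨j, i⟩, rfl⟩ | h)
    · exact (hψ j i).trans ((hv'₀ j i i.2).trans (hv₀b j i i.2))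
    · obtain rfl := Set.mem_singleton_iff.mp h
      have h₃ := congr((ψ.comp B.val) $hgb')
      have h₄ := congr(ι $hgb')
      rw [map_mul, map_one] at h₃ h₄
      rw [h₂] at h₃
      exact left_inv_eq_right_inv ((mul_comm _ _).trans h₃) h₄
  have h₂ : ψ.comp θ = AlgHom.id k T := by
    refine MvPolynomial.algHom_ext' ?_ fun x ↦ ?_
    · ext1 a
      refine (congr(ψ $(hθι a))).trans ?_
      exact congr($hψι a)
    · rw [AlgHom.comp_apply, hθX, hψ]
      have : v' (.inl x.1) = v₀ (.inl x.1) := by simp [hv']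
      rw [this]
      have h : ¬ x.2 + N < ν (.inl x.1) := by simp [ν]
      simp only [v₀, map_add, coeff_X_pow_mul, coeff_map, b, coeff_mk, dif_neg h]
      simp only [map_zero, zero_add, y, Sum.elim_inl, coeff_mk]
      rfl
  exact ⟨B, inferInstance, inferInstance, hBfg, ⟨AlgEquiv.ofAlgHom ψ θ h₂ h₁⟩⟩

end Universal

/-! ### Locally closed subschemes of the arc space of an affine scheme -/

section ArcStratum

open PowerSeries

variable {k : Type u} [CommRing k] {A : Type u} [CommRing A] {φ : k →+* A} {I : Ideal A} {e₀ : ℕ}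
  {m l : ℕ} {p : Fin l → MvPolynomial (Fin m ⊕ Fin l) k}

/-- The ring `R` represents the arcs `γ` on which `a⁽ⁱ⁾` vanishes for `(a, i) ∈ E` and `g⁽ᵉ⁾` is
invertible. -/
structure RepresentsArcs {R : Type u} [CommRing R] (χ : ArcAlgebra φ I e₀ →+* R) (E : Set (A × ℕ)) (g : A)
    (e : ℕ) : Prop where
  map_eq_zero : ∀ x ∈ E, χ (ArcAlgebra.coeff φ I e₀ x.1 x.2) = 0
  isUnit : IsUnit (χ (ArcAlgebra.coeff φ I e₀ g e))
  exists_lift : ∀ (T : Type u) [CommRing T] (τ : ArcAlgebra φ I e₀ →+* T),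
    (∀ x ∈ E, τ (ArcAlgebra.coeff φ I e₀ x.1 x.2) = 0) →
    IsUnit (τ (ArcAlgebra.coeff φ I e₀ g e)) → ∃ ψ : R →+* T, ψ.comp χ = τ
  hom_ext : ∀ (T : Type u) [CommRing T] (f f' : R →+* T), f.comp χ = f'.comp χ → f = f'

/-- The structure of the locally closed subschemes of the arc space of an affine scheme which are
defined by finitely many coefficients and on which the Jacobian determinant of some equations has
exact order `e`. -/
theorem RepresentsArcs.exists_ringEquiv_mvPolynomial {R : Type u} [CommRing R]
    {χ : ArcAlgebra φ I e₀ →+* R} {E : Set (A × ℕ)} {e c : ℕ}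
    (π : MvPolynomial (Fin m ⊕ Fin l) k →+* A) (hχ : RepresentsArcs χ E (π (yJacobian p)) e)
    (hπ : Function.Surjective π) (hπφ : π.comp MvPolynomial.C = φ)
    (hp : ∀ i, π (p i) = 0) (hec : e ≤ c) (hec₀ : e₀ ≤ c + 1) (hE : ∀ x ∈ E, x.2 ≤ c)
    (hχ₀ : ∀ i < e, χ (ArcAlgebra.coeff φ I e₀ (π (yJacobian p)) i) = 0)
    (hdet : ∀ (T : Type u) [CommRing T] [Algebra k T] (v : Fin m ⊕ Fin l → T⟦X⟧),
      (∀ i, MvPolynomial.aeval v (p i) = 0) →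
      HasExactOrder e (MvPolynomial.aeval v (yJacobian p)) →
      (∀ h ∈ RingHom.ker π, ∀ i ≤ c, coeff i (MvPolynomial.aeval v h) = 0) →
      ∀ h ∈ RingHom.ker π, MvPolynomial.aeval v h = 0) :
    ∃ (B : Type u) (_ : CommRing B) (_ : Algebra k B), Algebra.FiniteType k B ∧
      ∃ Φ : R ≃+* MvPolynomial (Fin m × ℕ) B,
        ∀ c, Φ (χ (ArcAlgebra.of φ I e₀ (φ c))) = MvPolynomial.C (algebraMap k B c) := by
  let : Algebra k R := (χ.comp ((ArcAlgebra.of φ I e₀).comp φ)).toAlgebra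
  have hk (a : k) : algebraMap k R a = χ (ArcAlgebra.of φ I e₀ (φ a)) := rfl
  let v (j : Fin m ⊕ Fin l) : R⟦X⟧ :=
    PowerSeries.map χ (ArcAlgebra.univ φ I e₀ (π (MvPolynomial.X j)))
  have hv (q) : MvPolynomial.aeval v q = PowerSeries.map χ (ArcAlgebra.univ φ I e₀ (π q)) := by
    have : (MvPolynomial.aeval (R := k) v).toRingHom =
        (PowerSeries.map χ).comp ((ArcAlgebra.univ φ I e₀).comp π) := by
      refine MvPolynomial.ringHom_ext (fun a ↦ ?_) fun j ↦ ?_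
      · have h₁ : π (MvPolynomial.C a) = φ a := congr($hπφ a)
        simp only [AlgHom.toRingHom_eq_coe, RingHom.coe_coe, MvPolynomial.algHom_C,
          RingHom.comp_apply, h₁]
        ext i
        rw [PowerSeries.algebraMap_apply, hk, PowerSeries.coeff_C, coeff_map]
        rcases i with _ | i
        · simp [ArcAlgebra.univ, ArcAlgebra.coeff_zero_right]
        · simp [ArcAlgebra.univ, ArcAlgebra.coeff_const]
      · simp [v]
    exact congr($this q)
  have hvi (q i) : coeff i (MvPolynomial.aeval v q) = χ (ArcAlgebra.coeff φ I e₀ (π q) i) := by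
    rw [hv, coeff_map]
    simp [ArcAlgebra.univ]
  obtain ⟨B, _, _, hB, ⟨Φ⟩⟩ := exists_algEquiv_mvPolynomial (p := p) (v := v) hec
    (fun i ↦ by rw [hv, hp, map_zero, map_zero])
    ⟨fun i hi ↦ by rw [hvi, hχ₀ i hi], by rw [hvi]; exact hχ.isUnit⟩ (fun f hf ↦ by
      have hf' (j) : PowerSeries.map (f : R →+* R) (v j) = v j := by
        ext i
        exact hf j i
      have : (f : R →+* R) = RingHom.id R := hχ.hom_ext R _ _ (ArcAlgebra.hom_ext fun a i ↦ by
        obtain ⟨q, rfl⟩ := hπ a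
        rw [RingHom.comp_apply, ← hvi, ← coeff_map, map_aeval_powerSeries]
        simp only [hf']
        exact hvi q i)
      ext x
      exact congr($this x)) (fun T _ _ v' B φ' b hv' hg' hb hb' ↦ by
      have h₁ (q : MvPolynomial (Fin m ⊕ Fin l) k) (i : ℕ) (hi : i ≤ c) : coeff i (MvPolynomial.aeval v' q) =
          φ' (coeff i (MvPolynomial.aeval b q)) := by
        have := dvd_aeval_sub_aeval hb' q
        rw [← map_aeval_powerSeries] at this
        rw [← coeff_eq_of_dvd_sub this (Nat.lt_succ_of_le hi), coeff_map]
        rfl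
      have h₂ (q : MvPolynomial (Fin m ⊕ Fin l) k) (i : ℕ) (hi : i ≤ c) : ((coeff i (MvPolynomial.aeval b q) : B) : R) =
          χ (ArcAlgebra.coeff φ I e₀ (π q) i) := by
        have := dvd_aeval_sub_aeval hb q
        rw [← map_aeval_powerSeries] at this
        rw [← hvi, ← coeff_eq_of_dvd_sub this (Nat.lt_succ_of_le hi), coeff_map]
        rfl
      -- Up to index `c`, the coefficients of `q(v)` lie in `B`, and `φ'` carries them to those of
      -- `q(v')`. So every vanishing condition of index at most `c` passes from the universal arc to
      -- `v'`.
      have h₃ (q : MvPolynomial (Fin m ⊕ Fin l) k) (i : ℕ) (hi : i ≤ c) (h : χ (ArcAlgebra.coeff φ I e₀ (π q) i) = 0) :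
          coeff i (MvPolynomial.aeval v' q) = 0 := by
        rw [← h₂ q i hi, ZeroMemClass.coe_eq_zero] at h
        rw [h₁ q i hi, h, map_zero]
      have hg'' : HasExactOrder e (MvPolynomial.aeval v' (yJacobian p)) :=
        ⟨fun i hi ↦ h₃ _ _ (hi.le.trans hec) (hχ₀ i hi), by
          rw [h₁ _ _ hec]; exact hg'.2.map φ'⟩
      -- The arc `v'` satisfies the equations of `Spec A` up to index `c`, and `hdet` upgrades this
      -- to all indices.
      have hker : ∀ h ∈ RingHom.ker π, (MvPolynomial.aeval v').toRingHom h = 0 :=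
        hdet T v' hv' hg'' fun h hh i hi ↦ h₃ h i hi (by
          rw [← hvi, hv, (RingHom.mem_ker).mp hh, map_zero, map_zero, map_zero])
      let γ : A →+* T⟦X⟧ := π.liftOfSurjective hπ ⟨(MvPolynomial.aeval v').toRingHom, hker⟩
      have hγ (q : MvPolynomial (Fin m ⊕ Fin l) k) : γ (π q) = MvPolynomial.aeval v' q :=
        RingHom.liftOfRightInverse_comp_apply π _ _
          ⟨(MvPolynomial.aeval v').toRingHom, hker⟩ q
      have hγφ (a : k) : γ (φ a) = PowerSeries.C (algebraMap k T a) := by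
        have h₁ : π (MvPolynomial.C a) = φ a := congr($hπφ a)
        rw [← h₁, hγ, MvPolynomial.algHom_C, PowerSeries.algebraMap_apply]
      let τ : ArcAlgebra φ I e₀ →+* T := ArcAlgebra.lift φ I e₀ γ
        (fun a i ↦ by rw [hγφ, PowerSeries.coeff_C, if_neg i.succ_ne_zero])
        (fun a ha ↦ by
          obtain ⟨q, rfl⟩ := hπ a
          rw [hγ, X_pow_dvd_iff]
          intro i hi
          exact h₃ q i (by omega) (by rw [ArcAlgebra.coeff_contact φ I e₀ ha hi, map_zero]))
      have hτ (q : MvPolynomial (Fin m ⊕ Fin l) k) (i : ℕ) : τ (ArcAlgebra.coeff φ I e₀ (π q) i) = coeff i (MvPolynomial.aeval v' q) := by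
        rw [ArcAlgebra.lift_coeff, hγ]
      obtain ⟨ψ, hψ⟩ := hχ.exists_lift T τ (fun x hx ↦ by
        obtain ⟨q, hq⟩ := hπ x.1
        rw [← hq, hτ]
        exact h₃ q x.2 (hE x hx) (by rw [hq, hχ.map_eq_zero x hx])) (by
        rw [hτ]; exact hg''.2)
      refine ⟨{ ψ with commutes' a := ?_ }, fun j i ↦ ?_⟩
      · refine (congr($hψ (ArcAlgebra.of φ I e₀ (φ a)))).trans ?_
        rw [ArcAlgebra.lift_of, hγφ, PowerSeries.constantCoeff_C]
      · have := hvi (MvPolynomial.X j) i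
        rw [MvPolynomial.aeval_X] at this
        rw [this]
        refine (congr($hψ (ArcAlgebra.coeff φ I e₀ (π (.X j)) i))).trans ?_
        rw [hτ, MvPolynomial.aeval_X])
  exact ⟨B, _, _, hB, Φ, fun a ↦ Φ.commutes a⟩

/-- The representing ring, as a localization of a quotient of the algebra of arcs. -/
theorem representsArcs_localization (I : Ideal A) (e₀ : ℕ) (E : Set (A × ℕ)) (g : A) (e : ℕ)
    (J : Ideal (ArcAlgebra φ I e₀))
    (hJ : J = Ideal.span ((fun x : A × ℕ ↦ ArcAlgebra.coeff φ I e₀ x.1 x.2) '' E))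
    (R : Type u) [CommRing R] [Algebra (ArcAlgebra φ I e₀ ⧸ J) R]
    [IsLocalization.Away (Ideal.Quotient.mk J (ArcAlgebra.coeff φ I e₀ g e)) R] :
    RepresentsArcs ((algebraMap (ArcAlgebra φ I e₀ ⧸ J) R).comp (Ideal.Quotient.mk J)) E g e where
  map_eq_zero x hx := by
    have : ArcAlgebra.coeff φ I e₀ x.1 x.2 ∈ J := hJ ▸ Ideal.subset_span ⟨x, hx, rfl⟩
    rw [RingHom.comp_apply, Ideal.Quotient.eq_zero_iff_mem.mpr this, map_zero]
  isUnit := IsLocalization.Away.algebraMap_isUnit _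
  exists_lift T _ τ hE hg := by
    have hJ' : ∀ a ∈ J, τ a = 0 := by
      have : J ≤ RingHom.ker τ := by
        rw [hJ, Ideal.span_le]
        rintro _ ⟨x, hx, rfl⟩
        exact hE x hx
      exact fun a ha ↦ this ha
    refine ⟨IsLocalization.Away.lift (g := Ideal.Quotient.lift J τ hJ')
      (Ideal.Quotient.mk J (ArcAlgebra.coeff φ I e₀ g e)) (by simpa using hg), ?_⟩
    ext1 a
    simp
  hom_ext T _ f f' h := by
    refine IsLocalization.ringHom_ext
      (Submonoid.powers (Ideal.Quotient.mk J (ArcAlgebra.coeff φ I e₀ g e))) ?_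
    exact Ideal.Quotient.ringHom_ext h

end ArcStratum

/-! ### Ideals of étale algebras over normal domains -/

section Etale

open TensorProduct

/-- An étale algebra over a field is finite and reduced, hence Artinian and reduced. -/
lemma isSemisimpleRing_of_etale_field (Q S K : Type u) [CommRing Q] [CommRing S] [Algebra Q S]
    [Algebra.Etale Q S] [Field K] [Algebra Q K] : IsSemisimpleRing (S ⊗[Q] K) := by
  have : Module.Finite K (K ⊗[Q] S) := Algebra.FormallyUnramified.finite_of_free K (K ⊗[Q] S)
  have : IsReduced (K ⊗[Q] S) := Algebra.FormallyUnramified.isReduced_of_field K (K ⊗[Q] S)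
  have : IsArtinianRing (K ⊗[Q] S) := IsArtinianRing.of_finite K (K ⊗[Q] S)
  have := IsArtinianRing.isSemisimpleRing_of_isReduced (K ⊗[Q] S)
  exact (Algebra.TensorProduct.comm Q S K).toRingEquiv.symm.isSemisimpleRing

/-- An étale algebra over a normal domain `Q` is integrally closed in its base change to the
fraction field of `Q`. -/
lemma exists_algebraMap_eq_of_isIntegral_of_etale (Q S K : Type u) [CommRing Q] [IsDomain Q]
    [IsIntegrallyClosed Q] [CommRing S] [Algebra Q S] [Algebra.Etale Q S] [Field K] [Algebra Q K]
    [IsFractionRing Q K] (ε : S ⊗[Q] K) (hε : IsIntegral S ε) :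
    ∃ a : S, algebraMap S (S ⊗[Q] K) a = ε := by
  -- Integral closure commutes with smooth base change, and the integral closure of the normal
  -- domain `Q` in `K` is `Q`.
  obtain ⟨x, hx⟩ := (TensorProduct.toIntegralClosure_bijective_of_smooth (R := Q) (S := S)
    (B := K)).2 ⟨ε, hε⟩
  have h₁ : ε = ((TensorProduct.toIntegralClosure Q S K x : integralClosure S (S ⊗[Q] K)) :
      S ⊗[Q] K) := by rw [hx]
  rw [h₁]
  clear h₁ hx
  induction x with
  | zero => exact ⟨0, by simp⟩
  | add x y hx hy =>
    obtain ⟨a, ha⟩ := hx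
    obtain ⟨b, hb⟩ := hy
    exact ⟨a + b, by rw [map_add, ha, hb, map_add]; rfl⟩
  | tmul s b =>
    obtain ⟨c, hc⟩ := IsIntegrallyClosed.isIntegral_iff.mp b.2
    refine ⟨algebraMap Q S c * s, ?_⟩
    change (algebraMap Q S c * s) ⊗ₜ[Q] (1 : K) = s ⊗ₜ (b : K)
    rw [← hc, ← Algebra.smul_def, TensorProduct.smul_tmul, Algebra.smul_def, mul_one]

/-- In the semisimple ring `T`, the extension of `J` is generated by an idempotent. As a root of `X²
- X` it is integral over `S`, so it comes from `S`. Since `J` is saturated with respect to `M`, it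
is recovered from its extension. -/
lemma exists_isIdempotentElem_of_isSemisimpleRing {S T : Type u} [CommRing S] [CommRing T]
    [Algebra S T] (M : Submonoid S) [IsLocalization M T] [IsSemisimpleRing T]
    (hinj : Function.Injective (algebraMap S T))
    (hint : ∀ ε : T, IsIntegral S ε → ∃ a : S, algebraMap S T a = ε) (J : Ideal S)
    (hJ : ∀ r ∈ M, ∀ a, r * a ∈ J → a ∈ J) :
    ∃ ε : S, IsIdempotentElem ε ∧ J = Ideal.span {ε} := by
  obtain ⟨ε, hε, hJε⟩ := IsSemisimpleRing.ideal_eq_span_idempotent (J.map (algebraMap S T))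
  have hεint : IsIntegral S ε := by
    refine ⟨Polynomial.X ^ 2 - Polynomial.X, ?_, ?_⟩
    · refine Polynomial.monic_X_pow_sub ?_
      exact Polynomial.degree_X_le.trans_lt (by norm_num)
    · rw [Polynomial.eval₂_sub, Polynomial.eval₂_pow, Polynomial.eval₂_X, pow_two, hε.eq, sub_self]
  obtain ⟨a, rfl⟩ := hint ε hεint
  have hmem (b : S) (hb : algebraMap S T b ∈ J.map (algebraMap S T)) : b ∈ J := by
    obtain ⟨r, hr, h⟩ := (IsLocalization.algebraMap_mem_map_algebraMap_iff M T J b).mp hb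
    exact hJ r hr b h
  refine ⟨a, hinj (by rw [map_mul]; exact hε), le_antisymm (fun b hb ↦ ?_) ?_⟩
  · have h₁ := Ideal.mem_map_of_mem (algebraMap S T) hb
    rw [hJε] at h₁
    obtain ⟨c, hc⟩ := Ideal.mem_span_singleton'.mp h₁
    refine Ideal.mem_span_singleton.mpr ⟨b, hinj ?_⟩
    rw [map_mul, ← hc, mul_left_comm, hε.eq]
  · rw [Ideal.span_singleton_le_iff_mem]
    exact hmem a (hJε ▸ Ideal.mem_span_singleton_self _)

/-- An ideal `J` of an étale algebra `S` over a normal domain `Q` such that `S ⧸ J` is torsion-free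
over `Q` is generated by an idempotent. -/
theorem exists_isIdempotentElem_of_etale {Q S : Type u} [CommRing Q] [IsDomain Q]
    [IsIntegrallyClosed Q] [CommRing S] [Algebra Q S] [Algebra.Etale Q S] (J : Ideal S)
    (hJ : ∀ (r : Q) (a : S), r ≠ 0 → algebraMap Q S r * a ∈ J → a ∈ J) :
    ∃ ε : S, IsIdempotentElem ε ∧ J = Ideal.span {ε} := by
  have := isSemisimpleRing_of_etale_field Q S (FractionRing Q)
  exact exists_isIdempotentElem_of_isSemisimpleRing (T := S ⊗[Q] FractionRing Q)
    (Algebra.algebraMapSubmonoid S (nonZeroDivisors Q))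
    (Algebra.TensorProduct.includeLeft_injective (S := Q)
      (IsFractionRing.injective Q (FractionRing Q)))
    (exists_algebraMap_eq_of_isIntegral_of_etale Q S (FractionRing Q)) J (by
      rintro _ ⟨r, hr, rfl⟩ a ha
      exact hJ r a (nonZeroDivisors.ne_zero hr) ha)

/-- The presentation by `p` has as many equations as variables. Composed with the localization at
its Jacobian determinant, it is submersive of relative dimension zero. -/
lemma etale_of_isUnit_det {Q : Type u} [CommRing Q] {l : ℕ}
    (p : Fin l → MvPolynomial (Fin l) Q) (S : Type u) [CommRing S]
    [Algebra (MvPolynomial (Fin l) Q ⧸ Ideal.span (Set.range p)) S] [Algebra Q S]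
    [IsScalarTower Q (MvPolynomial (Fin l) Q ⧸ Ideal.span (Set.range p)) S]
    [IsLocalization.Away (Ideal.Quotient.mk (Ideal.span (Set.range p))
      (Matrix.of fun i j ↦ MvPolynomial.pderiv j (p i)).det) S] : Algebra.Etale Q S := by
  classical
  let S₀ := MvPolynomial (Fin l) Q ⧸ Ideal.span (Set.range p)
  let P₀ : Algebra.PreSubmersivePresentation Q S₀ (Fin l) (Fin l) :=
    { Algebra.Presentation.naive with
      map := id
      map_inj := Function.injective_id }
  set g := Ideal.Quotient.mk (Ideal.span (Set.range p))
      (Matrix.of fun i j ↦ MvPolynomial.pderiv j (p i)).det with hg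
  have hP₀ : P₀.jacobian = g := by
    rw [Algebra.PreSubmersivePresentation.jacobian_eq_jacobiMatrix_det, hg]
    have h₁ : P₀.jacobiMatrix.det = (Matrix.of fun i j ↦ MvPolynomial.pderiv j (p i)).det := by
      rw [← Matrix.det_transpose]
      congr 1
      ext1 i j
      rw [Matrix.transpose_apply, Algebra.PreSubmersivePresentation.jacobiMatrix_apply]
      rfl
    rw [h₁]
    rfl
  let P₁ := Algebra.PreSubmersivePresentation.localizationAway S g
  have hu : IsUnit (P₁.comp P₀).jacobian := by
    rw [Algebra.PreSubmersivePresentation.comp_jacobian_eq_jacobian_smul_jacobian, hP₀,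
      Algebra.PreSubmersivePresentation.localizationAway_jacobian, Algebra.smul_def]
    have := IsLocalization.Away.algebraMap_isUnit (S := S) g
    exact this.mul this
  let P : Algebra.SubmersivePresentation Q S _ _ :=
    { P₁.comp P₀ with jacobian_isUnit := hu }
  have : Algebra.IsStandardSmoothOfRelativeDimension 0 Q S :=
    P.isStandardSmoothOfRelativeDimension (by simp [Algebra.Presentation.dimension])
  infer_instance

/-- If the polynomials `p` belong to a radical ideal `J` and all the minimal primes over `J` which
do not contain the Jacobian determinant `g` lie over the generic point of `Q`, then `J` is generated
by an idempotent up to powers of `g` and modulo `p`. -/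
theorem exists_generator_of_etale {Q : Type u} [CommRing Q] [IsDomain Q] [IsIntegrallyClosed Q]
    {l : ℕ} (p : Fin l → MvPolynomial (Fin l) Q) (g : MvPolynomial (Fin l) Q)
    (hg : g = (Matrix.of fun i j ↦ MvPolynomial.pderiv j (p i)).det)
    (J : Ideal (MvPolynomial (Fin l) Q)) (hJ : J.IsRadical) (hp : ∀ i, p i ∈ J)
    (hmin : ∀ P ∈ J.minimalPrimes, g ∉ P → ∀ r : Q, MvPolynomial.C r ∈ P → r = 0) :
    ∃ h ∈ J, ∃ s : ℕ, h ^ 2 - g ^ s * h ∈ Ideal.span (Set.range p) ∧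
      ∀ j ∈ J, ∃ t : ℕ, ∃ c, g ^ t * j - c * h ∈ Ideal.span (Set.range p) := by
  let W := MvPolynomial (Fin l) Q
  let L : Ideal W := Ideal.span (Set.range p)
  let S₀ := W ⧸ L
  have hLJ : L ≤ J := Ideal.span_le.mpr (by rintro _ ⟨i, rfl⟩; exact hp i)
  let S := Localization.Away (Ideal.Quotient.mk L g)
  have : IsLocalization.Away (Ideal.Quotient.mk (Ideal.span (Set.range p))
      (Matrix.of fun i j ↦ MvPolynomial.pderiv j (p i)).det) S := by
    rw [← hg]
    exact inferInstanceAs (IsLocalization.Away (Ideal.Quotient.mk L g)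
      (Localization.Away (Ideal.Quotient.mk L g)))
  have hloc : IsLocalization (Submonoid.powers (Ideal.Quotient.mk L g)) S :=
    inferInstanceAs (IsLocalization.Away (Ideal.Quotient.mk L g)
      (Localization.Away (Ideal.Quotient.mk L g)))
  have : Algebra.Etale Q S := etale_of_isUnit_det p S
  let ρ : W →+* S := (algebraMap S₀ S).comp (Ideal.Quotient.mk L)
  have hρL (w : W) (hw : ρ w = 0) : ∃ M : ℕ, g ^ M * w ∈ L := by
    obtain ⟨⟨_, M, rfl⟩, h⟩ :=
      (IsLocalization.map_eq_zero_iff (Submonoid.powers (Ideal.Quotient.mk L g)) S _).mp hw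
    refine ⟨M, Ideal.Quotient.eq_zero_iff_mem.mp ?_⟩
    simpa using! h
  have hρs (a : S) : ∃ (w : W) (N : ℕ), a * ρ g ^ N = ρ w := by
    obtain ⟨N, b, hb⟩ := IsLocalization.Away.surj (Ideal.Quotient.mk L g) a
    obtain ⟨w, rfl⟩ := Ideal.Quotient.mk_surjective b
    exact ⟨w, N, hb⟩
  have hρg : IsUnit (ρ g) := IsLocalization.Away.algebraMap_isUnit (S := S) (Ideal.Quotient.mk L g)
  have hρJ (w : W) (hw : ρ w ∈ J.map ρ) : ∃ M : ℕ, g ^ M * w ∈ J := by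
    rw [← Ideal.map_map] at hw
    obtain ⟨_, ⟨M, rfl⟩, h⟩ := (IsLocalization.algebraMap_mem_map_algebraMap_iff
      (Submonoid.powers (Ideal.Quotient.mk L g)) S _ _).mp hw
    refine ⟨M, ?_⟩
    replace h : Ideal.Quotient.mk L (g ^ M * w) ∈ J.map (Ideal.Quotient.mk L) := by
      rw [map_mul, map_pow]
      exact h
    rw [Ideal.mem_map_iff_of_surjective _ Ideal.Quotient.mk_surjective] at h
    obtain ⟨y, hy, hyw⟩ := h
    have := hLJ (Ideal.Quotient.eq.mp hyw)
    have := J.sub_mem hy this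
    rwa [sub_sub_cancel] at this
  obtain ⟨ε, hε, hJε⟩ := exists_isIdempotentElem_of_etale (Q := Q) (J.map ρ) (by
    intro r a hr hra
    obtain ⟨w, N, hw⟩ := hρs a
    have hr' : algebraMap Q S r = ρ (MvPolynomial.C r) := rfl
    have h₁ : ρ (MvPolynomial.C r * w) ∈ J.map ρ := by
      rw [map_mul, ← hr', ← hw, ← mul_assoc]
      exact Ideal.mul_mem_right _ _ hra
    obtain ⟨M, hM⟩ := hρJ _ h₁
    -- The radical ideal `J` is the intersection of its minimal primes. Those which contain `g`
    -- contain `g * w`; the others lie over zero in `Q`, so that `r` can be cancelled there.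
    have h₂ : g * w ∈ J := by
      rw [← hJ.radical, ← Ideal.sInf_minimalPrimes, Ideal.mem_sInf]
      intro P hP
      have : P.IsPrime := hP.1.1
      by_cases hgP : g ∈ P
      · exact P.mul_mem_right _ hgP
      · refine P.mul_mem_left _ ?_
        rcases this.mem_or_mem (hP.1.2 hM) with h | h
        · exact (hgP (this.mem_of_pow_mem _ h)).elim
        · rcases this.mem_or_mem h with h | h
          · exact (hr (hmin P hP hgP r h)).elim
          · exact h
    have h₃ := Ideal.mem_map_of_mem ρ h₂
    rw [map_mul, ← hw, Ideal.unit_mul_mem_iff_mem _ hρg,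
      Ideal.mul_unit_mem_iff_mem _ (hρg.pow N)] at h₃
    exact h₃)
  obtain ⟨w, N, hw⟩ := hρs ε
  obtain ⟨M, hM⟩ := hρJ w (by
    rw [← hw]
    exact Ideal.mul_mem_right _ _ (hJε ▸ Ideal.mem_span_singleton_self ε))
  have h₁ : ρ (g ^ M * w) = ε * ρ g ^ (M + N) := by
    rw [map_mul, map_pow, ← hw]
    ring
  have h₂ : ρ ((g ^ M * w) ^ 2 - g ^ (M + N) * (g ^ M * w)) = 0 := by
    rw [map_sub, map_mul, map_pow, h₁, map_pow, mul_pow, pow_two ε, hε.eq]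
    ring
  obtain ⟨M', hM'⟩ := hρL _ h₂
  -- The image of this `h` is `g ^ s * ε` with `s = M' + M + N`. The factor `g ^ M` brings it into
  -- `J`, and `g ^ M'` makes the idempotent relation hold modulo `p` before localization.
  refine ⟨g ^ M' * (g ^ M * w), J.mul_mem_left _ hM, M' + (M + N), ?_, fun j hj ↦ ?_⟩
  · have : (g ^ M' * (g ^ M * w)) ^ 2 - g ^ (M' + (M + N)) * (g ^ M' * (g ^ M * w)) =
        g ^ M' * (g ^ M' * ((g ^ M * w) ^ 2 - g ^ (M + N) * (g ^ M * w))) := by ring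
    rw [this]
    exact Ideal.mul_mem_left _ _ hM'
  · have h₃ := Ideal.mem_map_of_mem ρ hj
    rw [hJε] at h₃
    obtain ⟨b, hb⟩ := Ideal.mem_span_singleton'.mp h₃
    obtain ⟨c, t, hc⟩ := hρs b
    have h₄ : ρ (g ^ (M' + (M + N) + t) * j - c * (g ^ M' * (g ^ M * w))) = 0 := by
      rw [map_sub, map_mul, map_mul, map_mul _ (g ^ M') _, h₁, ← hb, ← hc, map_pow, map_pow]
      ring
    obtain ⟨M'', hM''⟩ := hρL _ h₄
    refine ⟨M'' + (M' + (M + N) + t), g ^ M'' * c, ?_⟩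
    have : g ^ (M'' + (M' + (M + N) + t)) * j - g ^ M'' * c * (g ^ M' * (g ^ M * w)) =
      g ^ M'' * (g ^ (M' + (M + N) + t) * j - c * (g ^ M' * (g ^ M * w))) := by ring
    rw [this]
    exact hM''

end Etale

/-! ### Transcendence degrees and Jacobian determinants -/

section Transcendence

open MvPolynomial

/-- The presentation of étale type of the ideals of `k[x, y]` on whose components the coordinates `x`
are independent. -/
lemma exists_generator {k : Type u} [Field k] {m l : ℕ}
    (p : Fin l → MvPolynomial (Fin m ⊕ Fin l) k) (J : Ideal (MvPolynomial (Fin m ⊕ Fin l) k))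
    (hJ : J.IsRadical) (hp : ∀ i, p i ∈ J)
    (hmin : ∀ P ∈ J.minimalPrimes, yJacobian p ∉ P →
      ∀ q : MvPolynomial (Fin m) k, rename Sum.inl q ∈ P → q = 0) :
    ∃ h ∈ J, ∃ s, h ^ 2 - yJacobian p ^ s * h ∈ Ideal.span (Set.range p) ∧
      ∀ j ∈ J, ∃ t c, yJacobian p ^ t * j - c * h ∈ Ideal.span (Set.range p) := by
  -- The coordinates `x` become constants: the normal base ring is `k[x]`, and `y` are the variables
  -- of the étale algebra.
  let σ : MvPolynomial (Fin m ⊕ Fin l) k ≃ₐ[k] MvPolynomial (Fin l) (MvPolynomial (Fin m) k) :=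
    (renameEquiv k (Equiv.sumComm _ _)).trans (sumAlgEquiv k (Fin l) (Fin m))
  have hσp (j : Fin l) (q : MvPolynomial (Fin m ⊕ Fin l) k) :
      σ (pderiv (Sum.inr j) q) = pderiv j (σ q) := by
    simp only [σ, AlgEquiv.trans_apply]
    rw [pderiv_sumAlgEquiv]
    congr 1
    exact (pderiv_rename (f := Equiv.sumComm (Fin m) (Fin l)) (Equiv.injective _) (Sum.inr j) q).symm
  have hσC (q : MvPolynomial (Fin m) k) : σ (rename Sum.inl q) = C q := by
    have : (σ.toAlgHom.comp (rename Sum.inl)) =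
        (IsScalarTower.toAlgHom k (MvPolynomial (Fin m) k) (MvPolynomial (Fin l) (MvPolynomial (Fin m) k))) := by
      refine MvPolynomial.algHom_ext fun i ↦ ?_
      simp [σ, MvPolynomial.algebraMap_eq]
    exact congr($this q)
  have hσs : Function.Surjective σ.symm := σ.symm.surjective
  have hg : σ (yJacobian p) = (Matrix.of fun i j ↦ pderiv j (σ (p i))).det := by
    rw [yJacobian, AlgEquiv.map_det]
    congr 1
    ext1 i j
    exact hσp j (p i)
  have hspan (x : MvPolynomial (Fin m ⊕ Fin l) k)
      (hx : σ x ∈ Ideal.span (Set.range fun i ↦ σ (p i))) : x ∈ Ideal.span (Set.range p) := by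
    have := Ideal.mem_map_of_mem (RingHomClass.toRingHom σ.symm) hx
    rw [Ideal.map_span, ← Set.range_comp] at this
    simpa [Function.comp_def] using this
  obtain ⟨h, hh, s, h₁, h₂⟩ := exists_generator_of_etale (fun i ↦ σ (p i)) (σ (yJacobian p)) hg
    (J.comap (σ.symm : _ →+* MvPolynomial (Fin m ⊕ Fin l) k)) (hJ.comap _) (by simpa using hp) (by
      intro P hP hgP r hr
      rw [Ideal.comap_minimalPrimes_eq_of_surjective (by exact hσs)] at hP
      obtain ⟨P, hP, rfl⟩ := hP
      refine hmin P hP (fun h ↦ hgP (by simpa using h)) r ?_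
      rw [← hσC] at hr
      simpa using hr)
  obtain ⟨h, rfl⟩ := σ.surjective h
  refine ⟨h, by simpa using hh, s, hspan _ (by simpa using h₁), fun j hj ↦ ?_⟩
  obtain ⟨t, c, hc⟩ := h₂ (σ j) (by simpa using hj)
  obtain ⟨c, rfl⟩ := σ.surjective c
  exact ⟨t, c, hspan _ (by simpa using hc)⟩

/-- As `b` is a nonzerodivisor, an algebraic relation for `b` may be taken with nonzero constant
coefficient. Applying `f` kills all other terms and leaves a nontrivial relation between the `f (x
i)`. -/
lemma algebraicIndependent_option_of_map_eq_zero {k A B ι : Type*} [CommRing k] [CommRing A]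
    [IsDomain A] [CommRing B] [Algebra k A] [Algebra k B] (f : A →ₐ[k] B) (x : ι → A)
    (hx : AlgebraicIndependent k (f ∘ x)) (b : A) (hb : b ≠ 0) (hfb : f b = 0) :
    AlgebraicIndependent k (fun o : Option ι ↦ o.elim b x) := by
  have hx' : AlgebraicIndependent k x := AlgebraicIndependent.of_comp f hx
  rw [hx'.option_iff_transcendental]
  intro halg
  obtain ⟨q, hq, hq'⟩ := halg.exists_nonzero_coeff_and_aeval_eq_zero (mem_nonZeroDivisors_of_ne_zero hb)
  apply hq
  have h₁ : f (q.coeff 0 : Algebra.adjoin k (Set.range x)) = 0 := by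
    have h₂ : (Polynomial.X : Polynomial (Algebra.adjoin k (Set.range x))) ∣ q - Polynomial.C (q.coeff 0) :=
      Polynomial.X_dvd_sub_C
    obtain ⟨r, hr⟩ := h₂
    have h₃ := congr(Polynomial.aeval b $hr)
    rw [map_sub, hq', map_mul, Polynomial.aeval_X, Polynomial.aeval_C, zero_sub] at h₃
    have h₄ := congr(f $h₃)
    rw [map_neg, map_mul, hfb, zero_mul, neg_eq_zero] at h₄
    exact h₄
  have h₅ (y : A) (hy : y ∈ Algebra.adjoin k (Set.range x)) : ∃ r : MvPolynomial ι k, aeval x r = y := by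
    rw [Algebra.adjoin_range_eq_range_aeval] at hy
    exact hy
  obtain ⟨r, hr'⟩ := h₅ _ (q.coeff 0).2
  rw [← hr', ← AlgHom.comp_apply, comp_aeval] at h₁
  have h₆ : r = 0 := by
    apply (algebraicIndependent_iff.mp hx) r
    exact h₁
  apply Subtype.ext
  rw [← hr', h₆]
  simp

/-- A chain of `n + 1` prime ideals gives `n` independent elements. -/
lemma exists_algebraicIndependent_of_strictMono {k A : Type*} [CommRing k] [CommRing A]
    [Algebra k A] (hk : ∀ P : Ideal A, P.IsPrime → Function.Injective (algebraMap k (A ⧸ P)))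
    (n : ℕ) (p : Fin (n + 1) → Ideal A) (hp : ∀ i, (p i).IsPrime)
    (hmono : StrictMono p) :
    ∃ x : Fin n → A, AlgebraicIndependent k (fun i ↦ Ideal.Quotient.mk (p 0) (x i)) := by
  induction n with
  | zero =>
    refine ⟨Fin.elim0, ?_⟩
    rw [algebraicIndependent_empty_type_iff]
    exact hk _ (hp 0)
  | succ n ih =>
    obtain ⟨x, hx⟩ := ih (fun i ↦ p i.succ) (fun i ↦ hp _) (fun i j h ↦ hmono (by simpa using h))
    have hlt : p 0 < p (Fin.succ 0) := hmono (by simp)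
    obtain ⟨b, hb₁, hb₀⟩ := SetLike.exists_of_lt hlt
    have := hp 0
    have h := algebraicIndependent_option_of_map_eq_zero (Ideal.Quotient.factorₐ k hlt.le)
      (fun i ↦ Ideal.Quotient.mk (p 0) (x i)) hx (Ideal.Quotient.mk (p 0) b)
      (by rwa [Ne, Ideal.Quotient.eq_zero_iff_mem]) (by
        exact Ideal.Quotient.eq_zero_iff_mem.mpr hb₁)
    refine ⟨fun i ↦ (finSuccEquiv n i).elim b x, ?_⟩
    have h' := h.comp (finSuccEquiv n) (Equiv.injective _)
    have he : (fun i ↦ Ideal.Quotient.mk (p 0) ((finSuccEquiv n i).elim b x)) =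
        (fun o : Option (Fin n) ↦ o.elim (Ideal.Quotient.mk (p 0) b)
          fun i ↦ Ideal.Quotient.mk (p 0) (x i)) ∘ finSuccEquiv n := by
      ext i
      simp only [Function.comp_apply]
      cases finSuccEquiv n i <;> rfl
    rw [he]
    exact h'

/-! ### Function fields in which the Jacobian determinant is nonzero -/

section Field

variable {k : Type u} [Field k] {m l : ℕ} {p : Fin l → MvPolynomial (Fin m ⊕ Fin l) k}
  {F : Type u} [Field F] [Algebra k F] {v : Fin m ⊕ Fin l → F}

lemma derivation_aeval {L M : Type*} [Field L] [Algebra k L] [Algebra L F] [IsScalarTower k L F]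
    [AddCommGroup M] [Module F M] [Module L M] {ι : Type*} [Fintype ι]
    (D : Derivation L F M) (v : ι → F) (q : MvPolynomial ι k) :
    D (aeval v q) = ∑ i, aeval v (pderiv i q) • D (v i) := by
  classical
  induction q using MvPolynomial.induction_on with
  | C a =>
    simp [IsScalarTower.algebraMap_apply k L F]
  | add q r hq hr => simp [hq, hr, add_smul, Finset.sum_add_distrib]
  | mul_X q i hq =>
    simp only [map_mul, Derivation.leibniz, aeval_X, hq, pderiv_X, smul_eq_mul, map_add, add_smul,
      Finset.sum_add_distrib, Finset.smul_sum, mul_smul]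
    congr 1
    rw [Finset.sum_eq_single i]
    · simp
    · intro j _ hj
      simp [hj.symm]
    · simp

/-- Over the field `L` generated by `x`, differentiating the equations gives a linear system for the
differentials of `y` with invertible matrix. Hence `Ω[F⁄L]` vanishes, and the finitely generated
extension `F` of `L` is separable algebraic, in any characteristic. -/
lemma isAlgebraic_adjoin_of_yJacobian_ne_zero (hp : ∀ i, aeval v (p i) = 0)
    (hg : aeval v (yJacobian p) ≠ 0)
    (hF : ∀ z : F, ∃ a b : MvPolynomial (Fin m ⊕ Fin l) k, aeval v b ≠ 0 ∧ z * aeval v b = aeval v a) :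
    Algebra.IsAlgebraic (Algebra.adjoin k (Set.range (v ∘ Sum.inl))) F := by
  let L := IntermediateField.adjoin k (Set.range (v ∘ Sum.inl))
  have htop : IntermediateField.adjoin k (Set.range v) = ⊤ := by
    rw [eq_top_iff]
    intro z _
    obtain ⟨a, b, hb, h⟩ := hF z
    have hmem (q : MvPolynomial (Fin m ⊕ Fin l) k) :
        aeval v q ∈ IntermediateField.adjoin k (Set.range v) := by
      apply IntermediateField.algebra_adjoin_le_adjoin
      rw [Algebra.adjoin_range_eq_range_aeval]
      exact ⟨q, rfl⟩
    rw [eq_div_of_mul_eq hb h]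
    exact div_mem (hmem a) (hmem b)
  have hfg : Algebra.EssFiniteType k F := by
    rw [← IntermediateField.fg_top_iff, ← htop]
    exact IntermediateField.fg_adjoin_of_finite (Set.finite_range v)
  have : Algebra.EssFiniteType L F := .of_comp k L F
  let D := KaehlerDifferential.D L F
  have hx (i : Fin m) : D (v (Sum.inl i)) = 0 := by
    have : v (Sum.inl i) ∈ L := IntermediateField.subset_adjoin _ _ ⟨i, rfl⟩
    exact D.map_algebraMap ⟨_, this⟩
  have hJ (i : Fin l) : ∑ j, jacobianAt p v i j • D (v (Sum.inr j)) = 0 := by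
    have h := derivation_aeval (k := k) D v (p i)
    rw [hp, map_zero, Fintype.sum_sum_type] at h
    simp only [hx, smul_zero, Finset.sum_const_zero, zero_add] at h
    exact h.symm
  have hy (j : Fin l) : D (v (Sum.inr j)) = 0 := by
    have h₁ : ∑ i, (jacobianAt p v).adjugate j i • ∑ j', jacobianAt p v i j' • D (v (Sum.inr j')) = 0 := by
      simp [hJ]
    simp only [Finset.smul_sum, smul_smul] at h₁
    rw [Finset.sum_comm] at h₁
    simp only [← Finset.sum_smul, ← Matrix.mul_apply, Matrix.adjugate_mul, Matrix.smul_apply] at h₁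
    rw [Finset.sum_eq_single j (fun j' _ h ↦ by simp [Matrix.one_apply_ne h.symm]) (by simp)] at h₁
    rw [det_jacobianAt] at h₁
    simpa [hg] using h₁
  have hD (z : F) : D z = 0 := by
    have hDq (q : MvPolynomial (Fin m ⊕ Fin l) k) : D (aeval v q) = 0 := by
      rw [derivation_aeval, Fintype.sum_sum_type]
      simp [hx, hy]
    obtain ⟨a, b, hb, h⟩ := hF z
    have h₁ := congr(D $h)
    rw [D.leibniz, hDq, hDq, smul_zero, zero_add] at h₁
    exact (smul_eq_zero.mp h₁).resolve_left hb
  have : Subsingleton (Ω[F⁄L]) := by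
    rw [← Submodule.subsingleton_iff F, ← subsingleton_iff_bot_eq_top, eq_comm,
      ← KaehlerDifferential.span_range_derivation, Submodule.span_eq_bot]
    rintro _ ⟨z, rfl⟩
    exact hD z
  have : Algebra.FormallyUnramified L F := ⟨this⟩
  have : Algebra.IsSeparable L F := Algebra.FormallyUnramified.isSeparable L F
  have : Algebra.IsAlgebraic L F := inferInstance
  open scoped IntermediateField.algebraAdjoinAdjoin in
  exact (IsFractionRing.comap_isAlgebraic_iff (A := Algebra.adjoin k (Set.range (v ∘ Sum.inl)))
    (K := L) (C := F)).mpr this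

/-- The transcendence degree is at most `m` because `F` is algebraic over the `m` elements `x`, and
at least `n ≥ m` by hypothesis. So `x` is a transcendence basis. -/
lemma eq_and_algebraicIndependent_of_yJacobian_ne_zero (hp : ∀ i, aeval v (p i) = 0)
    (hg : aeval v (yJacobian p) ≠ 0)
    (hF : ∀ z : F, ∃ a b : MvPolynomial (Fin m ⊕ Fin l) k, aeval v b ≠ 0 ∧ z * aeval v b = aeval v a)
    {n : ℕ} (hmn : m ≤ n) {x : Fin n → F} (hx : AlgebraicIndependent k x) :
    m = n ∧ AlgebraicIndependent k (v ∘ Sum.inl) := by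
  have := isAlgebraic_adjoin_of_yJacobian_ne_zero hp hg hF
  have h₁ := hx.lift_cardinalMk_le_trdeg
  have h₂ := Algebra.IsAlgebraic.trdeg_le_cardinalMk k (Set.range (v ∘ Sum.inl))
  have h₃ := Cardinal.mk_range_le_lift (f := v ∘ Sum.inl)
  have h₄ : Cardinal.lift.{0} (Cardinal.mk (Set.range (v ∘ Sum.inl))) ≤ (m : Cardinal.{u}) := by
    simpa using h₃
  have h₅ : (n : Cardinal.{u}) ≤ Algebra.trdeg k F := by simpa using h₁
  rw [Cardinal.lift_uzero] at h₄
  obtain rfl : m = n := le_antisymm hmn (by exact_mod_cast h₅.trans (h₂.trans h₄))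
  refine ⟨rfl, (Algebra.IsAlgebraic.isTranscendenceBasis_of_lift_le_trdeg_of_finite k (v ∘ Sum.inl)
    (by simpa using h₅)).1⟩

end Field

/-- The irreducible components of `Spec A` have at least `n` algebraically independent rational
functions. -/
def HasIndependentFunctions {k A : Type u} [Field k] [CommRing A] (φ : k →+* A) (n : ℕ) : Prop :=
  ∀ P ∈ minimalPrimes A, ∃ (F : Type u) (_ : Field F) (_ : Algebra k F) (χ : A →+* F),
    χ.comp φ = algebraMap k F ∧ RingHom.ker χ = P ∧ (∀ z, ∃ a b, χ b ≠ 0 ∧ z * χ b = χ a) ∧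
    ∃ x : Fin n → F, AlgebraicIndependent k x

end Transcendence

/-! ### Equations of a reduced scheme along an arc -/

section Detection

variable {k A : Type u} [Field k] [CommRing A] {φ : k →+* A} {n : ℕ} {m l : ℕ}
    {p : Fin l → MvPolynomial (Fin m ⊕ Fin l) k} (π : MvPolynomial (Fin m ⊕ Fin l) k →+* A)

/-- A component on which the determinant is nonzero dominates `𝔸^m`. This is the hypothesis on
minimal primes in `exists_generator`. -/
lemma HasIndependentFunctions.eq_and_injective (hA : HasIndependentFunctions φ n)
    (hπ : Function.Surjective π) (hπφ : π.comp MvPolynomial.C = φ) (hp : ∀ i, π (p i) = 0)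
    (hmn : m ≤ n) (P : Ideal A) (hP : P ∈ minimalPrimes A) (hg : π (yJacobian p) ∉ P) :
    m = n ∧ ∀ q : MvPolynomial (Fin m) k, π (MvPolynomial.rename Sum.inl q) ∈ P → q = 0 := by
  obtain ⟨F, _, _, χ, hχφ, rfl, hF, x, hx⟩ := hA P hP
  let v (j : Fin m ⊕ Fin l) : F := χ (π (MvPolynomial.X j))
  have hv (q) : MvPolynomial.aeval v q = χ (π q) := by
    have : (MvPolynomial.aeval (R := k) v).toRingHom = χ.comp π := by
      refine MvPolynomial.ringHom_ext (fun a ↦ ?_) fun j ↦ ?_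
      · have h₁ : π (MvPolynomial.C a) = φ a := congr($hπφ a)
        have h₂ : χ (φ a) = algebraMap k F a := congr($hχφ a)
        simp [h₁, h₂]
      · simp [v]
    exact congr($this q)
  obtain ⟨h₁, h₂⟩ := eq_and_algebraicIndependent_of_yJacobian_ne_zero (p := p) (v := v)
    (fun i ↦ by rw [hv, hp, map_zero]) (by rwa [hv]) (fun z ↦ by
      obtain ⟨a, b, hb, h⟩ := hF z
      obtain ⟨a, rfl⟩ := hπ a
      obtain ⟨b, rfl⟩ := hπ b
      exact ⟨a, b, by rwa [hv], by rw [hv, hv, h]⟩) hmn hx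
  refine ⟨h₁, fun q hq ↦ algebraicIndependent_iff.mp h₂ q ?_⟩
  rw [← MvPolynomial.aeval_rename, hv]
  exact hq

open PowerSeries in
/-- The vanishing of the equations of a reduced scheme along an arc on which a Jacobian determinant
has order `e` can be checked on sufficiently many coefficients. -/
theorem HasIndependentFunctions.exists_forall_eq_zero [_root_.IsReduced A] (hA : HasIndependentFunctions φ n)
    (hπ : Function.Surjective π) (hπφ : π.comp MvPolynomial.C = φ) (hp : ∀ i, π (p i) = 0)
    (hmn : m ≤ n) (e : ℕ) :
    π (yJacobian p) = 0 ∨ m = n ∧ ∃ c₀, ∀ c ≥ c₀,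
      ∀ (T : Type u) [CommRing T] [Algebra k T] (v : Fin m ⊕ Fin l → T⟦X⟧),
      (∀ i, MvPolynomial.aeval v (p i) = 0) →
      HasExactOrder e (MvPolynomial.aeval v (yJacobian p)) →
      (∀ h ∈ RingHom.ker π, ∀ i ≤ c, coeff i (MvPolynomial.aeval v h) = 0) →
      ∀ h ∈ RingHom.ker π, MvPolynomial.aeval v h = 0 := by
  by_cases hg : π (yJacobian p) = 0
  · exact .inl hg
  have hmem (a : A) (ha : ∀ P ∈ minimalPrimes A, a ∈ P) : a = 0 := by
    have : a ∈ sInf (minimalPrimes A) := Ideal.mem_sInf.mpr fun {P} hP ↦ ha P hP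
    rw [minimalPrimes, Ideal.sInf_minimalPrimes] at this
    exact (mem_nilradical.mp this).eq_zero
  refine .inr ⟨?_, ?_⟩
  -- If `m ≠ n`, the determinant vanishes on every component, hence is zero as `A` is reduced.
  · by_contra hne
    exact hg (hmem _ fun P hP ↦ by_contra fun h ↦
      hne (hA.eq_and_injective π hπ hπφ hp hmn P hP h).1)
  have hker : (RingHom.ker π).minimalPrimes = Ideal.comap π '' minimalPrimes A := by
    rw [minimalPrimes, ← Ideal.comap_minimalPrimes_eq_of_surjective hπ]
    rfl
  have hrad : (RingHom.ker π).IsRadical := by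
    rintro a ⟨N, ha⟩
    rw [RingHom.mem_ker, map_pow] at ha
    exact (eq_zero_of_pow_eq_zero ha)
  obtain ⟨h, hh, s, h₁, h₂⟩ := exists_generator p (RingHom.ker π) hrad hp (by
    intro P hP hgP q hq
    rw [hker] at hP
    obtain ⟨P, hP, rfl⟩ := hP
    exact (hA.eq_and_injective π hπ hπφ hp hmn P hP hgP).2 q hq)
  -- Along the arc, `g ^ s` is `X ^ (e * s)` times a unit. If `h` is divisible by one more power of
  -- `X`, the relation `h ^ 2 = g ^ s * h` reads `X ^ (e * s) * unit * h = 0`, which forces `h = 0`.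
  refine ⟨e * s, fun c hc T _ _ v hpv hgv hv j hj ↦ ?_⟩
  have hspan (a) (ha : a ∈ Ideal.span (Set.range p)) : MvPolynomial.aeval v a = 0 := by
    have : Ideal.span (Set.range p) ≤ RingHom.ker (MvPolynomial.aeval (R := k) v) := by
      rw [Ideal.span_le]
      rintro _ ⟨i, rfl⟩
      exact hpv i
    exact this ha
  obtain ⟨w, hw, hgw⟩ := hgv.exists_eq
  have h₃ := hspan _ h₁
  have hH : X ^ (e * s + 1) ∣ MvPolynomial.aeval v h :=
    X_pow_dvd_iff.mpr fun i hi ↦ hv h hh i (by omega)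
  have hX {a : T⟦X⟧} {N : ℕ} (ha : X ^ N * a = 0) : a = 0 := by
    ext i
    simpa [coeff_X_pow_mul] using congr(coeff (i + N) $ha)
  have hH0 : MvPolynomial.aeval v h = 0 := by
    obtain ⟨H, hH⟩ := hH
    rw [map_sub, map_mul, map_pow, map_pow, hgw] at h₃
    have h₄ : X ^ (e * s) * ((X * H - w ^ s) * MvPolynomial.aeval v h) = 0 := by
      rw [← h₃, pow_two]
      nth_rw 2 [hH]
      ring
    have hu : IsUnit (X * H - w ^ s) := by
      rw [PowerSeries.isUnit_iff_constantCoeff] at hw ⊢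
      simpa using hw.pow s
    exact (hu.mul_right_eq_zero).mp (hX h₄)
  -- Any other equation is a multiple of `h` up to a power of `g`, which is a nonzerodivisor along
  -- the arc.
  obtain ⟨t, b, h₅⟩ := h₂ j hj
  have h₆ := hspan _ h₅
  rw [map_sub, map_mul, map_mul, hH0, mul_zero, sub_zero, map_pow, hgw, mul_pow, ← pow_mul,
    mul_assoc] at h₆
  exact ((hw.pow t).mul_right_eq_zero).mp (hX h₆)

end Detection

/-! ### Generators of Fitting ideals -/

section FittingGenerators

variable {A : Type*} [CommRing A]

/-- An ideal which contains the determinants of the matrices with rows in `C` contains those of the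
matrices with rows in the span of `C`. -/
lemma det_mem_of_forall_mem_span {κ : Type*} [Fintype κ] [DecidableEq κ] (I : Ideal A)
    (C : Set (κ → A)) (hC : ∀ W : Matrix κ κ A, (∀ i, W i ∈ C) → W.det ∈ I)
    (W : Matrix κ κ A) (hW : ∀ i, W i ∈ Submodule.span A C) : W.det ∈ I := by
  have key (s : Finset κ) : ∀ W : Matrix κ κ A, (∀ i, W i ∈ Submodule.span A C) →
      (∀ i ∉ s, W i ∈ C) → W.det ∈ I := by
    induction s using Finset.induction_on with
    | empty => exact fun W _ h ↦ hC W fun i ↦ h i (by simp)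
    | insert i s _ ih =>
      intro W hW hWC
      have h (x) (hx : x ∈ Submodule.span A C) : (W.updateRow i x).det ∈ I := by
        induction hx using Submodule.span_induction with
        | mem x hx =>
          refine ih _ (fun j ↦ ?_) fun j hj ↦ ?_
          · rcases eq_or_ne j i with rfl | hji
            · simpa using Submodule.subset_span hx
            · simpa [Matrix.updateRow_ne hji] using hW j
          · rcases eq_or_ne j i with rfl | hji
            · simpa using hx
            · simpa [Matrix.updateRow_ne hji] using hWC j (by simp [hji, hj])
        | zero =>
          rw [Matrix.det_eq_zero_of_row_eq_zero i (by simp)]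
          exact I.zero_mem
        | add x y _ _ hx hy =>
          rw [Matrix.det_updateRow_add]
          exact I.add_mem hx hy
        | smul a x _ hx =>
          rw [Matrix.det_updateRow_smul]
          exact I.mul_mem_left _ hx
      simpa using h (W i) (hW i)
  exact key Finset.univ W hW (by simp)

variable {M : Type*} [AddCommGroup M] [Module A M] {ι : Type*} [Fintype ι]

/-- The ideal generated by the minors of size at least `#ι - j` of the matrices of relations between
the elements `u i`. -/
def relationMinors (u : ι → M) (j : ℕ) : Ideal A :=
  Ideal.span {x | ∃ (q : ℕ) (R : Matrix (Fin q) ι A) (c : Fin q → ι), Fintype.card ι ≤ q + j ∧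
    (∀ i, ∑ b, R i b • u b = 0) ∧ x = (R.submatrix id c).det}

/-- Laplace expansion along the first `a` columns, which are arbitrary. Each expansion costs one row
and one column, which the term `a` in the size bound pays for. -/
lemma det_mem_relationMinors_of_fin (u : ι → M) (j a : ℕ) : ∀ (s : ℕ) (W : Matrix (Fin s) (Fin s) A)
    (R : Matrix (Fin s) ι A) (c : Fin s → ι), Fintype.card ι + a ≤ s + j →
    (∀ i, ∑ b, R i b • u b = 0) → (∀ i b, a ≤ b.1 → W i b = R i (c b)) →
    W.det ∈ relationMinors u j := by
  induction a with
  | zero =>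
    intro s W R c hs hR hW
    refine Ideal.subset_span ⟨s, R, c, hs, hR, ?_⟩
    congr 1
    ext i b
    exact hW i b (Nat.zero_le _)
  | succ a ih =>
    intro s W R c hs hR hW
    rcases s with _ | s
    · exact ih 0 W R c (by omega) hR fun i ↦ i.elim0
    · rw [Matrix.det_succ_column_zero]
      refine Ideal.sum_mem _ fun i _ ↦ Ideal.mul_mem_left _ _ ?_
      exact ih s _ (R.submatrix i.succAbove id) (c ∘ Fin.succ) (by omega) (fun i' ↦ hR _)
        fun i' b hb ↦ hW _ _ (by simpa using hb)

/-- A repeated column of `Q` makes the determinant zero. Otherwise at most `card α` columns come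
from `Q`; they are moved to the front and expanded away. -/
lemma det_mem_relationMinors {κ α : Type*} [Fintype κ] [DecidableEq κ] [Fintype α] (u : ι → M)
    (j : ℕ) (W : Matrix κ κ A) (Q : Matrix κ α A) (R : Matrix κ ι A) (t : κ → α ⊕ ι)
    (hcard : Fintype.card ι + Fintype.card α ≤ Fintype.card κ + j)
    (hR : ∀ i, ∑ b, R i b • u b = 0) (hW : ∀ i b, W i b = Sum.elim (Q i) (R i) (t b)) :
    W.det ∈ relationMinors u j := by
  classical
  by_cases hinj : ∀ b b' x, t b = .inl x → t b' = .inl x → b = b'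
  · let κ₁ := {b : κ // (t b).isLeft}
    let κ₂ := {b : κ // ¬ (t b).isLeft}
    have h₁ : Fintype.card κ₁ ≤ Fintype.card α := by
      refine Fintype.card_le_of_injective (fun b ↦ (t b.1).getLeft b.2) fun b b' h ↦ ?_
      refine Subtype.ext (hinj _ _ ((t b.1).getLeft b.2) (by simp) ?_)
      have h' : (t b.1).getLeft b.2 = (t b'.1).getLeft b'.2 := h
      rw [h']
      simp
    let σ : Fin (Fintype.card κ₁ + Fintype.card κ₂) ≃ κ :=
      finSumFinEquiv.symm.trans ((Equiv.sumCongr (Fintype.equivFin κ₁).symm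
        (Fintype.equivFin κ₂).symm).trans (Equiv.sumCompl _))
    have hcard' : Fintype.card κ₁ + Fintype.card κ₂ = Fintype.card κ := by
      simpa using Fintype.card_congr σ
    have hσ (b : Fin (Fintype.card κ₁ + Fintype.card κ₂)) (hb : Fintype.card κ₁ ≤ b.1) :
        ∃ x, t (σ b) = .inr x := by
      obtain ⟨b, rfl⟩ := finSumFinEquiv.surjective b
      rcases b with b | b
      · simp only [finSumFinEquiv_apply_left, Fin.val_castAdd] at hb
        omega
      · have : σ (finSumFinEquiv (.inr b)) = ((Fintype.equivFin κ₂).symm b).1 := by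
          simp only [σ, Equiv.trans_apply, Equiv.symm_apply_apply]
          rfl
        rw [this]
        have := ((Fintype.equivFin κ₂).symm b).2
        simpa [Sum.isRight_iff] using this
    rw [← Matrix.det_submatrix_equiv_self σ]
    by_cases hι : Nonempty ι
    · let c (b : Fin (Fintype.card κ₁ + Fintype.card κ₂)) : ι :=
        (t (σ b)).elim (fun _ ↦ Classical.choice hι) id
      refine det_mem_relationMinors_of_fin u j (Fintype.card κ₁) _ _ (R.submatrix σ id) c (by omega)
        (fun i ↦ hR _) fun i b hb ↦ ?_
      obtain ⟨x, hx⟩ := hσ b hb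
      simp [hW, c, hx]
    · have := not_nonempty_iff.mp hι
      have h : (1 : A) ∈ relationMinors u j :=
        Ideal.subset_span ⟨0, Matrix.of Fin.elim0, Fin.elim0, by simp, fun i ↦ i.elim0, by simp⟩
      rw [(Ideal.eq_top_iff_one _).mpr h]
      exact Submodule.mem_top
  · push Not at hinj
    obtain ⟨b, b', x, hb, hb', hne⟩ := hinj
    rw [Matrix.det_zero_of_column_eq hne fun i ↦ by rw [hW, hW, hb, hb']]
    exact Ideal.zero_mem _

/-- Fitting ideals can be computed with any finite family of generators. -/
lemma fittingIdeal_le_relationMinors (u : ι → M) (hu : Submodule.span A (Set.range u) = ⊤) (j : ℕ) :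
    fittingIdeal A M j ≤ relationMinors u j := by
  classical
  refine Ideal.span_le.mpr ?_
  rintro _ ⟨r, p, v, ρ, c, hj, hv, hρ, rfl⟩
  have hκ (b : ι) : ∃ κ : Fin r → A, ∑ l, κ l • v l = u b :=
    (Submodule.mem_span_range_iff_exists_fun A).mp (hv ▸ Submodule.mem_top)
  have hl (b : Fin r) : ∃ κ : ι → A, ∑ l, κ l • u l = v b :=
    (Submodule.mem_span_range_iff_exists_fun A).mp (hu ▸ Submodule.mem_top)
  choose κ hκ using hκ
  choose τ hτ using hl
  let Q : Matrix (Fin p ⊕ ι) (Fin r) A :=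
    Matrix.of fun i ↦ Sum.elim (fun i ↦ ρ i) (fun b l ↦ -κ b l) i
  -- The relations `ρ` and `u = κ v` are rewritten in terms of `u` alone, by substituting `v = τ u`.
  let R : Matrix (Fin p ⊕ ι) ι A := Q * Matrix.of τ + 
    Matrix.of fun i ↦ Sum.elim (fun _ _ ↦ 0) (fun b ↦ (1 : Matrix ι ι A) b) i
  have hR (i) : ∑ b, R i b • u b = 0 := by
    have h₁ : ∑ b, (Q * Matrix.of τ) i b • u b = ∑ l, Q i l • v l := by
      simp only [Matrix.mul_apply, Finset.sum_smul, mul_smul, ← hτ, Finset.smul_sum, Matrix.of_apply]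
      exact Finset.sum_comm
    simp only [R, Matrix.add_apply, add_smul, Finset.sum_add_distrib, h₁]
    rcases i with i | b
    · simp [Q, hρ]
    · simp [Q, hκ, Matrix.one_apply]
  -- Adding the relations `u = κ v` with an identity block does not change the minor. The columns of
  -- this block are those of `R` minus combinations of the columns of `Q`, so multilinearity
  -- applies.
  let W : Matrix (Fin p ⊕ ι) (Fin p ⊕ ι) A :=
    Matrix.fromBlocks (ρ.submatrix id c) 0 (Matrix.of fun b l ↦ -κ b (c l)) 1
  have hdet : W.det = (ρ.submatrix id c).det := by
    rw [Matrix.det_fromBlocks_zero₁₂, Matrix.det_one, mul_one]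
  change _ ∈ relationMinors u j
  rw [← hdet, ← Matrix.det_transpose]
  let col (t : Fin r ⊕ ι) (i : Fin p ⊕ ι) : A := Sum.elim (Q i) (R i) t
  refine det_mem_of_forall_mem_span _ (Set.range col) (fun V hV ↦ ?_) _ fun b ↦ ?_
  · choose t ht using hV
    rw [← Matrix.det_transpose]
    refine det_mem_relationMinors u j _ Q R t (by simp; omega) hR fun i b ↦ ?_
    exact congr($(ht b) i).symm
  · rcases b with b | b
    · refine Submodule.subset_span ⟨.inl (c b), ?_⟩
      ext (i | i) <;> simp [col, W, Q]
    · have : W.transpose (.inr b) = col (.inr b) - ∑ l, τ l b • col (.inl l) := by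
        ext i
        rw [Pi.sub_apply, Finset.sum_apply]
        simp only [Pi.smul_apply, col, Sum.elim_inl, Sum.elim_inr, R, Matrix.add_apply,
          Matrix.mul_apply, Matrix.of_apply, smul_eq_mul]
        rw [Finset.sum_congr rfl fun l _ ↦ mul_comm (Q i l) (τ l b), add_sub_cancel_left]
        rcases i with i | i <;> simp [W]
      rw [this]
      exact sub_mem (Submodule.subset_span ⟨_, rfl⟩)
        (Submodule.sum_mem _ fun l _ ↦ Submodule.smul_mem _ _ (Submodule.subset_span ⟨_, rfl⟩))

end FittingGenerators

/-! ### Fitting ideals of differentials and Jacobian minors -/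

section JacobianMinors

open KaehlerDifferential TensorProduct

variable {k A : Type u} [CommRing k] [CommRing A] [Algebra k A] {N : ℕ}
  (π : MvPolynomial (Fin N) k →ₐ[k] A)

/-- The relations between the differentials of coordinates are the differentials of equations. -/
lemma exists_pderiv_eq_of_sum_smul_eq_zero (hπ : Function.Surjective π) (a : Fin N → A)
    (ha : ∑ b, a b • D k A (π (.X b)) = 0) :
    ∃ F, π F = 0 ∧ ∀ b, π (MvPolynomial.pderiv b F) = a b := by
  let := π.toRingHom.toAlgebra
  have : IsScalarTower k (MvPolynomial (Fin N) k) A :=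
    .of_algebraMap_eq fun x ↦ (π.commutes x).symm
  obtain ⟨y, hy⟩ := (exact_kerCotangentToTensor_mapBaseChange k (MvPolynomial (Fin N) k) A hπ
    (∑ b, a b ⊗ₜ D k _ (.X b))).mp (by
      rw [map_sum, ← ha]
      refine Finset.sum_congr rfl fun b _ ↦ ?_
      rw [mapBaseChange_tmul, KaehlerDifferential.map_D]
      rfl)
  -- In the conormal sequence, the kernel of the map to `Ω[A⁄k]` is the image of `I/I²` itself, so
  -- one polynomial suffices.
  obtain ⟨F, rfl⟩ := Ideal.toCotangent_surjective _ y
  refine ⟨F, F.2, fun b ↦ ?_⟩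
  have h := congr((((Algebra.linearMap (MvPolynomial (Fin N) k) A).comp
    ((mvPolynomialBasis k (Fin N)).coord b)).liftBaseChange A) $hy)
  rw [kerCotangentToTensor_toCotangent, LinearMap.liftBaseChange_tmul, map_sum] at h
  simp only [LinearMap.liftBaseChange_tmul, LinearMap.comp_apply, Module.Basis.coord_apply,
    mvPolynomialBasis_repr_D_X, mvPolynomialBasis_repr_apply, one_smul] at h
  refine h.trans ?_
  simp [Finsupp.single_apply]

/-- The minors of size at least `N - n` of the Jacobian matrices of the equations of a closed
subscheme of the affine space of dimension `N`. -/
def jacobianMinors (n : ℕ) : Set A :=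
  {x | ∃ (q : ℕ) (F : Fin q → MvPolynomial (Fin N) k) (c : Fin q → Fin N), N ≤ q + n ∧
    (∀ i, π (F i) = 0) ∧ x = π (Matrix.of fun a b ↦ MvPolynomial.pderiv (c b) (F a)).det}

lemma fittingIdeal_eq_span_jacobianMinors (hπ : Function.Surjective π) (n : ℕ) :
    fittingIdeal A (Ω[A⁄k]) n = Ideal.span (jacobianMinors π n) := by
  have hD (F : MvPolynomial (Fin N) k) : D k A (π F) =
      ∑ b, π (MvPolynomial.pderiv b F) • D k A (π (.X b)) := by
    induction F using MvPolynomial.induction_on with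
    | C a => simp
    | add q r hq hr => simp [hq, hr, add_smul, Finset.sum_add_distrib]
    | mul_X q i hq =>
      classical
      simp only [map_mul, Derivation.leibniz, hq, MvPolynomial.pderiv_X, smul_eq_mul, map_add,
        add_smul, Finset.sum_add_distrib, Finset.smul_sum, mul_smul]
      congr 1
      rw [Finset.sum_eq_single i]
      · simp
      · intro j _ hj
        simp [hj.symm]
      · simp
  have hspan : Submodule.span A (Set.range fun b ↦ D k A (π (.X b))) = ⊤ := by
    rw [eq_top_iff, ← span_range_derivation, Submodule.span_le]
    rintro _ ⟨a, rfl⟩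
    obtain ⟨F, rfl⟩ := hπ a
    rw [hD]
    exact Submodule.sum_mem _ fun b _ ↦ Submodule.smul_mem _ _ (Submodule.subset_span ⟨b, rfl⟩)
  apply le_antisymm
  · refine (fittingIdeal_le_relationMinors _ hspan n).trans (Ideal.span_mono ?_)
    rintro _ ⟨q, R, c, hq, hR, rfl⟩
    choose F hF hF' using fun i ↦ exists_pderiv_eq_of_sum_smul_eq_zero π hπ (R i) (hR i)
    refine ⟨q, F, c, by simpa using hq, hF, ?_⟩
    rw [AlgHom.map_det]
    congr 1
    ext i b
    simp [hF']
  · refine Ideal.span_le.mpr ?_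
    rintro _ ⟨q, F, c, hq, hF, rfl⟩
    rw [AlgHom.map_det]
    exact det_mem_fittingIdeal (by simpa using hq) _ hspan
      (Matrix.of fun i b ↦ π (MvPolynomial.pderiv b (F i))) (fun i ↦ by
        simp only [Matrix.of_apply]
        rw [← hD, hF, map_zero]) c

/-- A nonzero Jacobian minor is the Jacobian determinant of a special complete intersection. -/
lemma exists_yJacobian_eq_of_mem_jacobianMinors (hπ : Function.Surjective π) {n : ℕ} {x : A}
    (hx : x ∈ jacobianMinors π n) (hx0 : x ≠ 0) :
    ∃ (m l : ℕ) (p : Fin l → MvPolynomial (Fin m ⊕ Fin l) k)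
      (ψ : MvPolynomial (Fin m ⊕ Fin l) k →ₐ[k] A), m ≤ n ∧ Function.Surjective ψ ∧
      (∀ i, ψ (p i) = 0) ∧ x = ψ (yJacobian p) := by
  classical
  obtain ⟨q, F, c, hq, hF, rfl⟩ := hx
  -- The columns of a nonzero minor are distinct. Their variables become `y`, and the remaining `m =
  -- N - q ≤ n` variables become `x`.
  have hc : Function.Injective c := by
    intro b b' h
    by_contra hne
    apply hx0
    rw [Matrix.det_zero_of_column_eq hne (by simp [h]), map_zero]
  let m := Fintype.card {i // i ∉ Set.range c}
  let σ : Fin m ⊕ Fin q ≃ Fin N :=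
    (Equiv.sumComm _ _).trans <| (Equiv.sumCongr (Equiv.ofInjective c hc)
      (Fintype.equivFin {i // i ∉ Set.range c}).symm).trans (Equiv.sumCompl (· ∈ Set.range c))
  have hσ (b) : σ (.inr b) = c b := rfl
  have hm : m + q = N := by simpa using Fintype.card_congr σ
  refine ⟨m, q, fun i ↦ MvPolynomial.rename σ.symm (F i), π.comp (MvPolynomial.rename σ), by omega,
    ?_, fun i ↦ ?_, ?_⟩
  · exact hπ.comp (MvPolynomial.renameEquiv k σ).surjective
  · simp [MvPolynomial.rename_rename, hF]
  · rw [yJacobian, AlgHom.comp_apply, AlgHom.map_det (MvPolynomial.rename σ)]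
    congr 2
    ext1 i b
    simp only [Matrix.of_apply, AlgHom.mapMatrix_apply, Matrix.map_apply]
    have := MvPolynomial.pderiv_rename (f := σ.symm) σ.symm.injective (c b) (F i)
    rw [← hσ, Equiv.symm_apply_apply] at this
    rw [this, MvPolynomial.rename_rename, hσ]
    simp

end JacobianMinors

/-! ### The rings of the strata -/

section AffineStratum

open PowerSeries

variable {k : Type u} [Field k] {A : Type u} [CommRing A]

/-- The condition `1 ≤ n` ensures that `Fin m × ℕ` is countably infinite, since `m = n`. The value
`x = 0` is allowed because lists of generators are padded by zero; the stratum is then empty. -/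
theorem RepresentsArcs.exists_ringEquiv_of_mem_jacobianMinors [Algebra k A] [_root_.IsReduced A]
    {n N : ℕ} (hn : 1 ≤ n) (hA : HasIndependentFunctions (algebraMap k A) n)
    (π : MvPolynomial (Fin N) k →ₐ[k] A) (hπ : Function.Surjective π) {x : A}
    (hx : x ≠ 0 → x ∈ jacobianMinors π n) {E : Set (A × ℕ)} (hE : E.Finite) {e : ℕ} {R : Type u}
    [CommRing R] {χ : ArcAlgebra (algebraMap k A) ⊥ 0 →+* R} (hχ : RepresentsArcs χ E x e)
    (hχ₀ : ∀ i < e, χ (ArcAlgebra.coeff (algebraMap k A) ⊥ 0 x i) = 0) :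
    ∃ (B : Type u) (_ : CommRing B) (_ : Algebra k B), Algebra.FiniteType k B ∧
      ∃ Φ : R ≃+* MvPolynomial (ULift.{u} ℕ) B, ∀ c,
        Φ (χ (ArcAlgebra.of (algebraMap k A) ⊥ 0 (algebraMap k A c))) =
          MvPolynomial.C (algebraMap k B c) := by
  by_cases hx0 : x = 0
  · have h0 : (0 : R) = χ (ArcAlgebra.coeff (algebraMap k A) ⊥ 0 x e) := by
      have := congr(coeff e $(map_zero (ArcAlgebra.univ (algebraMap k A) ⊥ 0)))
      have h₁ : ArcAlgebra.coeff (algebraMap k A) ⊥ 0 0 e = 0 := by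
        simpa [ArcAlgebra.univ] using this
      rw [hx0, h₁, map_zero]
    have : Subsingleton R := subsingleton_of_zero_eq_one
      (isUnit_zero_iff.mp (h0 ▸ hχ.isUnit))
    let : Algebra k R := (χ.comp ((ArcAlgebra.of (algebraMap k A) ⊥ 0).comp (algebraMap k A))).toAlgebra
    exact ⟨R, inferInstance, inferInstance, inferInstance,
      { toFun := MvPolynomial.C
        invFun := fun _ ↦ 0
        left_inv := fun _ ↦ Subsingleton.elim _ _
        right_inv := fun _ ↦ Subsingleton.elim _ _
        map_mul' := map_mul _
        map_add' := map_add _ }, fun c ↦ rfl⟩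
  obtain ⟨m, l, p, ψ, hmn, hψ, hp, rfl⟩ := exists_yJacobian_eq_of_mem_jacobianMinors π hπ (hx hx0) hx0
  have hψφ : (ψ : MvPolynomial (Fin m ⊕ Fin l) k →+* A).comp MvPolynomial.C = algebraMap k A :=
    RingHom.ext fun c ↦ ψ.commutes c
  obtain ⟨rfl, c₀, hc₀⟩ := (hA.exists_forall_eq_zero (ψ : MvPolynomial (Fin m ⊕ Fin l) k →+* A) hψ hψφ
    hp hmn e).resolve_left hx0
  obtain ⟨c₁, hc₁⟩ := (hE.image Prod.snd).bddAbove
  -- The bound `c` must dominate the order `e`, the index `c₀` up to which the equations have to be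
  -- checked, and the indices `c₁` that occur in `E`.
  obtain ⟨B, _, _, hB, Φ, hΦ⟩ := RepresentsArcs.exists_ringEquiv_mvPolynomial
    (ψ : MvPolynomial (Fin m ⊕ Fin l) k →+* A) (c := max e (max c₀ c₁)) hχ hψ hψφ hp (by simp)
    (Nat.zero_le _) (fun x hx ↦ (hc₁ ⟨x, hx, rfl⟩).trans (by simp)) hχ₀ (hc₀ _ (by simp))
  have : NeZero m := ⟨by omega⟩
  have hcard : Nonempty (Fin m × ℕ ≃ ULift.{u} ℕ) :=
    ⟨(nonempty_denumerable (Fin m × ℕ)).some.eqv.trans Equiv.ulift.symm⟩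
  obtain ⟨σ⟩ := hcard
  refine ⟨B, _, _, hB, Φ.trans (MvPolynomial.renameEquiv B σ).toRingEquiv, fun c ↦ ?_⟩
  simp [hΦ]

/-- Here the equations `p` generate the whole ideal, so there is nothing to detect and `c = d`
suffices. The coefficients of index below `d` vanish by the contact relations. -/
theorem exists_ringEquiv_specialCI {m l : ℕ} (p : Fin l → MvPolynomial (Fin m ⊕ Fin l) k)
    (π : MvPolynomial (Fin m ⊕ Fin l) k →+* A) (hπ : Function.Surjective π)
    (hker : RingHom.ker π = Ideal.span (Set.range p)) (φ : k →+* A)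
    (hπφ : π.comp MvPolynomial.C = φ) (I : Ideal A) (hI : π (yJacobian p) ∈ I) (d : ℕ) (R : Type u)
    [CommRing R] [Algebra (ArcAlgebra φ I d) R]
    [IsLocalization.Away (ArcAlgebra.coeff φ I d (π (yJacobian p)) d) R] :
    ∃ (B : Type u) (_ : CommRing B) (_ : Algebra k B), Algebra.FiniteType k B ∧
      ∃ Φ : R ≃+* MvPolynomial (Fin m × ℕ) B,
        ∀ c, Φ (algebraMap _ R (ArcAlgebra.of φ I d (φ c))) = MvPolynomial.C (algebraMap k B c) := by
  have hχ : RepresentsArcs (algebraMap (ArcAlgebra φ I d) R) ∅ (π (yJacobian p)) d :=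
    { map_eq_zero := by simp
      isUnit := IsLocalization.Away.algebraMap_isUnit _
      exists_lift := fun T _ τ _ hτ ↦ ⟨IsLocalization.Away.lift _ hτ, by ext1; simp⟩
      hom_ext := fun T _ f f' h ↦ IsLocalization.ringHom_ext (Submonoid.powers
        (ArcAlgebra.coeff φ I d (π (yJacobian p)) d)) h }
  refine RepresentsArcs.exists_ringEquiv_mvPolynomial π hχ hπ hπφ (c := d) (p := p) (fun i ↦ ?_) le_rfl
    (by omega) (by simp) (fun i hi ↦ ?_) ?_
  · rw [← RingHom.mem_ker, hker]
    exact Ideal.subset_span ⟨i, rfl⟩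
  · rw [ArcAlgebra.coeff_contact φ I d hI hi, map_zero]
  · intro T _ _ v hv _ _ h hh
    rw [hker] at hh
    have : Ideal.span (Set.range p) ≤ RingHom.ker (MvPolynomial.aeval (R := k) v) := by
      rw [Ideal.span_le]
      rintro _ ⟨i, rfl⟩
      exact hv i
    exact this hh

/-- The algebra of arcs of a polynomial ring is a polynomial ring. -/
theorem ArcAlgebra.exists_ringEquiv_mvPolynomial {σ : Type u} (φ : k →+* A)
    (Ψ : MvPolynomial σ k ≃+* A) (hΨ : ∀ c, Ψ (MvPolynomial.C c) = φ c) :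
    ∃ Φ : ArcAlgebra φ ⊥ 0 ≃+* MvPolynomial (σ × ℕ) k,
      ∀ c, Φ (ArcAlgebra.of φ ⊥ 0 (φ c)) = MvPolynomial.C c := by
  let v (j : σ) : (MvPolynomial (σ × ℕ) k)⟦X⟧ := PowerSeries.mk fun i ↦ MvPolynomial.X (j, i)
  let γ : A →+* (MvPolynomial (σ × ℕ) k)⟦X⟧ :=
    (MvPolynomial.aeval (R := k) v).toRingHom.comp Ψ.symm.toRingHom
  have hγ (a : MvPolynomial σ k) : γ (Ψ a) = MvPolynomial.aeval v a := by simp [γ]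
  have hγφ (c : k) : γ (φ c) = PowerSeries.C (MvPolynomial.C c) := by
    rw [← hΨ, hγ, MvPolynomial.algHom_C, PowerSeries.algebraMap_apply, MvPolynomial.algebraMap_eq]
  let Φ : ArcAlgebra φ ⊥ 0 →+* MvPolynomial (σ × ℕ) k :=
    ArcAlgebra.lift φ ⊥ 0 γ (fun c i ↦ by rw [hγφ, PowerSeries.coeff_C]; simp) (by simp)
  have hΦ (a : A) (i : ℕ) : Φ (ArcAlgebra.coeff φ ⊥ 0 a i) = PowerSeries.coeff i (γ a) := by simp [Φ]
  have hΦof (c : k) : Φ (ArcAlgebra.of φ ⊥ 0 (φ c)) = MvPolynomial.C c := by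
    rw [← ArcAlgebra.coeff_zero_right, hΦ, hγφ, PowerSeries.coeff_C]
    simp
  let Θ : MvPolynomial (σ × ℕ) k →+* ArcAlgebra φ ⊥ 0 :=
    MvPolynomial.eval₂Hom ((ArcAlgebra.of φ ⊥ 0).comp φ)
      fun x ↦ ArcAlgebra.coeff φ ⊥ 0 (Ψ (MvPolynomial.X x.1)) x.2
  refine ⟨RingEquiv.ofRingHom Φ Θ ?_ ?_, hΦof⟩
  · refine MvPolynomial.ringHom_ext (fun c ↦ ?_) fun x ↦ ?_
    · simp [Θ, hΦof]
    · simp [Θ, hΦ, hγ, v]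
  · have h : (PowerSeries.map Θ).comp (MvPolynomial.aeval (R := k) v).toRingHom =
        (ArcAlgebra.univ φ ⊥ 0).comp Ψ.toRingHom := by
      refine MvPolynomial.ringHom_ext (fun c ↦ ?_) fun j ↦ ?_
      · have h₁ : (MvPolynomial.aeval (R := k) v).toRingHom (MvPolynomial.C c) =
            PowerSeries.C (MvPolynomial.C c) := by rw [← hγφ, ← hΨ, hγ]; rfl
        rw [RingHom.comp_apply, h₁]
        ext i
        rw [PowerSeries.map_C, PowerSeries.coeff_C]
        rcases i with _ | i
        · simp [Θ, ArcAlgebra.univ, hΨ, ArcAlgebra.coeff_zero_right]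
        · simp [ArcAlgebra.univ, hΨ, ArcAlgebra.coeff_const]
      · ext i
        simp [v, Θ, ArcAlgebra.univ]
    refine ArcAlgebra.hom_ext fun a i ↦ ?_
    obtain ⟨a, rfl⟩ := Ψ.surjective a
    rw [RingHom.comp_apply, hΦ, hγ]
    exact (congr(PowerSeries.coeff i ($h a))).trans (by simp [ArcAlgebra.univ])

end AffineStratum

/-! ### The affine charts of the arc space -/

section Charts

open Scheme Scheme.AffineZariskiSite Opposite

variable {k : Type u} [CommRing k] {X : Scheme.{u}} (f : X ⟶ Spec (.of k))
  (Z : X.IdealSheafData) (e : ℕ)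

lemma fromSpec_comp {U : X.Opens} (hU : IsAffineOpen U) :
    hU.fromSpec ≫ f = Spec.map (CommRingCat.ofHom (constants f U)) := by
  rw [constants, CommRingCat.ofHom_hom, Spec.map_comp,
    ← IsAffineOpen.SpecMap_appLE_fromSpec f (isAffineOpen_top _) hU
      (le_top.trans_eq f.preimage_top.symm), IsAffineOpen.fromSpec_top, Scheme.isoSpec_Spec_inv]

/-- The open subset of `contactGE f Z e` lying over the affine open subset `U` of `X`. -/
def contactGE.chart (U : X.AffineZariskiSite) :
    Spec (.of (arcAlgebra f Z e U)) ⟶ contactGE f Z e :=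
  (arcGluingData f Z e).cover.f U

instance (U : X.AffineZariskiSite) : IsOpenImmersion (contactGE.chart f Z e U) :=
  (arcGluingData f Z e).cover.map_prop U

lemma contactGE.chart_toBase (U : X.AffineZariskiSite) :
    contactGE.chart f Z e U ≫ contactGE.toBase f Z e =
      Spec.map (CommRingCat.ofHom (ArcAlgebra.of (constants f U.1) (Z.ideal U) e)) ≫
        U.2.fromSpec := by
  refine ((arcGluingData f Z e).ι_toBase U).trans ?_
  exact Category.assoc _ _ _

lemma contactGE.chart_toBase_comp (U : X.AffineZariskiSite) :
    contactGE.chart f Z e U ≫ contactGE.toBase f Z e ≫ f =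
      Spec.map (CommRingCat.ofHom ((ArcAlgebra.of (constants f U.1) (Z.ideal U) e).comp
        (constants f U.1))) := by
  rw [← Category.assoc, contactGE.chart_toBase, Category.assoc, fromSpec_comp, ← Spec.map_comp,
    ← CommRingCat.ofHom_comp]

lemma contactGE.toBase_preimage (U : X.AffineZariskiSite) :
    contactGE.toBase f Z e ⁻¹ᵁ U.1 = (contactGE.chart f Z e U).opensRange := by
  have h := (arcGluingData f Z e).toBase_preimage_eq_opensRange_ι U
  exact (congrArg (fun V ↦ contactGE.toBase f Z e ⁻¹ᵁ V) U.1.opensRange_ι.symm).trans h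

lemma contactGE.mem_range_chart (U : X.AffineZariskiSite) (x : contactGE f Z e) :
    x ∈ Set.range (contactGE.chart f Z e U) ↔ contactGE.toBase f Z e x ∈ U.1 := by
  have := congr(x ∈ $(contactGE.toBase_preimage f Z e U))
  exact (iff_of_eq this).symm

lemma contactGE.isIso_chart (U : X.AffineZariskiSite) (hU : U.1 = ⊤) :
    IsIso (contactGE.chart f Z e U) := by
  have : Surjective (contactGE.chart f Z e U) := ⟨fun x ↦ by
    refine (contactGE.mem_range_chart f Z e U x).mpr ?_
    rw [hU]
    trivial⟩
  exact (isIso_iff_isOpenImmersion_and_surjective _).mpr ⟨inferInstance, this⟩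

lemma contactGE.chart_ι (U : X.AffineZariskiSite) :
    contactGE.chart f Z e U ≫ contactGE.ι f Z e =
      Spec.map (CommRingCat.ofHom (forgetContact f Z e U)) ≫ arcChart f U :=
  colimit.ι_desc _ _

lemma SpecMap_arcRes_arcChart {U V : X.AffineZariskiSite} (h : V ≤ U) :
    Spec.map (CommRingCat.ofHom (arcRes f ⊥ 0 (toOpens_mono h))) ≫ arcChart f U = arcChart f V :=
  colimit.w (arcGluingData f ⊥ 0).functor (homOfLE h)

lemma arcChart_toSpec (U : X.AffineZariskiSite) :
    arcChart f U ≫ arcSpace.toSpec f = Spec.map (CommRingCat.ofHom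
      ((ArcAlgebra.of (constants f U.1) ((⊥ : X.IdealSheafData).ideal U) 0).comp (constants f U.1))) :=
  contactGE.chart_toBase_comp f ⊥ 0 U

lemma contactGE.chart_ι_toSpec (U : X.AffineZariskiSite) :
    contactGE.chart f Z e U ≫ contactGE.ι f Z e ≫ arcSpace.toSpec f =
      Spec.map (CommRingCat.ofHom ((ArcAlgebra.of (constants f U.1) (Z.ideal U) e).comp
        (constants f U.1))) := by
  rw [← Category.assoc, contactGE.chart_ι, Category.assoc, arcChart_toSpec, ← Spec.map_comp,
    ← CommRingCat.ofHom_comp]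
  congr 2
  refine RingHom.ext fun a ↦ ?_
  simp only [RingHom.comp_apply, ← ArcAlgebra.coeff_zero_right, forgetContact_coeff]

lemma exists_le_le_mem {U V : X.AffineZariskiSite} (x : X) (hU : x ∈ U.1) (hV : x ∈ V.1) :
    ∃ W ≤ U, W ≤ V ∧ x ∈ W.1 := by
  obtain ⟨a, b, hab, hx⟩ := exists_basicOpen_le_affine_inter U.2 V.2 x ⟨hU, hV⟩
  refine ⟨U.basicOpen a, U.basicOpen_le a, ?_, hx⟩
  have : U.basicOpen a = V.basicOpen b := Subtype.ext hab
  rw [this]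
  exact V.basicOpen_le b

/-- The functions whose first coefficients vanish at a point of the arc space form an ideal. -/
lemma coeff_mem_of_mem_span {A : Type u} [CommRing A] {φ : k →+* A} {I : Ideal A} {G : Set A} {e d : ℕ}
    (P : Ideal (ArcAlgebra φ I e)) (hG : ∀ g ∈ G, ∀ i ≤ d, ArcAlgebra.coeff φ I e g i ∈ P) (g : A)
    (hg : g ∈ Ideal.span G) (i : ℕ) (hi : i ≤ d) : ArcAlgebra.coeff φ I e g i ∈ P := by
  let γ := (PowerSeries.map (Ideal.Quotient.mk P)).comp (ArcAlgebra.univ φ I e)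
  have hγ (a : A) (i : ℕ) : PowerSeries.coeff i (γ a) = Ideal.Quotient.mk P (ArcAlgebra.coeff φ I e a i) := by
    simp [γ, ArcAlgebra.univ]
  have h : Ideal.span G ≤ (Ideal.span {(PowerSeries.X : PowerSeries (ArcAlgebra φ I e ⧸ P)) ^ (d + 1)}).comap γ := by
    rw [Ideal.span_le]
    intro a ha
    rw [SetLike.mem_coe, Ideal.mem_comap, Ideal.mem_span_singleton, PowerSeries.X_pow_dvd_iff]
    intro i hi
    rw [hγ, Ideal.Quotient.eq_zero_iff_mem]
    exact hG a ha i (by omega)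
  have h' := h hg
  rw [Ideal.mem_comap, Ideal.mem_span_singleton, PowerSeries.X_pow_dvd_iff] at h'
  have := h' i (by omega)
  rwa [hγ, Ideal.Quotient.eq_zero_iff_mem] at this

lemma mem_contactLE_of_coeff_notMem (d : ℕ) (U : X.AffineZariskiSite)
    (y : PrimeSpectrum (arcAlgebra f ⊥ 0 U)) (g : Γ(X, U.1)) (hg : g ∈ Z.ideal U) (i : ℕ) (hi : i ≤ d)
    (h : ArcAlgebra.coeff _ _ _ g i ∉ y.asIdeal) : arcChart f U y ∈ contactLE f Z d := by
  refine TopologicalSpace.Opens.mem_iSup.mpr ⟨U, TopologicalSpace.Opens.mem_iSup.mpr ⟨⟨g, hg⟩,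
    TopologicalSpace.Opens.mem_iSup.mpr ⟨⟨i, by omega⟩, ⟨y, h, rfl⟩⟩⟩⟩

/-- The open set is defined through all charts at once. This shows that a single chart containing
the arc, with any generators of the ideal there, decides membership. -/
lemma arcChart_mem_contactLE_iff (d : ℕ) (U : X.AffineZariskiSite) {G : Set Γ(X, U.1)}
    (hG : Z.ideal U = Ideal.span G) (y : PrimeSpectrum (arcAlgebra f ⊥ 0 U)) :
    arcChart f U y ∈ contactLE f Z d ↔
      ∃ g ∈ G, ∃ i ≤ d, ArcAlgebra.coeff _ _ _ g i ∉ y.asIdeal := by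
  refine ⟨fun h ↦ ?_, fun ⟨g, hg, i, hi, h⟩ ↦ mem_contactLE_of_coeff_notMem f Z d U y g
    (hG ▸ Ideal.subset_span hg) i hi h⟩
  obtain ⟨V, h⟩ := TopologicalSpace.Opens.mem_iSup.mp h
  obtain ⟨⟨g, hg⟩, h⟩ := TopologicalSpace.Opens.mem_iSup.mp h
  obtain ⟨i, z, hz, hzy⟩ := TopologicalSpace.Opens.mem_iSup.mp h
  have hU : contactGE.toBase f ⊥ 0 (arcChart f U y) ∈ U.1 :=
    (contactGE.mem_range_chart f ⊥ 0 U _).mp ⟨y, rfl⟩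
  have hV : contactGE.toBase f ⊥ 0 (arcChart f U y) ∈ V.1 :=
    (contactGE.mem_range_chart f ⊥ 0 V _).mp ⟨z, hzy⟩
  -- The two charts are compared on a smaller affine neighbourhood of the origin of the arc, where
  -- both ideals extend to the same one.
  obtain ⟨W, hWU, hWV, hW⟩ := exists_le_le_mem _ hU hV
  have hWU' : W.1 ≤ U.1 := toOpens_mono hWU
  have hWV' : W.1 ≤ V.1 := toOpens_mono hWV
  obtain ⟨w, hw⟩ := (contactGE.mem_range_chart f ⊥ 0 W _).mpr hW
  replace hw : arcChart f W w = arcChart f U y := hw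
  have hwU : Spec.map (CommRingCat.ofHom (arcRes f ⊥ 0 hWU')) w = y := by
    apply (arcChart f U).injective
    rw [← Scheme.Hom.comp_apply, SpecMap_arcRes_arcChart f hWU, hw]
  have hwV : Spec.map (CommRingCat.ofHom (arcRes f ⊥ 0 hWV')) w = z := by
    apply (arcChart f V).injective
    rw [← Scheme.Hom.comp_apply, SpecMap_arcRes_arcChart f hWV, hw, ← hzy]
    rfl
  have hyU (a : Γ(X, U.1)) (i : ℕ) : ArcAlgebra.coeff _ _ _ a i ∈ y.asIdeal ↔
      ArcAlgebra.coeff (constants f W.1) _ _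
        ((X.presheaf.map (homOfLE hWU').op).hom a) i ∈ (w : PrimeSpectrum _).asIdeal := by
    rw [← arcRes_coeff f ⊥ 0 hWU', ← hwU]
    rfl
  have hzV (a : Γ(X, V.1)) (i : ℕ) : ArcAlgebra.coeff _ _ _ a i ∈ z.asIdeal ↔
      ArcAlgebra.coeff (constants f W.1) _ _
        ((X.presheaf.map (homOfLE hWV').op).hom a) i ∈ (w : PrimeSpectrum _).asIdeal := by
    rw [← arcRes_coeff f ⊥ 0 hWV', ← hwV]
    rfl
  by_contra! hcon
  apply hz
  change ArcAlgebra.coeff _ _ _ g i ∈ z.asIdeal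
  rw [hzV]
  refine coeff_mem_of_mem_span (d := d)
    (G := (X.presheaf.map (homOfLE hWU').op).hom '' G) _ ?_ _ ?_ _ (by omega)
  · rintro _ ⟨a, ha, rfl⟩ i hi
    rw [← hyU]
    exact hcon a ha i hi
  · rw [← Ideal.map_span, ← hG]
    have h₁ := Z.map_ideal (U := W) (V := U) hWU'
    have h₂ := Z.map_ideal (U := W) (V := V) hWV'
    exact (h₁.trans h₂.symm).ge (Ideal.mem_map_of_mem _ hg)

/-- The locally closed subscheme of arcs of contact order `d` with a principal subscheme of an
affine scheme. -/
lemma exists_iso_contactEQ (d : ℕ) (U : X.AffineZariskiSite) (hU : U.1 = ⊤) (g : Γ(X, U.1))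
    (hg : Z.ideal U = Ideal.span {g}) :
    ∃ φ : contactEQ f Z d ≅ Spec (.of (Localization.Away (ArcAlgebra.coeff (constants f U.1) (Z.ideal U) d g d))),
      φ.inv ≫ contactEQ.toSpec f Z d = Spec.map (CommRingCat.ofHom ((algebraMap _ _).comp
        ((ArcAlgebra.of (constants f U.1) (Z.ideal U) d).comp (constants f U.1)))) := by
  have := contactGE.isIso_chart f Z d U hU
  let c := ArcAlgebra.coeff (constants f U.1) (Z.ideal U) d g d
  let j : Spec (.of (Localization.Away c)) ⟶ contactGE f Z d :=
    Spec.map (CommRingCat.ofHom (algebraMap (arcAlgebra f Z d U) (Localization.Away c))) ≫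
      contactGE.chart f Z d U
  have hj : IsOpenImmersion (Spec.map (CommRingCat.ofHom
      (algebraMap (arcAlgebra f Z d U) (Localization.Away c)))) :=
    IsOpenImmersion.of_isLocalization c
  -- The coefficients of `g` of index below `d` are zero on `contactGE f Z d`, so order at most `d`
  -- means that the coefficient of index `d` does not vanish.
  have hrange : Set.range j = Set.range (contactGE.ι f Z d ⁻¹ᵁ contactLE f Z d).ι := by
    rw [Scheme.Opens.range_ι]
    ext x
    obtain ⟨y, rfl⟩ := (contactGE.chart f Z d U).surjective x
    have h₁ : contactGE.chart f Z d U y ∈ Set.range j ↔ c ∉ (y : PrimeSpectrum (arcAlgebra f Z d U)).asIdeal := by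
      rw [Scheme.Hom.comp_base, TopCat.coe_comp, Set.range_comp,
        (contactGE.chart f Z d U).injective.mem_set_image]
      have := PrimeSpectrum.localization_away_comap_range (Localization.Away c) c
      exact iff_of_eq congr(y ∈ $this)
    rw [h₁]
    have h₂ : contactGE.chart f Z d U y ∈ (contactGE.ι f Z d ⁻¹ᵁ contactLE f Z d : Set _) ↔
        arcChart f U (Spec.map (CommRingCat.ofHom (forgetContact f Z d U)) y) ∈ contactLE f Z d := by
      rw [← Scheme.Hom.comp_apply, ← contactGE.chart_ι, Scheme.Hom.comp_apply]
      rfl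
    rw [h₂]
    refine Iff.trans ?_ (arcChart_mem_contactLE_iff f Z d U hg _).symm
    have h₃ (i : ℕ) : ArcAlgebra.coeff (constants f U.1) _ 0 g i ∈ PrimeSpectrum.asIdeal
        (Spec.map (CommRingCat.ofHom (forgetContact f Z d U)) y) ↔
        ArcAlgebra.coeff (constants f U.1) (Z.ideal U) d g i ∈ (y : PrimeSpectrum _).asIdeal := by
      rw [← forgetContact_coeff f Z d U]
      rfl
    simp only [Set.mem_singleton_iff, exists_eq_left]
    constructor
    · intro h
      exact ⟨d, le_rfl, by rwa [h₃]⟩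
    · rintro ⟨i, hi, h⟩
      rw [h₃] at h
      obtain rfl | hi := hi.eq_or_lt
      · exact h
      · rw [ArcAlgebra.coeff_contact _ _ _ (hg ▸ Ideal.mem_span_singleton_self g) hi] at h
        exact (h (Ideal.zero_mem _)).elim
  refine ⟨(IsOpenImmersion.isoOfRangeEq j _ hrange).symm, ?_⟩
  refine (IsOpenImmersion.isoOfRangeEq_hom_fac_assoc j _ hrange _).trans ?_
  refine (Category.assoc _ _ _).trans ?_
  refine Eq.trans ?_ (Spec.map_comp (CommRingCat.ofHom ((ArcAlgebra.of (constants f U.1)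
    (Z.ideal U) d).comp (constants f U.1))) (CommRingCat.ofHom (algebraMap (arcAlgebra f Z d U)
    (Localization.Away c)))).symm
  exact congrArg (fun q ↦ Spec.map (CommRingCat.ofHom
    (algebraMap (arcAlgebra f Z d U) (Localization.Away c))) ≫ q) (contactGE.chart_ι_toSpec f Z d U)

end Charts

/-! ### Special complete intersections -/

section SpecialCompleteIntersectionArcs

open Scheme Scheme.AffineZariskiSite

lemma constants_SpecMap {k A : CommRingCat.{u}} (φ : k ⟶ A) :
    constants (k := k) (Spec.map φ) ⊤ = (Scheme.ΓSpecIso A).inv.hom.comp φ.hom := by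
  rw [constants, ← CommRingCat.hom_comp]
  congr 1
  refine Eq.trans ?_ (Scheme.ΓSpecIso_inv_naturality φ).symm
  congr 1

variable {k : Type u} [Field k]

lemma exists_iso_arcSpace_affineSpace (m : ℕ) :
    ∃ ε : arcSpace (𝔸(ULift.{u} (Fin m); Spec (.of k)) ↘ Spec (.of k)) ≅
        Spec (.of (MvPolynomial (Fin m × ℕ) k)),
      ε.hom ≫ Spec.map (CommRingCat.ofHom MvPolynomial.C) = arcSpace.toSpec _ := by
  let σ := ULift.{u} (Fin m)
  let f := 𝔸(σ; Spec (.of k)) ↘ Spec (.of k)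
  let U : 𝔸(σ; Spec (.of k)).AffineZariskiSite := ⟨⊤, isAffineOpen_top _⟩
  have hc := contactGE.isIso_chart f ⊥ 0 U rfl
  let c := asIso (contactGE.chart f ⊥ 0 U)
  let ψ : CommRingCat.of (MvPolynomial σ k) ≅ Γ(𝔸(σ; Spec (.of k)), ⊤) :=
    (Scheme.ΓSpecIso (.of (MvPolynomial σ k))).symm ≪≫
      Scheme.Γ.mapIso (AffineSpace.SpecIso σ (.of k)).op
  have hψ : CommRingCat.ofHom MvPolynomial.C ≫ ψ.hom = CommRingCat.ofHom (constants f ⊤) := by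
    have h₁ : f = (AffineSpace.SpecIso σ (.of k)).hom ≫ Spec.map (CommRingCat.ofHom MvPolynomial.C) := by
      rw [← AffineSpace.SpecIso_inv_over, Iso.hom_inv_id_assoc]
    have h₂ : CommRingCat.ofHom (constants f ⊤) = (Scheme.ΓSpecIso (.of k)).inv ≫ f.appTop := by
      rw [constants, CommRingCat.ofHom_hom]
      congr 1
      exact Scheme.Hom.appLE_eq_app _
    rw [h₂, h₁, Scheme.Hom.comp_appTop, ← Category.assoc, ← Scheme.ΓSpecIso_inv_naturality,
      Category.assoc]
    rfl
  obtain ⟨Φ, hΦ⟩ := ArcAlgebra.exists_ringEquiv_mvPolynomial (constants f ⊤)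
    ψ.commRingCatIsoToRingEquiv (fun c ↦ congr($hψ c))
  let e : σ × ℕ ≃ Fin m × ℕ := Equiv.ulift.prodCongr (Equiv.refl _)
  let Θ : CommRingCat.of (arcAlgebra f ⊥ 0 U) ≅ CommRingCat.of (MvPolynomial (Fin m × ℕ) k) :=
    (Φ.trans (MvPolynomial.renameEquiv k e).toRingEquiv).toCommRingCatIso
  refine ⟨c.symm ≪≫ (Scheme.Spec.mapIso Θ.symm.op), ?_⟩
  have h₃ : CommRingCat.ofHom MvPolynomial.C ≫ Θ.inv = CommRingCat.ofHom
      ((ArcAlgebra.of (constants f U.1) ((⊥ : IdealSheafData _).ideal U) 0).comp (constants f U.1)) := by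
    rw [Iso.comp_inv_eq]
    refine CommRingCat.hom_ext (RingHom.ext fun c ↦ ?_)
    have h := congr(MvPolynomial.rename (R := k) e $(hΦ c))
    rw [MvPolynomial.rename_C] at h
    exact h.symm
  refine (Category.assoc _ _ _).trans ?_
  refine (Iso.inv_comp_eq c).mpr (Eq.trans ?_ (arcChart_toSpec f U).symm)
  rw [← h₃]
  exact (Spec.map_comp _ _).symm

theorem exists_contactEQ_specialCI_iso (m l : ℕ) (p : Fin l → MvPolynomial (Fin m ⊕ Fin l) k) (d : ℕ) :
    ∃ (D : Scheme.{u}) (h : D ⟶ Spec (.of k)),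
      LocallyOfFiniteType h ∧ QuasiCompact h ∧
      ∃ φ : contactEQ (specialCI.toSpec p) (specialCI.singularIdeal p) d ≅
          pullback h (arcSpace.toSpec (𝔸(ULift.{u} (Fin m); Spec (.of k)) ↘ Spec (.of k))),
        φ.hom ≫ pullback.fst _ _ ≫ h =
          contactEQ.toSpec (specialCI.toSpec p) (specialCI.singularIdeal p) d := by
  let f := specialCI.toSpec p
  let U : (specialCI p).AffineZariskiSite := ⟨⊤, isAffineOpen_top _⟩
  let e := Scheme.ΓSpecIso (.of (SpecialCIRing p))
  let π : MvPolynomial (Fin m ⊕ Fin l) k →+* Γ(specialCI p, ⊤) :=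
    e.inv.hom.comp (Ideal.Quotient.mk _)
  have hZ : (specialCI.singularIdeal p).ideal U = Ideal.span {π (yJacobian p)} := by
    change Ideal.map ((specialCI p).presheaf.map (𝟙 (Opposite.op (⊤ : (specialCI p).Opens)))).hom
      (Ideal.span {π (yJacobian p)}) = _
    rw [CategoryTheory.Functor.map_id]
    exact Ideal.map_id _
  have hπφ : π.comp MvPolynomial.C = constants f ⊤ := by
    exact (constants_SpecMap (CommRingCat.ofHom (algebraMap k (SpecialCIRing p)))).symm
  have heinj : Function.Injective e.inv.hom :=
    (ConcreteCategory.bijective_of_isIso e.inv).1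
  have hesurj : Function.Surjective e.inv.hom :=
    (ConcreteCategory.bijective_of_isIso e.inv).2
  obtain ⟨φ₁, hφ₁⟩ := exists_iso_contactEQ f (specialCI.singularIdeal p) d U rfl _ hZ
  obtain ⟨B, _, _, hB, Φ, hΦ⟩ := exists_ringEquiv_specialCI p π (hesurj.comp Ideal.Quotient.mk_surjective)
    (by
      ext x
      rw [RingHom.mem_ker, RingHom.comp_apply, map_eq_zero_iff _ heinj, Ideal.Quotient.eq_zero_iff_mem])
    (constants f ⊤) hπφ ((specialCI.singularIdeal p).ideal U)
    (hZ ▸ Ideal.mem_span_singleton_self _) d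
    (Localization.Away (ArcAlgebra.coeff (constants f U.1) ((specialCI.singularIdeal p).ideal U) d
      (π (yJacobian p)) d))
  obtain ⟨ε, hε⟩ := exists_iso_arcSpace_affineSpace (k := k) m
  let : Algebra (MvPolynomial (Fin m × ℕ) k) (MvPolynomial (Fin m × ℕ) B) :=
    MvPolynomial.algebraMvPolynomial
  -- The polynomial ring over `B` is the base change to `B` of the coordinate ring `k[x_j^(i)]` of
  -- the arc space of `𝔸^m`.
  have hpb := isPullback_SpecMap_of_isPushout _ _ _ _ (CommRingCat.isPushout_of_isPushout k B
    (MvPolynomial (Fin m × ℕ) k) (MvPolynomial (Fin m × ℕ) B))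
  have hpb' := hpb.of_iso (Iso.refl _) (Iso.refl _) ε.symm (Iso.refl _) (fst' := _)
    (snd' := Spec.map (CommRingCat.ofHom (algebraMap (MvPolynomial (Fin m × ℕ) k)
      (MvPolynomial (Fin m × ℕ) B))) ≫ ε.inv) (f' := Spec.map (CommRingCat.ofHom (algebraMap k B)))
    (g' := arcSpace.toSpec _) (by simp; rfl) (by simp) (by simp) (by simp [← hε])
  let Θ : CommRingCat.of (Localization.Away (ArcAlgebra.coeff (constants f U.1)
      ((specialCI.singularIdeal p).ideal U) d (π (yJacobian p)) d)) ≅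
      CommRingCat.of (MvPolynomial (Fin m × ℕ) B) := Φ.toCommRingCatIso
  have hΘ : Spec.map Θ.inv ≫ Spec.map (CommRingCat.ofHom MvPolynomial.C) ≫
      Spec.map (CommRingCat.ofHom (algebraMap k B)) = φ₁.inv ≫ contactEQ.toSpec _ _ d := by
    rw [← Spec.map_comp, ← Spec.map_comp, Category.assoc]
    refine Eq.trans ?_ hφ₁.symm
    congr 1
    rw [← Category.assoc, Iso.comp_inv_eq]
    exact CommRingCat.hom_ext (RingHom.ext fun c ↦ (hΦ c).symm)
  refine ⟨Spec (.of B), Spec.map (CommRingCat.ofHom (algebraMap k B)), ?_, inferInstance,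
    φ₁ ≪≫ Scheme.Spec.mapIso Θ.symm.op ≪≫ hpb'.isoPullback, ?_⟩
  · rw [HasRingHomProperty.Spec_iff (P := @LocallyOfFiniteType)]
    exact (RingHom.finiteType_algebraMap).mpr hB
  · refine (Category.assoc _ _ _).trans ((Iso.eq_inv_comp φ₁).mp ((Category.assoc _ _ _).trans ?_))
    rw [IsPullback.isoPullback_hom_fst_assoc]
    exact hΘ

end SpecialCompleteIntersectionArcs

/-! ### Independent functions on schemes of pure dimension -/

section PureDimension

open Scheme

section

variable {X : Scheme.{u}} {U : X.Opens}

lemma mem_primeIdealOf_iff (hU : IsAffineOpen U) (x : U) (a : Γ(X, U)) :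
    a ∈ (hU.primeIdealOf x).asIdeal ↔ X.evaluation U x.1 x.2 a = 0 := by
  rw [X.evaluation_eq_zero_iff_notMem_basicOpen, iff_not_comm]
  have h : hU.primeIdealOf x ∈ hU.fromSpec ⁻¹ᵁ X.basicOpen a ↔
      hU.primeIdealOf x ∈ PrimeSpectrum.basicOpen a :=
    iff_of_eq congr(hU.primeIdealOf x ∈ $(hU.fromSpec_preimage_basicOpen a))
  change hU.fromSpec (hU.primeIdealOf x) ∈ X.basicOpen a ↔ _ at h
  rw [hU.fromSpec_primeIdealOf] at h
  exact h

lemma ker_evaluation (hU : IsAffineOpen U) (x : U) :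
    RingHom.ker (X.evaluation U x.1 x.2).hom = (hU.primeIdealOf x).asIdeal := by
  ext a
  exact (mem_primeIdealOf_iff hU x a).symm

lemma exists_mul_evaluation_eq (hU : IsAffineOpen U) (x : U) (z : X.residueField x.1) :
    ∃ a b : Γ(X, U), X.evaluation U x.1 x.2 b ≠ 0 ∧
      z * X.evaluation U x.1 x.2 b = X.evaluation U x.1 x.2 a := by
  obtain ⟨s, rfl⟩ := X.residue_surjective x.1 z
  have := hU.isLocalization_stalk x
  obtain ⟨⟨a, b⟩, h⟩ := IsLocalization.surj (hU.primeIdealOf x).asIdeal.primeCompl s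
  refine ⟨a, b, fun h0 ↦ b.2 ((mem_primeIdealOf_iff hU x _).mpr h0), ?_⟩
  have h' := congr(X.residue x.1 $h)
  rw [map_mul] at h'
  exact h'

lemma primeIdealOf_le_iff (hU : IsAffineOpen U) (x y : U) :
    (hU.primeIdealOf x).asIdeal ≤ (hU.primeIdealOf y).asIdeal ↔ x.1 ⤳ y.1 := by
  rw [PrimeSpectrum.asIdeal_le_asIdeal, PrimeSpectrum.le_iff_specializes]
  have := hU.fromSpec.isOpenEmbedding.isInducing.specializes_iff
    (x := hU.primeIdealOf x) (y := hU.primeIdealOf y)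
  rw [hU.fromSpec_primeIdealOf, hU.fromSpec_primeIdealOf] at this
  exact this.symm

end

variable {k : Type u} [Field k] {X : Scheme.{u}} (f : X ⟶ Spec (.of k))

/-- The `k`-structure on a residue field may be computed on any open set; two different affine open
sets are used below. -/
lemma evaluation_constants {U V : X.Opens} (x : X) (hU : x ∈ U) (hV : x ∈ V) (c : k) :
    X.evaluation U x hU (constants f U c) = X.evaluation V x hV (constants f V c) := by
  have h (W : X.Opens) (hW : x ∈ W) :
      X.evaluation W x hW (constants f W c) = X.evaluation ⊤ x trivial (constants f ⊤ c) := by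
    have h₁ : constants f W c = X.presheaf.map (homOfLE le_top).op (constants f ⊤ c) :=
      congr($(map_constants f (le_top : W ≤ ⊤)) c).symm
    rw [h₁]
    change X.residue x (X.presheaf.germ _ _ _ _) = X.residue x (X.presheaf.germ _ _ _ _)
    congr 1
    exact X.presheaf.germ_res_apply _ _ _ _
  rw [h U hU, h V hV]

/-- The points of a chain of irreducible closed subsets of an irreducible component. -/
lemma exists_specializes_chain [QuasiSober X] (C : Set X) (hC : IsClosed C) {n : ℕ}
    (h : n ≤ topologicalKrullDim C) :
    ∃ x : Fin (n + 1) → X, (∀ i, x i ∈ C) ∧ ∀ i j, i < j → x i ⤳ x j ∧ ¬ x j ⤳ x i := by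
  obtain ⟨l, rfl⟩ := Order.le_krullDim_iff.mp h
  have : QuasiSober C := hC.isClosedEmbedding_subtypeVal.quasiSober
  choose x hx using fun i ↦ QuasiSober.sober (l i).isIrreducible (l i).isClosed
  have key (i j) (hij : i < j) : x j ⤳ x i ∧ ¬ x i ⤳ x j := by
    have hlt : l i < l j := l.strictMono hij
    constructor
    · rw [specializes_iff_mem_closure, (hx j).def]
      exact hlt.le ((hx i).mem)
    · intro hs
      refine hlt.not_ge ?_
      have h₁ := hs.closure_subset
      rw [(hx i).def, (hx j).def] at h₁
      exact h₁
  -- Larger closed subsets have more generic points, so the chain is reversed to obtain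
  -- specializations.
  refine ⟨fun i ↦ x i.rev, fun i ↦ (x _).2, fun i j hij ↦ ?_⟩
  have := key j.rev i.rev (by simpa using hij)
  rw [Topology.IsInducing.subtypeVal.specializes_iff, Topology.IsInducing.subtypeVal.specializes_iff]
  exact this

lemma algebraicIndependent_mk_of_le {A ι : Type*} [CommRing A] [Algebra k A] {P Q : Ideal A} (h : P ≤ Q)
    {x : ι → A} (hx : AlgebraicIndependent k (fun i ↦ Ideal.Quotient.mk Q (x i))) :
    AlgebraicIndependent k (fun i ↦ Ideal.Quotient.mk P (x i)) :=
  AlgebraicIndependent.of_comp (Ideal.Quotient.factorₐ k h) hx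

/-- The prime `P` is the generic point `η` of a component of dimension `n`. The generic points of a
chain of closed subsets give a chain of `n + 1` primes, hence `n` independent functions. The chain
need not meet `U`, so this takes place on another affine open set `V`, and the functions are
compared in the residue field of `η`. -/
theorem hasIndependentFunctions_of_isPureOfDim {n : ℕ} (hX : IsPureOfDim X n) {U : X.Opens}
    (hU : IsAffineOpen U) : HasIndependentFunctions (constants f U) n := by
  intro P hP
  have hPprime : P.IsPrime := hP.1.1
  let y : PrimeSpectrum Γ(X, U) := ⟨P, hPprime⟩
  have hηU : hU.fromSpec y ∈ U := hU.range_fromSpec.le ⟨y, rfl⟩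
  let η : U := ⟨hU.fromSpec y, hηU⟩
  have hηP : hU.primeIdealOf η = y :=
    hU.fromSpec.injective (hU.fromSpec_primeIdealOf η)
  let C := irreducibleComponent η.1
  have hCcl : IsClosed C := isClosed_irreducibleComponent
  obtain ⟨ξ, hξ⟩ := QuasiSober.sober isIrreducible_irreducibleComponent hCcl
  have hξη : ξ ⤳ η.1 := by
    rw [specializes_iff_mem_closure, hξ.def]
    exact mem_irreducibleComponent
  have hξU : ξ ∈ U := hξη.mem_open U.2 η.2
  have hle := (primeIdealOf_le_iff hU ⟨ξ, hξU⟩ η).mpr hξη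
  have hge : (hU.primeIdealOf η).asIdeal ≤ (hU.primeIdealOf ⟨ξ, hξU⟩).asIdeal := by
    rw [hηP] at hle ⊢
    exact hP.2 ⟨(hU.primeIdealOf ⟨ξ, hξU⟩).isPrime, bot_le⟩ hle
  have hηξ : η.1 ⤳ ξ := (primeIdealOf_le_iff hU η ⟨ξ, hξU⟩).mp hge
  obtain ⟨x, hxC, hx⟩ := exists_specializes_chain C hCcl (n := n)
    (hX C (irreducibleComponent_mem_irreducibleComponents _)).ge
  have hηx (i) : η.1 ⤳ x i := by
    refine hηξ.trans ?_
    rw [specializes_iff_mem_closure, hξ.def]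
    exact hxC i
  -- An open neighbourhood of the most special point contains the whole chain, and `η`.
  obtain ⟨V, hV, hxV, -⟩ := exists_isAffineOpen_mem_and_subset (X := X) (x := x (Fin.last n)) (U := ⊤) trivial
  have hxV' (i) : x i ∈ V := by
    rcases (Fin.le_last i).eq_or_lt with h | h
    · rw [h]; exact hxV
    · exact (hx _ _ h).1.mem_open V.2 hxV
  have hηV : η.1 ∈ V := (hηx 0).mem_open V.2 (hxV' 0)
  let : Algebra k Γ(X, V) := (constants f V).toAlgebra
  let χ := (X.evaluation U η.1 η.2).hom
  let χV := (X.evaluation V η.1 hηV).hom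
  let : Algebra k (X.residueField η.1) := (χ.comp (constants f U)).toAlgebra
  obtain ⟨z, hz⟩ := exists_algebraicIndependent_of_strictMono (k := k)
    (fun P hP ↦ (algebraMap k (Γ(X, V) ⧸ P)).injective) n
    (fun i ↦ (hV.primeIdealOf ⟨x i, hxV' i⟩).asIdeal) (fun i ↦ (hV.primeIdealOf _).isPrime)
    (fun i j hij ↦ by
      refine lt_of_le_not_ge ((primeIdealOf_le_iff hV _ _).mpr (hx i j hij).1) fun h ↦ ?_
      exact (hx i j hij).2 ((primeIdealOf_le_iff hV _ _).mp h))
  have hz' := algebraicIndependent_mk_of_le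
    (P := (hV.primeIdealOf ⟨η.1, hηV⟩).asIdeal) ((primeIdealOf_le_iff hV _ _).mpr (hηx 0)) hz
  let ψ : Γ(X, V) →ₐ[k] X.residueField η.1 :=
    { χV with commutes' := fun c ↦ evaluation_constants f _ _ _ c }
  have hψ : RingHom.ker ψ = (hV.primeIdealOf ⟨η.1, hηV⟩).asIdeal := ker_evaluation hV ⟨η.1, hηV⟩
  let ψ' : (Γ(X, V) ⧸ (hV.primeIdealOf ⟨η.1, hηV⟩).asIdeal) →ₐ[k] X.residueField η.1 :=
    Ideal.Quotient.liftₐ _ ψ fun a ha ↦ by rwa [← hψ] at ha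
  refine ⟨X.residueField η.1, inferInstance, inferInstance, χ, rfl, ?_, exists_mul_evaluation_eq hU η,
    fun i ↦ ψ' (Ideal.Quotient.mk _ (z i)), hz'.map' (f := ψ') ?_⟩
  · rw [ker_evaluation hU η, hηP]
  · rw [injective_iff_map_eq_zero]
    intro a ha
    obtain ⟨a, rfl⟩ := Ideal.Quotient.mk_surjective a
    rw [Ideal.Quotient.eq_zero_iff_mem, ← hψ]
    exact ha

end PureDimension

/-! ### Stratifications defined by a finite ordered family of open subsets -/

section OpenStratification

/-- The differences of the members of a finite ordered family of open subsets form a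
stratification. -/
lemma exists_isConstructibleStratification {Y : Scheme.{u}} [CompactSpace Y] [QuasiSeparatedSpace Y]
    {α : Type} [Fintype α] [LinearOrder α] (O : α → Set Y) (hO : ∀ a, IsOpen (O a))
    (hcover : ∀ y, ∃ a, y ∈ O a) {S : α → Scheme.{u}} (s : ∀ a, S a ⟶ Y) (hs : ∀ a, IsImmersion (s a))
    (hs' : ∀ a, LocallyOfFinitePresentation (s a)) (hs'' : ∀ a, QuasiCompact (s a))
    (hrange : ∀ a y, y ∈ Set.range (s a) ↔ y ∈ O a ∧ ∀ b < a, y ∉ O b) :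
    ∃ (r : ℕ) (σ : Fin r → α), IsConstructibleStratification (fun i ↦ s (σ i)) := by
  classical
  have hmem (y : Y) : ∃ a, y ∈ Set.range (s a) := by
    obtain ⟨a, ha, hmin⟩ := (Set.toFinite {a | y ∈ O a}).exists_minimal (hcover y)
    exact ⟨a, (hrange a y).mpr ⟨ha, fun b hb h ↦ hb.not_ge (hmin h hb.le)⟩⟩
  have hdisj (y : Y) (a b : α) (ha : y ∈ Set.range (s a)) (hb : y ∈ Set.range (s b)) : a = b := by
    rw [hrange] at ha hb
    rcases lt_trichotomy a b with h | h | h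
    · exact (hb.2 a h ha.1).elim
    · exact h
    · exact (ha.2 b h hb.1).elim
  -- The first set is open, so the closed strata come last in `α`; the order is reversed to have
  -- closures contained in the preceding strata.
  let σ := (monoEquivOfFin αᵒᵈ rfl)
  refine ⟨_, fun i ↦ OrderDual.ofDual (σ i), ⟨fun i ↦ hs _, fun i ↦ hs' _, fun i ↦ hs'' _,
    fun i ↦ ?_, fun i j hij ↦ ?_, ?_, fun i y hy ↦ ?_⟩⟩
  · have := hs' (OrderDual.ofDual (σ i))
    have := hs'' (OrderDual.ofDual (σ i))
    rw [← Set.image_univ]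
    exact (s _).isConstructible_image .univ
  · rw [Set.disjoint_left]
    intro y hi hj
    exact hij (σ.injective (OrderDual.ofDual.injective (hdisj y _ _ hi hj)))
  · refine Set.eq_univ_of_forall fun y ↦ ?_
    obtain ⟨a, ha⟩ := hmem y
    obtain ⟨i, rfl⟩ := σ.surjective (OrderDual.toDual a)
    exact Set.mem_iUnion.mpr ⟨i, ha⟩
  · obtain ⟨a, ha⟩ := hmem y
    have hle : OrderDual.ofDual (σ i) ≤ a := by
      by_contra! hlt
      obtain ⟨z, hz, hz'⟩ := mem_closure_iff.mp hy _ (hO a) ((hrange a y).mp ha).1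
      exact ((hrange _ z).mp hz').2 a hlt hz
    obtain ⟨j, rfl⟩ := σ.surjective (OrderDual.toDual a)
    exact Set.mem_iUnion₂.mpr ⟨j, σ.le_iff_le.mp hle, ha⟩

end OpenStratification

/-! ### The strata of the arc space -/

section Strata

open Scheme Scheme.AffineZariskiSite

variable {k : Type u}

section

variable [CommRing k] {X : Scheme.{u}} (f : X ⟶ Spec (.of k))

instance : IsAffineHom (contactGE.toBase f ⊥ 0) where
  isAffine_preimage U hU := by
    let V : X.AffineZariskiSite := ⟨U, hU⟩
    have h := contactGE.toBase_preimage f ⊥ 0 V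
    exact h ▸ isAffineOpen_opensRange (contactGE.chart f ⊥ 0 V)

/-- Quasi-separatedness makes the maps from the affine strata quasi-compact. -/
lemma quasiSeparatedSpace_arcSpace [QuasiSeparatedSpace X] : QuasiSeparatedSpace (arcSpace f) :=
  have : QuasiSeparatedSpace (contactGE f ⊥ 0) :=
    quasiSeparatedSpace_of_quasiSeparated (contactGE.toBase f ⊥ 0)
  this

/-- Having its origin outside `V` is a vanishing condition on coefficients of index `0`, of the kind
allowed in `RepresentsArcs`. -/
lemma toBase_arcChart_mem_iff {U : X.AffineZariskiSite} {V : X.Opens} {T : Set Γ(X, U.1)}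
    (hT : ∀ y : PrimeSpectrum Γ(X, U.1), U.2.fromSpec y ∈ V ↔ ∃ t ∈ T, t ∉ y.asIdeal)
    (y : PrimeSpectrum (arcAlgebra f ⊥ 0 U)) :
    contactGE.toBase f ⊥ 0 (arcChart f U y) ∈ V ↔
      ∃ t ∈ T, ArcAlgebra.coeff _ _ _ t 0 ∉ y.asIdeal := by
  have h : contactGE.toBase f ⊥ 0 (arcChart f U y) = U.2.fromSpec (Spec.map (CommRingCat.ofHom
      (ArcAlgebra.of (constants f U.1) ((⊥ : X.IdealSheafData).ideal U) 0)) y) := by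
    have := congr($(contactGE.chart_toBase f ⊥ 0 U) y)
    exact this
  rw [h]
  refine (hT _).trans (exists_congr fun t ↦ and_congr_right fun _ ↦ not_congr ?_)
  rw [ArcAlgebra.coeff_zero_right]
  rfl

lemma exists_finset_fromSpec_mem_iff [IsLocallyNoetherian X] {U : X.Opens} (hU : IsAffineOpen U)
    (V : X.Opens) : ∃ T : Finset Γ(X, U), ∀ y : PrimeSpectrum Γ(X, U),
      hU.fromSpec y ∈ V ↔ ∃ t ∈ (T : Set Γ(X, U)), t ∉ y.asIdeal := by
  have : IsNoetherianRing Γ(X, U) := IsLocallyNoetherian.component_noetherian ⟨U, hU⟩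
  have hW : IsOpen {y : PrimeSpectrum Γ(X, U) | hU.fromSpec y ∈ V} := (hU.fromSpec ⁻¹ᵁ V).2
  obtain ⟨T, hT⟩ := PrimeSpectrum.isCompact_isOpen_iff.mp
    ⟨TopologicalSpace.NoetherianSpace.isCompact _, hW⟩
  refine ⟨T, fun y ↦ ?_⟩
  have h : y ∈ (PrimeSpectrum.zeroLocus (T : Set Γ(X, U)))ᶜ ↔ hU.fromSpec y ∈ V :=
    iff_of_eq congr(y ∈ $hT)
  rw [← h, Set.mem_compl_iff, PrimeSpectrum.mem_zeroLocus, Set.not_subset]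
  rfl

/-- The subscheme of the arc space of an affine scheme on which finitely many coefficients vanish and
another one is invertible. -/
lemma exists_stratum (U : X.AffineZariskiSite) {E : Set (Γ(X, U.1) × ℕ)} (hE : E.Finite)
    (g : Γ(X, U.1)) (e : ℕ) :
    ∃ (R : Type u) (_ : CommRing R) (χ : arcAlgebra f ⊥ 0 U →+* R),
      RepresentsArcs χ E g e ∧ IsImmersion (Spec.map (CommRingCat.ofHom χ) ≫ arcChart f U) ∧
      LocallyOfFinitePresentation (Spec.map (CommRingCat.ofHom χ) ≫ arcChart f U) ∧
      ∀ y : PrimeSpectrum (arcAlgebra f ⊥ 0 U),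
        arcChart f U y ∈ Set.range (Spec.map (CommRingCat.ofHom χ) ≫ arcChart f U) ↔
          ArcAlgebra.coeff _ _ _ g e ∉ y.asIdeal ∧
            ∀ x ∈ E, ArcAlgebra.coeff _ _ _ x.1 x.2 ∈ y.asIdeal := by
  let F : Set (arcAlgebra f ⊥ 0 U) :=
    (fun x : Γ(X, U.1) × ℕ ↦ ArcAlgebra.coeff (constants f U.1) _ 0 x.1 x.2) '' E
  let J : Ideal (arcAlgebra f ⊥ 0 U) := Ideal.span F
  let q := Ideal.Quotient.mk J
  let c := q (ArcAlgebra.coeff _ _ 0 g e)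
  let χ : arcAlgebra f ⊥ 0 U →+* Localization.Away c := (algebraMap _ _).comp q
  have hχ : Spec.map (CommRingCat.ofHom χ) =
      Spec.map (CommRingCat.ofHom (algebraMap _ (Localization.Away c))) ≫
        Spec.map (CommRingCat.ofHom q) := by
    rw [← Spec.map_comp, ← CommRingCat.ofHom_comp]
  have hc : IsOpenImmersion (Spec.map (CommRingCat.ofHom (algebraMap _ (Localization.Away c)))) :=
    IsOpenImmersion.of_isLocalization c
  have hq : IsClosedImmersion (Spec.map (CommRingCat.ofHom q)) :=
    IsClosedImmersion.spec_of_surjective _ Ideal.Quotient.mk_surjective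
  have hq' : LocallyOfFinitePresentation (Spec.map (CommRingCat.ofHom q)) := by
    rw [LocallyOfFinitePresentation.SpecMap_iff]
    refine RingHom.FinitePresentation.of_surjective _ Ideal.Quotient.mk_surjective ?_
    rw [CommRingCat.hom_ofHom, Ideal.mk_ker]
    exact Submodule.fg_span (hE.image _)
  refine ⟨Localization.Away c, inferInstance, χ, representsArcs_localization _ _ _ _ _ J rfl _,
    ?_, ?_, fun y ↦ ?_⟩
  · rw [hχ]
    infer_instance
  · rw [hχ]
    infer_instance
  · have h₀ : arcChart f U y ∈ Set.range (Spec.map (CommRingCat.ofHom χ) ≫ arcChart f U) ↔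
        y ∈ Set.range (Spec.map (CommRingCat.ofHom χ)) :=
      ⟨fun ⟨z, hz⟩ ↦ ⟨z, (arcChart f U).injective hz⟩, fun ⟨z, hz⟩ ↦ ⟨z, congr(arcChart f U $hz)⟩⟩
    refine h₀.trans ?_
    rw [hχ, Scheme.Hom.comp_base, TopCat.coe_comp, Set.range_comp]
    have h₁ := PrimeSpectrum.localization_away_comap_range (Localization.Away c) c
    have h₂ := range_comap_of_surjective _ q Ideal.Quotient.mk_surjective
    constructor
    · rintro ⟨z, hz, rfl⟩
      have hz' : c ∉ (z : PrimeSpectrum _).asIdeal := (iff_of_eq congr(z ∈ $h₁)).mp hz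
      refine ⟨hz', fun x hx ↦ ?_⟩
      change q (ArcAlgebra.coeff _ _ 0 x.1 x.2) ∈ (z : PrimeSpectrum _).asIdeal
      rw [Ideal.Quotient.eq_zero_iff_mem.mpr (Ideal.subset_span (s := F) ⟨x, hx, rfl⟩)]
      exact Ideal.zero_mem _
    · rintro ⟨hy, hyE⟩
      have hyJ : J ≤ y.asIdeal := by
        refine Ideal.span_le.mpr ?_
        rintro _ ⟨x, hx, rfl⟩
        exact hyE x hx
      obtain ⟨z, hz⟩ : y ∈ Set.range (PrimeSpectrum.comap q) := by
        rw [h₂, Ideal.mk_ker]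
        exact hyJ
      refine ⟨z, (iff_of_eq congr(z ∈ $h₁)).mpr ?_, hz⟩
      change c ∉ z.asIdeal
      rw [← hz] at hy
      exact hy

end

variable [Field k] {X : Scheme.{u}} (f : X ⟶ Spec (.of k))

/-- Padding by zero lets the generators on all charts be indexed by one set. -/
lemma exists_enumeration {M : Type*} [Zero M] (s : Finset M) :
    ∃ G : ℕ → M, (∀ j, s.card ≤ j → G j = 0) ∧ (∀ x ∈ s, ∃ j, G j = x) ∧
      ∀ j, G j ≠ 0 → G j ∈ s := by
  refine ⟨fun j ↦ s.toList.getD j 0,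
    fun j hj ↦ List.getD_eq_default _ _ (s.length_toList.trans_le hj), fun x hx ↦ ?_, fun j hj ↦ ?_⟩
  · obtain ⟨j, hj, rfl⟩ := List.getElem_of_mem (Finset.mem_toList.mpr hx)
    exact ⟨j, List.getD_eq_getElem _ _ hj⟩
  · rcases lt_or_ge j s.toList.length with h | h
    · have h' : s.toList.getD j 0 = s.toList[j] := List.getD_eq_getElem _ _ h
      change s.toList.getD j 0 ∈ s
      rw [h']
      exact Finset.mem_toList.mp (List.getElem_mem h)
    · exact (hj (List.getD_eq_default _ _ h)).elim

/-- Finitely many generators of the Jacobian ideal, such that the strata on which their arcs have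
exact orders are products with an infinite-dimensional affine space. -/
lemma exists_jacobianIdeal_generators [LocallyOfFiniteType f] [IsReduced X] [IsLocallyNoetherian X]
    {n : ℕ} (hn : 1 ≤ n) (hX : IsPureOfDim X n) (U : X.AffineZariskiSite) :
    ∃ (J : ℕ) (G : ℕ → Γ(X, U.1)), (∀ j, J ≤ j → G j = 0) ∧
      (jacobianIdeal f n).ideal U = Ideal.span (Set.range G) ∧
      ∀ (j : ℕ) (E : Set (Γ(X, U.1) × ℕ)) (e : ℕ) (R : Type u) [CommRing R]
        (χ : arcAlgebra f ⊥ 0 U →+* R), E.Finite → RepresentsArcs χ E (G j) e →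
        (∀ i < e, (G j, i) ∈ E) →
        ∃ (B : Type u) (_ : CommRing B) (_ : Algebra k B), Algebra.FiniteType k B ∧
          ∃ Φ : R ≃+* MvPolynomial (ULift.{u} ℕ) B, ∀ c,
            Φ (χ (ArcAlgebra.of _ _ 0 (constants f U.1 c))) = MvPolynomial.C (algebraMap k B c) := by
  let : Algebra k Γ(X, U.1) := (constants f U.1).toAlgebra
  have hft : Algebra.FiniteType k Γ(X, U.1) := finiteType_constants f U.2
  have hnoeth : IsNoetherianRing Γ(X, U.1) := IsLocallyNoetherian.component_noetherian ⟨U.1, U.2⟩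
  have hred : _root_.IsReduced Γ(X, U.1) := IsReduced.component_reduced U.1
  obtain ⟨N, π, hπ⟩ := Algebra.FiniteType.iff_quotient_mvPolynomial''.mp hft
  have hZ : (jacobianIdeal f n).ideal U = Ideal.span (jacobianMinors π n) :=
    fittingIdeal_eq_span_jacobianMinors π hπ n
  -- By noetherianity the ideal has finitely many generators which are themselves minors, not
  -- combinations of minors.
  obtain ⟨s, hs, hs'⟩ := (Submodule.fg_span_iff_fg_span_finset_subset (R := Γ(X, U.1))
    (jacobianMinors π n)).mp (IsNoetherian.noetherian _)
  obtain ⟨G, hG₀, hG, hG'⟩ := exists_enumeration s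
  refine ⟨s.card, G, hG₀, ?_, fun j E e R _ χ hE hχ hE' ↦ ?_⟩
  · rw [hZ]
    refine le_antisymm (hs'.le.trans (Ideal.span_mono fun x hx ↦ hG x hx)) (Ideal.span_le.mpr ?_)
    rintro _ ⟨j, rfl⟩
    by_cases hj : G j = 0
    · rw [hj]
      exact Ideal.zero_mem _
    · exact Ideal.subset_span (hs (hG' j hj))
  · have hχ₀ (i : ℕ) (hi : i < e) : χ (ArcAlgebra.coeff (algebraMap k Γ(X, U.1)) ⊥ 0 (G j) i) = 0 :=
      hχ.map_eq_zero (G j, i) (hE' i hi)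
    exact RepresentsArcs.exists_ringEquiv_of_mem_jacobianMinors hn
      (hasIndependentFunctions_of_isPureOfDim f hX U.2) π hπ (fun hj ↦ hs (hG' j hj)) hE hχ hχ₀

lemma exists_iso_affineSpace {R : Type u} [CommRing R] (ρ : k →+* R) {B : Type u} [CommRing B]
    [Algebra k B] [Algebra.FiniteType k B] (Φ : R ≃+* MvPolynomial (ULift.{u} ℕ) B)
    (hΦ : ∀ c, Φ (ρ c) = MvPolynomial.C (algebraMap k B c)) :
    ∃ (H : Scheme.{u}) (h : H ⟶ Spec (.of k)), LocallyOfFiniteType h ∧ QuasiCompact h ∧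
      ∃ φ : Spec (.of R) ≅ 𝔸(ULift.{u} ℕ; H),
        φ.hom ≫ (𝔸(ULift.{u} ℕ; H) ↘ H) ≫ h = Spec.map (CommRingCat.ofHom ρ) := by
  refine ⟨Spec (.of B), Spec.map (CommRingCat.ofHom (algebraMap k B)), ?_, inferInstance,
    Scheme.Spec.mapIso Φ.toCommRingCatIso.symm.op ≪≫ (AffineSpace.SpecIso _ (.of B)).symm, ?_⟩
  · rw [HasRingHomProperty.Spec_iff (P := @LocallyOfFiniteType)]
    exact (RingHom.finiteType_algebraMap).mpr inferInstance
  · rw [Iso.trans_hom, Iso.symm_hom, Category.assoc, AffineSpace.SpecIso_inv_over_assoc]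
    change Spec.map Φ.toCommRingCatIso.inv ≫ _ = _
    rw [← Spec.map_comp, ← Spec.map_comp]
    congr 1
    rw [Iso.comp_inv_eq]
    exact CommRingCat.hom_ext (RingHom.ext fun c ↦ (hΦ c).symm)

end Strata

/-! ### The stratification of the arc space -/

section Stratification

open Scheme Scheme.AffineZariskiSite

variable {k : Type u} [Field k] {X : Scheme.{u}} (f : X ⟶ Spec (.of k))

/-- The graph of `f` is a section of a base change of the open immersion `g`, hence an open
immersion, and `f` is this graph followed by a base change of `f ≫ g`. -/
lemma locallyOfFinitePresentation_of_comp {X Y Z : Scheme.{u}} (f : X ⟶ Y) (g : Y ⟶ Z)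
    [IsOpenImmersion g] (h : LocallyOfFinitePresentation (f ≫ g)) :
    LocallyOfFinitePresentation f := by
  let q : X ⟶ pullback (f ≫ g) g := pullback.lift (𝟙 X) f (Category.id_comp _)
  have hq : q ≫ pullback.fst _ _ = 𝟙 X := pullback.lift_fst _ _ _
  have : IsOpenImmersion (q ≫ pullback.fst (f ≫ g) g) := hq ▸ inferInstance
  have : IsOpenImmersion q := IsOpenImmersion.of_comp q (pullback.fst (f ≫ g) g)
  have hf : q ≫ pullback.snd (f ≫ g) g = f := pullback.lift_snd _ _ _
  have : LocallyOfFinitePresentation (q ≫ pullback.snd (f ≫ g) g) := inferInstance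
  rwa [hf] at this

lemma exists_fin_affine_cover (X : Scheme.{u}) [CompactSpace X] :
    ∃ (M : ℕ) (U : Fin M → X.AffineZariskiSite), ∀ x : X, ∃ i, x ∈ (U i).1 := by
  obtain ⟨t, ht⟩ := CompactSpace.elim_nhds_subcover
    (fun x : X ↦ ((exists_isAffineOpen_mem_and_subset (X := X) (x := x) (U := ⊤) trivial).choose : Set X))
    fun x ↦ ((exists_isAffineOpen_mem_and_subset (X := X) (x := x) (U := ⊤) trivial).choose.2.mem_nhds
      (exists_isAffineOpen_mem_and_subset (X := X) (x := x) (U := ⊤) trivial).choose_spec.2.1)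
  refine ⟨t.card, fun i ↦ ⟨_, (exists_isAffineOpen_mem_and_subset (X := X)
    (x := (t.equivFin.symm i : X)) (U := ⊤) trivial).choose_spec.1⟩, fun x ↦ ?_⟩
  obtain ⟨y, hy, hx⟩ := Set.mem_iUnion₂.mp (ht.ge (Set.mem_univ x))
  refine ⟨t.equivFin ⟨y, hy⟩, ?_⟩
  simpa using hx

theorem exists_isConstructibleStratification_contactLE [LocallyOfFiniteType f] [QuasiCompact f]
    [IsReduced X] {n : ℕ} (hn : 1 ≤ n) (hX : IsPureOfDim X n) (d : ℕ) :
    ∃ (r : ℕ) (S : Fin r → Scheme.{u})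
      (ι : ∀ i, S i ⟶ (contactLE f (jacobianIdeal f n) d).toScheme),
      IsConstructibleStratification ι ∧
      ∀ i, ∃ (H : Scheme.{u}) (h : H ⟶ Spec (.of k)),
        LocallyOfFiniteType h ∧ QuasiCompact h ∧
        ∃ φ : S i ≅ 𝔸(ULift.{u} ℕ; H),
          φ.hom ≫ (𝔸(ULift.{u} ℕ; H) ↘ H) ≫ h =
            ι i ≫ (contactLE f (jacobianIdeal f n) d).ι ≫ arcSpace.toSpec f := by
  have : IsLocallyNoetherian X := LocallyOfFiniteType.isLocallyNoetherian f
  have : CompactSpace X := QuasiCompact.compactSpace_of_compactSpace f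
  have hqs : QuasiSeparatedSpace (arcSpace f) := quasiSeparatedSpace_arcSpace f
  let W := contactLE f (jacobianIdeal f n) d
  obtain ⟨M, U, hU⟩ := exists_fin_affine_cover X
  choose J G hG₀ hG hGχ using fun i ↦ exists_jacobianIdeal_generators f hn hX (U i)
  obtain ⟨L, hL⟩ : ∃ L, ∀ i, J i ≤ L := ⟨Finset.univ.sup J, fun i ↦ Finset.le_sup (Finset.mem_univ i)⟩
  choose T hT using fun i i' ↦ exists_finset_fromSpec_mem_iff (U i).2 (U i').1
  let β := Fin L ×ₗ Fin (d + 1)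
  let γ (i : Fin M) (b : β) : Γ(X, (U i).1) × ℕ := (G i (ofLex b).1, (ofLex b).2)
  -- The index consists of a chart, a generator and an order `e ≤ d`, in this lexicographic
  -- priority.
  let O (a : Fin M ×ₗ β) : Set (arcSpace f) := arcChart f (U (ofLex a).1) ''
    {y : PrimeSpectrum (arcAlgebra f ⊥ 0 (U (ofLex a).1)) | ArcAlgebra.coeff _ _ _
      (γ (ofLex a).1 (ofLex a).2).1 (γ (ofLex a).1 (ofLex a).2).2 ∉ y.asIdeal}
  have hOopen (a) : IsOpen (O a) := by
    refine (arcChart f (U (ofLex a).1)).isOpenEmbedding.isOpenMap _ ?_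
    exact (PrimeSpectrum.basicOpen _).2
  have hOcompact (a) : IsCompact (O a) := by
    refine IsCompact.image ?_ (arcChart f (U (ofLex a).1)).continuous
    exact PrimeSpectrum.isCompact_basicOpen _
  have hObase (a) (x) (hx : x ∈ O a) : contactGE.toBase f ⊥ 0 x ∈ (U (ofLex a).1).1 := by
    obtain ⟨y, -, rfl⟩ := hx
    exact (contactGE.mem_range_chart f ⊥ 0 (U (ofLex a).1) _).mp ⟨y, rfl⟩
  have hOW (a) (x) (hx : x ∈ O a) : x ∈ W := by
    obtain ⟨y, hy, rfl⟩ := hx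
    refine mem_contactLE_of_coeff_notMem f _ d _ y _ ?_ _ ?_ hy
    · rw [hG]
      exact Ideal.subset_span ⟨_, rfl⟩
    · exact Nat.le_of_lt_succ (ofLex (ofLex a).2).2.2
  have hWO (i) (x) (hx : x ∈ W) (hxi : contactGE.toBase f ⊥ 0 x ∈ (U i).1) :
      ∃ b : β, x ∈ O (toLex (i, b)) := by
    obtain ⟨y, rfl⟩ := (contactGE.mem_range_chart f ⊥ 0 (U i) x).mpr hxi
    obtain ⟨_, ⟨j, rfl⟩, e, he, h⟩ := (arcChart_mem_contactLE_iff f _ d (U i) (hG i) y).mp hx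
    have hj : j < L := by
      by_contra! hj
      rw [hG₀ i j ((hL i).trans hj)] at h
      refine h ?_
      have h0 := congr(PowerSeries.coeff e $(map_zero
        (ArcAlgebra.univ (constants f (U i).1) ((⊥ : X.IdealSheafData).ideal (U i)) 0)))
      have h1 : ArcAlgebra.coeff (constants f (U i).1) ((⊥ : X.IdealSheafData).ideal (U i)) 0 0 e = 0 := by
        simpa [ArcAlgebra.univ] using h0
      exact h1 ▸ Ideal.zero_mem _
    exact ⟨toLex (⟨j, hj⟩, ⟨e, Nat.lt_succ_of_le he⟩), y, h, rfl⟩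
  -- The first conditions put the origin outside the earlier charts; the others kill the earlier
  -- coefficients on the same chart.
  let E (a : Fin M ×ₗ β) : Set (Γ(X, (U (ofLex a).1).1) × ℕ) :=
    (⋃ i < (ofLex a).1, (fun t ↦ (t, 0)) '' (T (ofLex a).1 i : Set Γ(X, (U (ofLex a).1).1))) ∪
      γ (ofLex a).1 '' {b | b < (ofLex a).2}
  have hEfin (a) : (E a).Finite :=
    (Set.Finite.biUnion (Set.toFinite _) fun i _ ↦ (Finset.finite_toSet _).image _).union
      ((Set.toFinite _).image _)
  choose R hR χ hχ himm hlfp hrange using fun a ↦ exists_stratum f (U (ofLex a).1) (hEfin a)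
    (γ (ofLex a).1 (ofLex a).2).1 (γ (ofLex a).1 (ofLex a).2).2
  let s₀ (a) : Spec (.of (R a)) ⟶ arcSpace f :=
    Spec.map (CommRingCat.ofHom (χ a)) ≫ arcChart f (U (ofLex a).1)
  have hs₀ (a x) (hx : x ∈ W) : x ∈ Set.range (s₀ a) ↔ x ∈ O a ∧ ∀ b < a, x ∉ O b := by
    constructor
    · rintro ⟨z, rfl⟩
      let y : PrimeSpectrum (arcAlgebra f ⊥ 0 (U (ofLex a).1)) := Spec.map (CommRingCat.ofHom (χ a)) z
      obtain ⟨h₁, h₂⟩ := (hrange a y).mp ⟨z, rfl⟩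
      refine ⟨⟨y, h₁, rfl⟩, fun b hb hO ↦ ?_⟩
      rcases Prod.Lex.lt_iff.mp hb with h | ⟨h, h'⟩
      · obtain ⟨t, ht, ht'⟩ := (toBase_arcChart_mem_iff f (hT _ _) y).mp (hObase b _ hO)
        exact ht' (h₂ (t, 0) (Or.inl (Set.mem_iUnion₂.mpr ⟨_, h, t, ht, rfl⟩)))
      · obtain ⟨i, b⟩ := b
        obtain ⟨i', b'⟩ := a
        obtain rfl : i = i' := h
        obtain ⟨y', hy', hyy⟩ := hO
        obtain rfl : y' = y := (arcChart f (U i)).injective hyy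
        exact hy' (h₂ (γ i b) (Or.inr ⟨b, h', rfl⟩))
    -- An arc in `W` with origin in an earlier chart belongs to some open set of that chart, by
    -- `hWO`, and so has been removed.
    · rintro ⟨⟨y, hy, rfl⟩, h⟩
      refine (hrange a y).mpr ⟨hy, ?_⟩
      rintro x (hxE | ⟨b, hb, rfl⟩)
      · obtain ⟨i, hi, t, ht, rfl⟩ := Set.mem_iUnion₂.mp hxE
        by_contra hcon
        obtain ⟨b, hb⟩ := hWO i _ hx ((toBase_arcChart_mem_iff f (hT _ _) y).mpr ⟨t, ht, hcon⟩)
        exact h (toLex (i, b)) (Prod.Lex.lt_iff.mpr (Or.inl hi)) hb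
      · by_contra hcon
        exact h (toLex ((ofLex a).1, b)) (Prod.Lex.lt_iff.mpr (Or.inr ⟨rfl, hb⟩)) ⟨y, hcon, rfl⟩
  have hs₀W (a) : Set.range (s₀ a) ⊆ Set.range W.ι := by
    rintro _ ⟨z, rfl⟩
    refine W.range_ι.ge (hOW a _ ⟨Spec.map (CommRingCat.ofHom (χ a)) z, ?_, rfl⟩)
    exact ((hrange a _).mp ⟨z, rfl⟩).1
  let s (a) : Spec (.of (R a)) ⟶ W.toScheme := IsOpenImmersion.lift W.ι (s₀ a) (hs₀W a)
  have hs (a) : s a ≫ W.ι = s₀ a := IsOpenImmersion.lift_fac W.ι (s₀ a) (hs₀W a)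
  have hWeq : (W : Set (arcSpace f)) = ⋃ a, O a := by
    refine Set.Subset.antisymm (fun x hx ↦ ?_) (Set.iUnion_subset fun a x hx ↦ hOW a x hx)
    obtain ⟨i, hi⟩ := hU (contactGE.toBase f ⊥ 0 x)
    obtain ⟨b, hb⟩ := hWO i x hx hi
    exact Set.mem_iUnion.mpr ⟨_, hb⟩
  have hWc : CompactSpace W.toScheme := by
    have : IsCompact (W : Set (arcSpace f)) := hWeq ▸ isCompact_iUnion hOcompact
    exact isCompact_iff_compactSpace.mp this
  have hWqs : QuasiSeparatedSpace W.toScheme :=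
    W.ι.isOpenEmbedding.quasiSeparatedSpace
  obtain ⟨r, σ, hσ⟩ := exists_isConstructibleStratification (Y := W.toScheme)
    (fun a : Fin M ×ₗ β ↦ W.ι ⁻¹' O a) (fun a ↦ (hOopen a).preimage W.ι.continuous)
    (fun y ↦ by obtain ⟨a, ha⟩ := Set.mem_iUnion.mp (hWeq.le y.2); exact ⟨a, ha⟩) s
    (fun a ↦ by
      have : IsImmersion (s a ≫ W.ι) := hs a ▸ himm a
      exact IsImmersion.of_comp (s a) W.ι)
    (fun a ↦ locallyOfFinitePresentation_of_comp (s a) W.ι (hs a ▸ hlfp a))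
    (fun a ↦ inferInstance)
    (fun a y ↦ by
      refine Iff.trans ?_ (hs₀ a (W.ι y) y.2)
      constructor
      · rintro ⟨z, rfl⟩
        exact ⟨z, by rw [← hs a, Scheme.Hom.comp_apply]⟩
      · rintro ⟨z, hz⟩
        refine ⟨z, W.ι.injective ?_⟩
        rw [← hz, ← hs a, Scheme.Hom.comp_apply])
  refine ⟨r, _, _, hσ, fun i ↦ ?_⟩
  let a := σ i
  -- The pairs with the same generator and a smaller order precede `a`, so their coefficients vanish
  -- on the stratum and the order is exact.
  obtain ⟨B, _, _, hB, Φ, hΦ⟩ := hGχ (ofLex a).1 (ofLex (ofLex a).2).1 (E a) (ofLex (ofLex a).2).2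
    (R a) (χ a) (hEfin a) (hχ a) (fun e he ↦ Or.inr
      ⟨toLex ((ofLex (ofLex a).2).1, ⟨e, he.trans (ofLex (ofLex a).2).2.2⟩),
        Prod.Lex.lt_iff.mpr (Or.inr ⟨rfl, he⟩), rfl⟩)
  obtain ⟨H, h, hh, hh', φ, hφ⟩ := exists_iso_affineSpace ((χ a).comp ((ArcAlgebra.of
    (constants f (U (ofLex a).1).1) ((⊥ : X.IdealSheafData).ideal (U (ofLex a).1)) 0).comp
      (constants f (U (ofLex a).1).1))) Φ hΦ
  refine ⟨H, h, hh, hh', φ, hφ.trans ?_⟩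
  have h₁ : s a ≫ W.ι ≫ arcSpace.toSpec f = s₀ a ≫ arcSpace.toSpec f := by
    rw [← hs a, Category.assoc]
  refine Eq.trans ?_ h₁.symm
  refine Eq.trans ?_ (Category.assoc _ _ _).symm
  refine Eq.trans ?_ (congrArg (fun q ↦ Spec.map (CommRingCat.ofHom (χ a)) ≫ q)
    (arcChart_toSpec f (U (ofLex a).1)).symm)
  exact Spec.map_comp (CommRingCat.ofHom ((ArcAlgebra.of (constants f (U (ofLex a).1).1)
    ((⊥ : X.IdealSheafData).ideal (U (ofLex a).1)) 0).comp (constants f (U (ofLex a).1).1)))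
    (CommRingCat.ofHom (χ a))

end Stratification

end ArcSpaces

end

theorem mainTheorem2 {k : Type u} [Field k] [IsAlgClosed k] :
    (∀ (X : Scheme.{u}) (f : X ⟶ Spec (.of k)) [LocallyOfFiniteType f] [QuasiCompact f]
        [IsReduced X] (n : ℕ), 1 ≤ n → ArcSpaces.IsPureOfDim X n → ∀ d : ℕ,
      ∃ (r : ℕ) (S : Fin r → Scheme.{u})
        (ι : ∀ i, S i ⟶ (ArcSpaces.contactLE f (ArcSpaces.jacobianIdeal f n) d).toScheme),
        ArcSpaces.IsConstructibleStratification ι ∧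
        ∀ i, ∃ (H : Scheme.{u}) (h : H ⟶ Spec (.of k)),
          LocallyOfFiniteType h ∧ QuasiCompact h ∧
          ∃ φ : S i ≅ 𝔸(ULift.{u} ℕ; H),
            φ.hom ≫ (𝔸(ULift.{u} ℕ; H) ↘ H) ≫ h =
              ι i ≫ (ArcSpaces.contactLE f (ArcSpaces.jacobianIdeal f n) d).ι ≫
                ArcSpaces.arcSpace.toSpec f) ∧
    (∀ (m l : ℕ) (p : Fin l → MvPolynomial (Fin m ⊕ Fin l) k) (d : ℕ),
      ∃ (D : Scheme.{u}) (h : D ⟶ Spec (.of k)),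
        LocallyOfFiniteType h ∧ QuasiCompact h ∧
        ∃ φ : ArcSpaces.contactEQ (ArcSpaces.specialCI.toSpec p)
              (ArcSpaces.specialCI.singularIdeal p) d ≅
            pullback h (ArcSpaces.arcSpace.toSpec
              (𝔸(ULift.{u} (Fin m); Spec (.of k)) ↘ Spec (.of k))),
          φ.hom ≫ pullback.fst _ _ ≫ h =
            ArcSpaces.contactEQ.toSpec (ArcSpaces.specialCI.toSpec p)
              (ArcSpaces.specialCI.singularIdeal p) d) :=
  ⟨fun _ f _ _ _ _ hn hX d ↦
    ArcSpaces.exists_isConstructibleStratification_contactLE f hn hX d,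
  fun m l p d ↦ ArcSpaces.exists_contactEQ_specialCI_iso m l p d⟩
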